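/- Conventions. $E$ is a finite set and all matroids have ground set $E$. A laminar matroid is given explicitly by a family $\mathcal L\subseteq 2^E$, any two members of which are disjoint or nested, and capacities $c\colon\mathcal L\to\mathbb Z_{\ge 0}$; its independent sets are the $I\subseteq E$ with $|I\cap A|\le c(A)$ for all $A\in\mathcal L$. For an independent set $X$ of a matroid $\mathcal M$ and $x\in X$, a set $Y\subseteq E$ is $(X,x)$-exchangeable if $x\in Y$ and $(X\setminus\{x\})\cup\{y\}$ is independent for every $y\in Y$. For $\mathcal F\subseteq 2^E$, $w\colon E\to\mathbb R_{\ge 0}$ and $k\ge 1$, a random set $R\subseteq E$ is a reachable kernel if for every $\{x_1,\dots,x_t\}\in\mathcal F$ with $x_1,\dots,x_t$ distinct and $t\le k$, with probability at least $2/3$ there are $y_1,\dots,y_t\in R$ such that, for every $i\in\{1,\dots,t\}$, $w(y_i)\ge w(x_i)$ and $\{y_1,\dots,y_i,x_{i+1},\dots,x_t\}$ is a set of size $t$ in $\mathcal F$. Algorithms are randomized, and their time bounds and output-size bounds hold for all outcomes of the random choices. Procedure FindCandidate. Fix a positive integer $k$ and a laminar matroid without loops, with representation $(\mathcal L,c)$.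 Normalize: put $E$ into $\mathcal L$ with capacity $k$ (the minimum of $k$ and its capacity, if $E\in\mathcal L$ already), put all singletons into $\mathcal L$, give all sets with at most one element capacity $1$, and remove every set that has a superset of smaller capacity. For $\mathcal Z\subseteq\mathcal L$ let $\mathrm{height}(\mathcal Z)=\max_{A\in\mathcal Z}c(A)$ ($0$ if $\mathcal Z=\emptyset$), and let $\mathcal Z_i$ be the family of inclusionwise maximal sets among all $A\in\mathcal L$ with $c(A)\le i$ that lie in a member of $\mathcal Z$. Let $h=\mathrm{height}(\mathcal Z)$. If $h\le 1$, FindCandidate$(\mathcal Z)$ returns $\{\bigcup\mathcal Z\}$. If $h\ge 2$, then for each $i\in\{\lceil h/2\rceil,\dots,h-1\}$ it samples each set of $\mathcal Z_i$ independently with probability $1/k$ to obtain $\mathcal Z'$, samples each set of $\mathcal Z'_{h-i}$ independently with probability $1/k$ to obtain $\mathcal Z''$, and calls FindCandidate$(\mathcal Z'')$; it returns the union of the families so obtained. Theorem. (1) In FindCandidate, $\mathrm{height}(\mathcal Z'')\le\frac12\mathrm{height}(\mathcal Z)$ always. There is a constant $C$ such that for every finite set $E$, every $k\ge 1$ and every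 laminar matroid on $E$ without loops, FindCandidate$(\{E\})$ returns at most $k^{C\log k}$ sets, and for every independent $X$ with $|X|\le k$ and every $x\in X$, an $(X,x)$-exchangeable set is among them with probability at least $k^{-C\log k}$. (2) There are a constant $C$ and a randomized algorithm that, given an explicitly represented laminar matroid on $E$ and $k\ge1$, returns in time polynomial in $|E|$ a family $\mathcal Y\subseteq 2^E$ with $|\mathcal Y|\le k^{C\log k}$ such that, for every independent $X$ with $|X|\le k$ and every $x\in X$, $\mathcal Y$ contains an $(X,x)$-exchangeable set with probability at least $k^{-C\log k}$. (3) There are a constant $C$ and a randomized algorithm that, given $k,d\ge 1$, weights $w\colon E\to\mathbb R_{\ge0}$ (accessed by comparisons), an arbitrary matroid $\mathcal M_0=(E,\mathcal I_0)$ by an independence oracle, and explicitly represented laminar matroids $\mathcal M_i=(E,\mathcal I_i)$, $1\le i\le d-1$, returns in time polynomial in $|E|$ and $d$ a random set $R\subseteq E$ with $|R|\le k^{C d\log k}$ that is a reachable kernel with respect to $\mathcal F=\bigcap_{i=0}^{d-1}\mathcal I_i$, $w$ and $k$. -/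

import Mathlib

open scoped NNReal ENNReal

/-! ### Laminar matroids, exchangeable sets, reachable kernels -/

/-- An explicit representation of a laminar matroid on `E`: a list of distinct sets, any two of
which are disjoint or nested, with a capacity for each. Values of `cap` off the list are ignored. -/
structure LaminarRep (E : Type) [DecidableEq E] where
  sets : List (Finset E)
  nodup : sets.Nodup
  cap : Finset E → ℕ
  laminar : ∀ A ∈ sets, ∀ B ∈ sets, (A ∩ B).Nonempty → A ⊆ B ∨ B ⊆ A

/-- The matroid `M` with ground set `E` is the laminar matroid given by `L`. -/
def LaminarRep.Represents {E : Type} [DecidableEq E] (L : LaminarRep E) (M : Matroid E) : Prop :=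
  M.E = Set.univ ∧ ∀ I : Finset E, M.Indep (I : Set E) ↔ ∀ A ∈ L.sets, (I ∩ A).card ≤ L.cap A

/-- `Y` is an `(X, x)`-exchangeable set with respect to `M`. -/
def IsExchangeable {E : Type} [DecidableEq E] (M : Matroid E) (X : Finset E) (x : E)
    (Y : Finset E) : Prop :=
  x ∈ Y ∧ ∀ y ∈ Y, M.Indep ((insert y (X.erase x) : Finset E) : Set E)

/-- The set `{y₁, …, yᵢ, xᵢ₊₁, …, x_t}` (with indices starting from `0`). -/
def exchanged {E : Type} [DecidableEq E] {t : ℕ} (x y : Fin t → E) (i : Fin t) : Finset E :=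
  Finset.univ.image fun j => if j ≤ i then y j else x j

/-- A random set, given by its law `μ`, is a reachable kernel with respect to the feasible
family `F`, the weights `w` and the integer `k`. -/
def IsReachableKernel {E : Type} [DecidableEq E] (F : Set (Finset E)) (w : E → ℝ≥0) (k : ℕ)
    (μ : PMF (Finset E)) : Prop :=
  ∀ (t : ℕ) (x : Fin t → E), t ≤ k → Function.Injective x → Finset.univ.image x ∈ F →
    2 / 3 ≤ μ.toOuterMeasure {R | ∃ y : Fin t → E, ∀ i : Fin t,
      y i ∈ R ∧ w (x i) ≤ w (y i) ∧ (exchanged x y i).card = t ∧ exchanged x y i ∈ F}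

/-! ### The recursive sampling procedure `FindCandidate` -/

theorem sum_sample_eq_one {α : Type} (S : Finset α) (k : ℕ) :
    ∑ T ∈ S.powerset, (((k : ℝ≥0)⁻¹ : ℝ≥0) : ℝ≥0∞) ^ T.card *
      ((1 - (k : ℝ≥0)⁻¹ : ℝ≥0) : ℝ≥0∞) ^ (S.card - T.card) = 1 := by
  rw [Finset.sum_pow_mul_eq_add_pow, ← ENNReal.coe_add, add_tsub_cancel_of_le, ENNReal.coe_one,
    one_pow]
  rcases Nat.eq_zero_or_pos k with rfl | h
  · simp
  · exact inv_le_one_of_one_le₀ (by exact_mod_cast h)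

/-- The law of the random subset of `S` that contains each member of `S` independently with
probability `1 / k`. -/
noncomputable def sampleEach {α : Type} [DecidableEq α] (S : Finset α) (k : ℕ) :
    PMF (Finset α) :=
  PMF.ofFinset
    (fun T => if T ⊆ S then (((k : ℝ≥0)⁻¹ : ℝ≥0) : ℝ≥0∞) ^ T.card *
      ((1 - (k : ℝ≥0)⁻¹ : ℝ≥0) : ℝ≥0∞) ^ (S.card - T.card) else 0)
    S.powerset
    (by
      rw [← sum_sample_eq_one S k]
      exact Finset.sum_congr rfl fun T hT => if_pos (Finset.mem_powerset.1 hT))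
    (fun T hT => if_neg fun h => hT (Finset.mem_powerset.2 h))

/-- The largest capacity of a set in `Z` (`0` if `Z` is empty). -/
def height {E : Type} (c : Finset E → ℕ) (Z : Finset (Finset E)) : ℕ := Z.sup c

/-- `Z_i`: the inclusionwise maximal sets among the `A ∈ 𝓛` that lie in a member of `Z` and have
capacity at most `i`. -/
def refinement {E : Type} [DecidableEq E] (𝓛 : Finset (Finset E)) (c : Finset E → ℕ)
    (Z : Finset (Finset E)) (i : ℕ) : Finset (Finset E) :=
  let 𝒜 := 𝓛.filter fun A => (∃ B ∈ Z, A ⊆ B) ∧ c A ≤ i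
  𝒜.filter fun A => ∀ B ∈ 𝒜, A ⊆ B → A = B

/-- The law of the family `Z''` that is obtained from `Z` by sampling `Z'` from `Z_i` and then
`Z''` from `Z'_{h-i}`, where `h` is the height of `Z`. -/
noncomputable def doubleSample {E : Type} [DecidableEq E] (𝓛 : Finset (Finset E))
    (c : Finset E → ℕ) (k : ℕ) (Z : Finset (Finset E)) (i : ℕ) : PMF (Finset (Finset E)) :=
  (sampleEach (refinement 𝓛 c Z i) k).bind fun Z' =>
    sampleEach (refinement 𝓛 c Z' (height c Z - i)) k

/-- Run `f i` for the successive members `i` of a list, with fresh randomness each time, and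
return the union of the families obtained. -/
noncomputable def unionOver {α : Type} [DecidableEq α] (f : ℕ → PMF (Finset α)) :
    List ℕ → PMF (Finset α)
  | [] => PMF.pure ∅
  | i :: is => (f i).bind fun Y => (unionOver f is).bind fun Y' => PMF.pure (Y ∪ Y')

/-- The recursive procedure with a bound on the depth of the recursion. The height of the
argument at least halves in each recursive call, so the bound never takes effect when it is at
least the height of `Z`. -/
noncomputable def findCandidateAux {E : Type} [DecidableEq E] (𝓛 : Finset (Finset E))
    (c : Finset E → ℕ) (k : ℕ) : ℕ → Finset (Finset E) → PMF (Finset (Finset E))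
  | 0, Z => PMF.pure {Z.sup id}
  | fuel + 1, Z =>
    if height c Z ≤ 1 then PMF.pure {Z.sup id}
    else
      -- all `i` with `⌈h / 2⌉ ≤ i ≤ h - 1`, where `h` is the height of `Z`
      unionOver (fun i => (doubleSample 𝓛 c k Z i).bind (findCandidateAux 𝓛 c k fuel))
        (List.Ico ((height c Z + 1) / 2) (height c Z))

/-- `FindCandidate(Z)`, as the law of its output. -/
noncomputable def findCandidate {E : Type} [DecidableEq E] (𝓛 : Finset (Finset E))
    (c : Finset E → ℕ) (k : ℕ) (Z : Finset (Finset E)) : PMF (Finset (Finset E)) :=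
  findCandidateAux 𝓛 c k (height c Z) Z

/-- Normalized capacities: `1` on singletons, and at most `k` on the whole ground set. -/
def LaminarRep.normCap {E : Type} [Fintype E] [DecidableEq E] (L : LaminarRep E) (k : ℕ)
    (A : Finset E) : ℕ :=
  if A.card ≤ 1 then 1
  else if A = Finset.univ then (if A ∈ L.sets then min (L.cap A) k else k)
  else L.cap A

/-- The normalized laminar family: add the ground set and all singletons, then remove each set
that has a superset of smaller capacity. For a loopless matroid it has the same independent sets
of size at most `k` as `L`. -/
def LaminarRep.normSets {E : Type} [Fintype E] [DecidableEq E] (L : LaminarRep E) (k : ℕ) :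
    Finset (Finset E) :=
  let 𝒜 : Finset (Finset E) :=
    insert Finset.univ (L.sets.toFinset ∪ Finset.univ.image fun e => {e})
  𝒜.filter fun A => ∀ B ∈ 𝒜, A ⊆ B → L.normCap k A ≤ L.normCap k B

/-! ### Randomized random access machine programs with an independence oracle

Programs in a small structured language over natural numbers, with addition and truncated
subtraction as the only arithmetic, and arrays with three indices. Each executed command and each
test of a loop or a conditional costs one time unit. -/

/-- Expressions. `get a i j l` reads the cell `(i, j, l)` of the array `a`. -/
inductive Expr : Type where
  | num (v : ℕ)
  | var (x : ℕ)
  | add (e f : Expr)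
  | sub (e f : Expr)
  | get (a : ℕ) (i j l : Expr)

/-- Programs. -/
inductive Cmd : Type where
  | skip
  /-- `x := e` -/
  | assign (x : ℕ) (e : Expr)
  /-- write `e` to the cell `(i, j, l)` of the array `a` -/
  | put (a : ℕ) (i j l e : Expr)
  /-- `x :=` a uniformly random number smaller than the value of `e` (`0` if this value is `0`) -/
  | rand (x : ℕ) (e : Expr)
  /-- `x := 1` if the set of all `s` whose cell `(i, s, 0)` of the array `a` is nonzero is
  independent according to the oracle, and `x := 0` otherwise -/
  | query (x : ℕ) (a : ℕ) (i : Expr)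
  /-- `x := 1` if the elements `e` and `f` satisfy `w e ≤ w f`, and `x := 0` otherwise -/
  | compare (x : ℕ) (e f : Expr)
  | seq (p q : Cmd)
  /-- execute `p` if the value of `e` is nonzero, otherwise `q` -/
  | cond (e : Expr) (p q : Cmd)
  /-- execute `p` as long as the value of `e` is nonzero -/
  | loop (e : Expr) (p : Cmd)

/-- Contents of the variables and of the arrays. -/
structure Store where
  var : ℕ → ℕ
  arr : ℕ → ℕ → ℕ → ℕ → ℕ

def Store.setVar (σ : Store) (x v : ℕ) : Store :=
  { σ with var := Function.update σ.var x v }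

def Store.setArr (σ : Store) (a i j l v : ℕ) : Store :=
  { σ with arr := fun a' i' j' l' =>
      if a' = a ∧ i' = i ∧ j' = j ∧ l' = l then v else σ.arr a' i' j' l' }

def Expr.eval (σ : Store) : Expr → ℕ
  | .num v => v
  | .var x => σ.var x
  | .add e f => e.eval σ + f.eval σ
  | .sub e f => e.eval σ - f.eval σ
  | .get a i j l => σ.arr a (i.eval σ) (j.eval σ) (l.eval σ)

/-- Row `i` of the array `a`, read as the indicator of a subset of `{0, …, n - 1}`. -/
def Store.row (σ : Store) (n a i : ℕ) : Finset (Fin n) :=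
  Finset.univ.filter fun s => σ.arr a i s 0 ≠ 0

/-- The part of the input that a program accesses only through queries: an independence oracle and
weights, of which only comparisons are available. -/
structure Env (n : ℕ) where
  indep : Finset (Fin n) → Prop
  weight : Fin n → ℝ≥0

open Classical in
/-- The answer to an oracle query. -/
noncomputable def Env.query {n : ℕ} (env : Env n) (S : Finset (Fin n)) : ℕ :=
  if env.indep S then 1 else 0

open Classical in
/-- The answer to a comparison of weights. -/
noncomputable def Env.compare {n : ℕ} (env : Env n) (a b : ℕ) : ℕ :=
  if ∃ (ha : a < n) (hb : b < n), env.weight ⟨a, ha⟩ ≤ env.weight ⟨b, hb⟩ then 1 else 0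

/-- A uniformly random natural number smaller than `m`, and `0` if `m = 0`. -/
noncomputable def uniformBelow : ℕ → PMF ℕ
  | 0 => PMF.pure 0
  | m + 1 => (PMF.uniformOfFintype (Fin (m + 1))).map fun v => (v : ℕ)

/-- The law of the configuration after one step. A configuration is the list of the programs that
remain to be executed, with the current store; it has halted if the list is empty. -/
noncomputable def step {n : ℕ} (env : Env n) : List Cmd × Store → PMF (List Cmd × Store)
  | ([], σ) => PMF.pure ([], σ)
  | (.skip :: K, σ) => PMF.pure (K, σ)
  | (.assign x e :: K, σ) => PMF.pure (K, σ.setVar x (e.eval σ))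
  | (.put a i j l e :: K, σ) =>
      PMF.pure (K, σ.setArr a (i.eval σ) (j.eval σ) (l.eval σ) (e.eval σ))
  | (.rand x e :: K, σ) => (uniformBelow (e.eval σ)).map fun v => (K, σ.setVar x v)
  | (.query x a i :: K, σ) => PMF.pure (K, σ.setVar x (env.query (σ.row n a (i.eval σ))))
  | (.compare x e f :: K, σ) => PMF.pure (K, σ.setVar x (env.compare (e.eval σ) (f.eval σ)))
  | (.seq p q :: K, σ) => PMF.pure (p :: q :: K, σ)
  | (.cond e p q :: K, σ) => PMF.pure ((if e.eval σ ≠ 0 then p else q) :: K, σ)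
  | (.loop e p :: K, σ) => PMF.pure (if e.eval σ ≠ 0 then p :: .loop e p :: K else K, σ)

/-- The law of the configuration after `T` steps. -/
noncomputable def run {n : ℕ} (env : Env n) : ℕ → List Cmd × Store → PMF (List Cmd × Store)
  | 0, s => PMF.pure s
  | T + 1, s => (step env s).bind (run env T)

/-- From the store `σ`, the program `P` halts within `T` steps, whatever its random choices. -/
def HaltsWithin {n : ℕ} (env : Env n) (P : Cmd) (σ : Store) (T : ℕ) : Prop :=
  ∀ s ∈ (run env T ([P], σ)).support, s.1 = []

/-- The initial store for the parameter `k` and the explicit representations of `m` laminar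
matroids on `{0, …, n - 1}`. The variables `0`, `1`, `2` hold `n`, `k`, `m`. The cell `(i, 0, 0)`
of array `0` holds the number of sets in the `i`-th family, the cell `(i, j, 0)` of array `1` the
capacity of the `j`-th of these sets, and the cell `(i, j, s)` of array `2` tells whether `s`
belongs to this set. -/
def initialStore {n m : ℕ} (k : ℕ) (L : Fin m → LaminarRep (Fin n)) : Store where
  var x := if x = 0 then n else if x = 1 then k else if x = 2 then m else 0
  arr a i j l :=
    if hi : i < m then
      if a = 0 ∧ j = 0 ∧ l = 0 then (L ⟨i, hi⟩).sets.length
      else if hj : j < (L ⟨i, hi⟩).sets.length then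
        if a = 1 ∧ l = 0 then (L ⟨i, hi⟩).cap ((L ⟨i, hi⟩).sets[j])
        else if hl : l < n then
          if a = 2 ∧ (⟨l, hl⟩ : Fin n) ∈ (L ⟨i, hi⟩).sets[j] then 1 else 0
        else 0
      else 0
    else 0

/-- Output of a set: row `0` of the array `3`. -/
def outputSet (n : ℕ) (s : List Cmd × Store) : Finset (Fin n) := s.2.row n 3 0

/-- Output of a family of sets: the rows `0, …, N - 1` of the array `3`, where `N` is the value of
the variable `0`. -/
def outputFamily (n : ℕ) (s : List Cmd × Store) : Finset (Finset (Fin n)) :=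
  (Finset.range (s.2.var 0)).image fun j => s.2.row n 3 j

/-- The environment without any information (no matroid oracle, all weights zero). -/
def Env.trivial (n : ℕ) : Env n where
  indep _ := False
  weight _ := 0

/-!
The combinatorial core is a description of failing exchanges. In a laminar matroid, exchanging
`x ∈ X` for `y` destroys independence only if `y` lies in a tight set without `x`, that is, a set
`B` with `x ∉ B` and `c B ≤ |X ∩ B|` (`tight_of_exchange_violates`). So a set is exchangeable as
soon as it contains `x` and avoids all tight sets without `x`.

*The procedure `FindCandidate`.* The recursion keeps the family `Z` focused: only one member of
`Z` meets `X`, it contains `x`, and it includes every tight set without `x` that meets `⋃ Z`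
(`Focused`). If `h` is the height and `b` the largest capacity of a tight set without `x` inside
that member, the level `i = max b ⌈h / 2⌉` makes the two sampling steps preserve this
(`exists_good_level`): the first one cannot cut through a tight set, and all tight sets inside the
member of `Z'` that contains `x` have capacity at most `h - i`, since either `b < ⌈h / 2⌉`, or they
are disjoint from a tight set of capacity `b`. Each sampling step has to keep one of at most `k` disjoint sets that meet `X`
and to drop the others, which has probability at least `k⁻²` (`sampleEach_isolate`). The height
halves, so there are at most `log₂ k` such steps.

*The algorithm for candidate sets.* The program guesses a single set. There are `log₂ k` levels
such that each tight set without `x` (of positive capacity) is separated from `x` by one of them: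
it lies in a maximal set of capacity at most `i` that does not contain `x`
(`LaminarRep.exists_levels`). In each round, the program guesses a level and tosses a coin with `k`
sides for each maximal set of at most this capacity, and keeps the elements whose coin shows `0`.
With probability at least `k⁻³`, the level is the right one, the coin of `x` shows `0` and the coins
of the other elements of `X` do not (`guessRound_spec`). Hence the guess is exchangeable with
probability `k ^ (-3 log₂ k)` (`guess_spec`). A maximal set is never computed: the coin of an
element is copied from a smaller element of a common set of capacity at most `i`.

*Reachable kernels.* One trial intersects independent guesses for all laminar matroids, and adds a
greedy independent set of `k` heaviest elements of the remaining candidates with respect to `M₀`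
to the output. If all guesses succeed, then the greedy set contains an element of weight at least
`w x` by which `x` can be exchanged (`GreedyInv.exists_replacement`). As long as
`y₁, …, yⱼ` have been found, a trial finds the next element with probability at least
`q = k ^ (-3 (d - 1) log₂ k)`, and `t ≤ k` successes suffice. By an exponential moment bound,
`k ^ (4 d log₂ k)` trials contain `k` successes with probability at least `2 / 3`
(`two_thirds_le_successProb`). If this number of trials is at least `|E|`, the program outputs `E`
instead, which keeps the running time polynomial. The programs work with `min k |E|` in place of
`k`.

Running times and probabilities are derived in a program logic. The judgment `Triple` bounds the
number of steps for all random choices, asserts a postcondition for all outcomes, and bounds the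
expectation of a potential from below. It is sound for the step relation of the machine model
(`BigStep.halts`), and loops are handled by an invariant together with a potential whose expectation
does not decrease (`Triple.times`).
-/

/-! ### Expectations -/

/-- The expectation of a nonnegative function. -/
noncomputable def expect {α : Type*} (μ : PMF α) (Φ : α → ℝ≥0∞) : ℝ≥0∞ := ∑' a, μ a * Φ a

theorem expect_pure {α : Type*} (a : α) (Φ : α → ℝ≥0∞) : expect (PMF.pure a) Φ = Φ a := by
  rw [expect, tsum_eq_single a]
  · simp
  · intro b hb
    simp [hb]

theorem expect_bind {α β : Type*} (μ : PMF α) (f : α → PMF β) (Φ : β → ℝ≥0∞) :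
    expect (μ.bind f) Φ = expect μ fun a => expect (f a) Φ := by
  simp only [expect, PMF.bind_apply, ← ENNReal.tsum_mul_right, ← ENNReal.tsum_mul_left]
  rw [ENNReal.tsum_comm]
  simp only [mul_assoc]

theorem expect_map {α β : Type*} (μ : PMF α) (f : α → β) (Φ : β → ℝ≥0∞) :
    expect (μ.map f) Φ = expect μ fun a => Φ (f a) := by
  rw [PMF.map, expect_bind]
  simp [expect_pure]

theorem expect_mono {α : Type*} {μ : PMF α} {Φ Ψ : α → ℝ≥0∞} (h : ∀ a ∈ μ.support, Φ a ≤ Ψ a) :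
    expect μ Φ ≤ expect μ Ψ := by
  refine ENNReal.tsum_le_tsum fun a => ?_
  by_cases ha : a ∈ μ.support
  · exact mul_le_mul_right (h a ha) _
  · rw [(PMF.apply_eq_zero_iff _ _).2 ha]
    simp

theorem expect_const {α : Type*} (μ : PMF α) (r : ℝ≥0∞) : expect μ (fun _ => r) = r := by
  rw [expect, ENNReal.tsum_mul_right, PMF.tsum_coe, one_mul]

theorem le_expect {α : Type*} {μ : PMF α} {Φ : α → ℝ≥0∞} {r : ℝ≥0∞}
    (h : ∀ a ∈ μ.support, r ≤ Φ a) : r ≤ expect μ Φ :=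
  (expect_const μ r).symm.le.trans (expect_mono h)

theorem expect_indicator {α : Type*} (μ : PMF α) (A : Set α) :
    expect μ (A.indicator 1) = μ.toOuterMeasure A := by
  rw [PMF.toOuterMeasure_apply, expect]
  refine tsum_congr fun a => ?_
  by_cases ha : a ∈ A <;> simp [ha]

theorem toOuterMeasure_mono_support {α : Type*} {μ : PMF α} {A B : Set α}
    (h : ∀ a ∈ μ.support, a ∈ A → a ∈ B) : μ.toOuterMeasure A ≤ μ.toOuterMeasure B :=
  PMF.toOuterMeasure_mono μ fun a ha => h a ha.2 ha.1

theorem toOuterMeasure_eq_one_of_forall {α : Type*} {μ : PMF α} {A : Set α}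
    (h : ∀ a ∈ μ.support, a ∈ A) : μ.toOuterMeasure A = 1 :=
  (PMF.toOuterMeasure_apply_eq_one_iff _ _).2 h

theorem mul_le_toOuterMeasure_bind {α β : Type*} {μ : PMF α} {f : α → PMF β} {A : Set α}
    {B : Set β} {q r : ℝ≥0∞} (hq : q ≤ μ.toOuterMeasure A)
    (hr : ∀ a ∈ μ.support, a ∈ A → r ≤ (f a).toOuterMeasure B) :
    q * r ≤ (μ.bind f).toOuterMeasure B := by
  rw [← expect_indicator, expect_bind]
  calc q * r ≤ μ.toOuterMeasure A * r := mul_le_mul_left hq _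
    _ = expect μ (fun a => A.indicator 1 a * r) := by
      rw [← expect_indicator, expect, expect, ← ENNReal.tsum_mul_right]
      simp only [mul_assoc]
    _ ≤ _ := by
      refine expect_mono fun a ha => ?_
      rw [expect_indicator]
      by_cases h : a ∈ A
      · simpa [h] using hr a ha h
      · simp [h]

/-- If an event has probability at least `q`, then a function that is at least `a` on the event
and at least `b ≤ a` elsewhere has expectation at least `q * a + (1 - q) * b`. -/
theorem convex_le_expect {α : Type*} {μ : PMF α} {A : Set α} {q a b : ℝ≥0∞} {Φ : α → ℝ≥0∞}
    (hq : q ≤ μ.toOuterMeasure A) (hba : b ≤ a)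
    (ha : ∀ s ∈ μ.support, s ∈ A → a ≤ Φ s) (hb : ∀ s ∈ μ.support, b ≤ Φ s) :
    q * a + (1 - q) * b ≤ expect μ Φ := by
  have hq1 : q ≤ 1 := hq.trans (by
    rw [← toOuterMeasure_eq_one_of_forall (μ := μ) (A := Set.univ) (by simp)]
    exact PMF.toOuterMeasure_mono μ (by simp))
  obtain ⟨d, rfl⟩ := exists_add_of_le hba
  calc q * (b + d) + (1 - q) * b = (q + (1 - q)) * b + q * d := by ring
    _ = b + q * d := by rw [add_tsub_cancel_of_le hq1, one_mul]
    _ ≤ b + μ.toOuterMeasure A * d := by gcongr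
    _ = expect μ (fun s => b + A.indicator 1 s * d) := by
      rw [← expect_indicator, expect, expect, ← ENNReal.tsum_mul_right]
      simp only [mul_add, ENNReal.tsum_add, mul_assoc]
      rw [ENNReal.tsum_mul_right, PMF.tsum_coe, one_mul]
    _ ≤ _ := by
      refine expect_mono fun s hs => ?_
      by_cases h : s ∈ A
      · simpa [h] using ha s hs h
      · simpa [h] using hb s hs

/-! ### Isolating one element by sampling -/

theorem inv_le_one_sub_inv_pow {k m : ℕ} (hk : 1 ≤ k) (hm : m + 1 ≤ k) :
    ((k : ℝ≥0)⁻¹ : ℝ≥0) ≤ (1 - (k : ℝ≥0)⁻¹ : ℝ≥0) ^ m := by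
  have hk0 : (0 : ℝ) < k := by exact_mod_cast hk
  have h1 : (k : ℝ≥0)⁻¹ ≤ 1 := inv_le_one_of_one_le₀ (by exact_mod_cast hk)
  rw [← NNReal.coe_le_coe, NNReal.coe_pow, NNReal.coe_sub h1]
  push_cast
  have h2 := one_add_mul_le_pow (a := -(k : ℝ)⁻¹) (by
    have : (k : ℝ)⁻¹ ≤ 1 := inv_le_one_of_one_le₀ (by exact_mod_cast hk)
    linarith) m
  rw [← sub_eq_add_neg] at h2
  refine le_trans ?_ h2
  have h3 : (m : ℝ) + 1 ≤ k := by exact_mod_cast hm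
  have h4 : (k : ℝ) * (k : ℝ)⁻¹ = 1 := mul_inv_cancel₀ hk0.ne'
  nlinarith [inv_pos.2 hk0]

/-- Sampling with probability `1 / k` isolates a member `a` of a set of at most `k` elements with
probability at least `1 / k ^ 2`. -/
theorem sampleEach_isolate {α : Type} [DecidableEq α] {S G : Finset α} (hG : G ⊆ S) {a : α}
    (ha : a ∈ G) {k : ℕ} (hk : G.card ≤ k) :
    ((k : ℝ≥0∞)⁻¹) ^ 2 ≤
      (sampleEach S k).toOuterMeasure {T | a ∈ T ∧ ∀ b ∈ G, b ∈ T → b = a} := by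
  have hG1 : 1 ≤ G.card := Finset.card_pos.2 ⟨a, ha⟩
  have hk1 : 1 ≤ k := hG1.trans hk
  have hkc : ((k : ℝ≥0∞)⁻¹) = (((k : ℝ≥0)⁻¹ : ℝ≥0) : ℝ≥0∞) := by
    rw [ENNReal.coe_inv (by positivity)]
    simp
  have hinj : ∀ T ∈ (S \ G).powerset, a ∉ T := fun T hT haT =>
    (Finset.mem_sdiff.1 (Finset.mem_powerset.1 hT haT)).2 ha
  have hsub : ((((S \ G).powerset.image (insert a) : Finset (Finset α))) : Set (Finset α)) ⊆
      {T | a ∈ T ∧ ∀ b ∈ G, b ∈ T → b = a} := by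
    intro T hT
    obtain ⟨T', hT', rfl⟩ := Finset.mem_image.1 (Finset.mem_coe.1 hT)
    refine ⟨Finset.mem_insert_self _ _, fun b hb hbT => ?_⟩
    rcases Finset.mem_insert.1 hbT with h | h
    · exact h
    · exact absurd hb (Finset.mem_sdiff.1 (Finset.mem_powerset.1 hT' h)).2
  refine le_trans ?_ (MeasureTheory.measure_mono hsub)
  rw [PMF.toOuterMeasure_apply_finset, Finset.sum_image]
  swap
  · intro T hT T' hT' h
    rw [← Finset.erase_insert (hinj T hT), ← Finset.erase_insert (hinj T' hT')]
    rw [h]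
  have key : ∀ T ∈ (S \ G).powerset, sampleEach S k (insert a T) =
      ((((k : ℝ≥0)⁻¹ : ℝ≥0) : ℝ≥0∞) * ((1 - (k : ℝ≥0)⁻¹ : ℝ≥0) : ℝ≥0∞) ^ (G.card - 1)) *
      ((((k : ℝ≥0)⁻¹ : ℝ≥0) : ℝ≥0∞) ^ T.card *
      ((1 - (k : ℝ≥0)⁻¹ : ℝ≥0) : ℝ≥0∞) ^ ((S \ G).card - T.card)) := by
    intro T hT
    have hTs := Finset.mem_powerset.1 hT
    have h1 : insert a T ⊆ S := Finset.insert_subset (hG ha) (hTs.trans Finset.sdiff_subset)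
    have h2 : (insert a T).card = T.card + 1 := Finset.card_insert_of_notMem (hinj T hT)
    have h3 := Finset.card_le_card hTs
    have h4 := Finset.card_sdiff_add_card_eq_card hG
    rw [sampleEach, PMF.ofFinset_apply, if_pos h1, h2,
      show S.card - (T.card + 1) = (G.card - 1) + ((S \ G).card - T.card) by omega, pow_add,
      pow_succ]
    ring
  rw [Finset.sum_congr rfl key, ← Finset.mul_sum, sum_sample_eq_one, mul_one, hkc, sq]
  gcongr
  rw [← ENNReal.coe_pow, ENNReal.coe_le_coe]
  exact inv_le_one_sub_inv_pow hk1 (by omega)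

theorem subset_of_mem_support_sampleEach {α : Type} [DecidableEq α] {S T : Finset α} {k : ℕ}
    (h : T ∈ (sampleEach S k).support) : T ⊆ S := by
  rw [PMF.mem_support_iff, sampleEach, PMF.ofFinset_apply] at h
  by_contra hn
  exact h (if_neg hn)

/-! ### The procedure `FindCandidate` -/

section FindCandidate

variable {E : Type} [DecidableEq E] {𝓛 : Finset (Finset E)} {c : Finset E → ℕ} {k : ℕ}

theorem mem_refinement {Z : Finset (Finset E)} {i : ℕ} {A : Finset E} :
    A ∈ refinement 𝓛 c Z i ↔ (A ∈ 𝓛 ∧ (∃ B ∈ Z, A ⊆ B) ∧ c A ≤ i) ∧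
      ∀ B, B ∈ 𝓛 → (∃ D ∈ Z, B ⊆ D) → c B ≤ i → A ⊆ B → A = B := by
  simp only [refinement, Finset.mem_filter, and_imp]

theorem two_mul_height_le {Z Z' : Finset (Finset E)} {i : ℕ} (hi : (height c Z + 1) / 2 ≤ i)
    (hZ' : Z' ∈ (doubleSample 𝓛 c k Z i).support) : 2 * height c Z' ≤ height c Z := by
  obtain ⟨Z₁, _, hZ⟩ := (PMF.mem_support_bind_iff _ _ _).1 hZ'
  have h : height c Z' ≤ height c Z - i := by
    refine Finset.sup_le fun A hA => ?_
    exact (mem_refinement.1 (subset_of_mem_support_sampleEach hZ hA)).1.2.2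
  omega

theorem exists_maximal_mem_refinement {Z : Finset (Finset E)} {i : ℕ} {A : Finset E}
    (hA : A ∈ 𝓛) (hAZ : ∃ B ∈ Z, A ⊆ B) (hi : c A ≤ i) : ∃ B ∈ refinement 𝓛 c Z i, A ⊆ B := by
  obtain ⟨B, hAB, hB⟩ := Finset.exists_le_maximal
    (𝓛.filter fun A => (∃ B ∈ Z, A ⊆ B) ∧ c A ≤ i) (Finset.mem_filter.2 ⟨hA, hAZ, hi⟩)
  refine ⟨B, mem_refinement.2 ⟨Finset.mem_filter.1 hB.1, fun D hD hDZ hDi hBD => ?_⟩, hAB⟩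
  exact Finset.Subset.antisymm hBD (hB.2 (Finset.mem_filter.2 ⟨hD, hDZ, hDi⟩) hBD)

theorem eq_of_mem_refinement
    (hlam : ∀ A ∈ 𝓛, ∀ B ∈ 𝓛, (A ∩ B).Nonempty → A ⊆ B ∨ B ⊆ A)
    {Z : Finset (Finset E)} {i : ℕ} {A B : Finset E} (hA : A ∈ refinement 𝓛 c Z i)
    (hB : B ∈ refinement 𝓛 c Z i) {e : E} (heA : e ∈ A) (heB : e ∈ B) : A = B := by
  rw [mem_refinement] at hA hB
  rcases hlam A hA.1.1 B hB.1.1 ⟨e, Finset.mem_inter.2 ⟨heA, heB⟩⟩ with h | h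
  · exact hA.2 B hB.1.1 hB.1.2.1 hB.1.2.2 h
  · exact (hB.2 A hA.1.1 hA.1.2.1 hA.1.2.2 h).symm

/-- Sampling a refinement isolates, among the sets that meet `X`, the one that contains `x`. -/
theorem sample_refinement_isolate
    (hlam : ∀ A ∈ 𝓛, ∀ B ∈ 𝓛, (A ∩ B).Nonempty → A ⊆ B ∨ B ⊆ A)
    {Z : Finset (Finset E)} {i : ℕ} {A X : Finset E} {x : E} (hA : A ∈ refinement 𝓛 c Z i)
    (hxA : x ∈ A) (hx : x ∈ X) (hX : X.card ≤ k) :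
    ((k : ℝ≥0∞)⁻¹) ^ 2 ≤ (sampleEach (refinement 𝓛 c Z i) k).toOuterMeasure
      {T | T ⊆ refinement 𝓛 c Z i ∧ A ∈ T ∧ ∀ B ∈ T, (X ∩ B).Nonempty → B = A} := by
  classical
  set G := (refinement 𝓛 c Z i).filter fun B => (X ∩ B).Nonempty with hG
  have hcard : G.card ≤ k := by
    refine le_trans ?_ hX
    have hex : ∀ B ∈ G, ∃ e, e ∈ X ∩ B := fun B hB => (Finset.mem_filter.1 hB).2
    have : Nonempty E := ⟨x⟩
    choose! f hf using hex
    refine Finset.card_le_card_of_injOn f (fun B hB => (Finset.mem_inter.1 (hf B hB)).1) ?_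
    intro B hB D hD hBD
    have h1 := (Finset.mem_inter.1 (hf B hB)).2
    have h2 := (Finset.mem_inter.1 (hf D hD)).2
    rw [← hBD] at h2
    exact eq_of_mem_refinement hlam (Finset.mem_filter.1 hB).1 (Finset.mem_filter.1 hD).1 h1 h2
  refine (sampleEach_isolate (Finset.filter_subset _ _) (a := A)
    (Finset.mem_filter.2 ⟨hA, x, Finset.mem_inter.2 ⟨hx, hxA⟩⟩) hcard).trans ?_
  refine toOuterMeasure_mono_support fun T hT h => ?_
  have hTs := subset_of_mem_support_sampleEach hT
  exact ⟨hTs, h.1, fun B hB hXB => h.2 B (Finset.mem_filter.2 ⟨hTs hB, hXB⟩) hB⟩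

/-- The invariant of the recursion: the set of `Z` that contains `x` is the only one that meets
`X`, and it includes all tight sets without `x` that meet `⋃ Z`. -/
def Focused (𝓛 : Finset (Finset E)) (c : Finset E → ℕ) (X : Finset E) (x : E)
    (Z : Finset (Finset E)) (A : Finset E) : Prop :=
  A ∈ Z ∧ x ∈ A ∧ (∀ D ∈ Z, (X ∩ D).Nonempty → D = A) ∧
    ∀ B ∈ 𝓛, x ∉ B → c B ≤ (X ∩ B).card → (∃ D ∈ Z, (D ∩ B).Nonempty) → B ⊆ A

/-- A level at which the two sampling steps can separate `x` from all tight sets inside `A`. -/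
theorem exists_good_level
    (hlam : ∀ A ∈ 𝓛, ∀ B ∈ 𝓛, (A ∩ B).Nonempty → A ⊆ B ∨ B ⊆ A)
    {X A : Finset E} {x : E} (hX : ∀ A ∈ 𝓛, (X ∩ A).card ≤ c A) (hx : x ∈ X) (hxA : x ∈ A)
    (hA : A ∈ 𝓛) {h : ℕ} (hc : c A ≤ h) (h2 : 2 ≤ h) :
    ∃ i, (h + 1) / 2 ≤ i ∧ i < h ∧
      (∀ B ∈ 𝓛, x ∉ B → c B ≤ (X ∩ B).card → B ⊆ A → c B ≤ i) ∧
      ∀ A' ∈ 𝓛, x ∈ A' → A' ⊆ A → c A' ≤ i →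
        ∀ B ∈ 𝓛, x ∉ B → c B ≤ (X ∩ B).card → B ⊆ A' → c B ≤ h - i := by
  classical
  -- a set that contains `x` and a set `B` without `x` has at least one more element of `X`
  have hlt : ∀ D : Finset E, x ∈ D → ∀ B, x ∉ B → B ⊆ D → (X ∩ B).card + 1 ≤ (X ∩ D).card := by
    intro D hD B hxB hBD
    refine Finset.card_lt_card ⟨Finset.inter_subset_inter_left hBD, fun hs => hxB ?_⟩
    exact (Finset.mem_inter.1 (hs (Finset.mem_inter.2 ⟨hx, hD⟩))).2
  set 𝒯 := 𝓛.filter fun B => x ∉ B ∧ c B ≤ (X ∩ B).card ∧ B ⊆ A with h𝒯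
  set b := 𝒯.sup c with hb
  have hb_le : ∀ B ∈ 𝓛, x ∉ B → c B ≤ (X ∩ B).card → B ⊆ A → c B ≤ b := fun B hB h1 h3 h4 =>
    Finset.le_sup (f := c) (Finset.mem_filter.2 ⟨hB, h1, h3, h4⟩)
  have hbh : b < h := by
    refine (Finset.sup_lt_iff (by simp; omega)).2 fun B hB => ?_
    obtain ⟨hB1, hB2, hB3, hB4⟩ := Finset.mem_filter.1 hB
    have := hlt A hxA B hB2 hB4
    have := hX A hA
    omega
  by_cases hcase : (h + 1) / 2 ≤ b
  · refine ⟨b, hcase, hbh, hb_le, ?_⟩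
    have hne : 𝒯.Nonempty := by
      by_contra hne
      rw [Finset.not_nonempty_iff_eq_empty] at hne
      rw [hb, hne, Finset.sup_empty, bot_eq_zero] at hcase
      omega
    obtain ⟨B₀, hB₀, hbB₀⟩ := Finset.exists_mem_eq_sup 𝒯 hne c
    obtain ⟨hB1, hB2, hB3, hB4⟩ := Finset.mem_filter.1 hB₀
    intro A' hA' hxA' hA'A hcA' B hB hxB hBt hBA'
    rw [← hb] at hbB₀
    by_cases hint : (B ∩ B₀).Nonempty
    · exfalso
      have hA'B₀ : (A' ∩ B₀).Nonempty := hint.mono (Finset.inter_subset_inter_right hBA')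
      rcases hlam A' hA' B₀ hB1 hA'B₀ with h5 | h5
      · exact hB2 (h5 hxA')
      · have := hlt A' hxA' B₀ hB2 h5
        have := hX A' hA'
        omega
    · have hdis : Disjoint B B₀ := by
        rwa [Finset.disjoint_iff_inter_eq_empty, ← Finset.not_nonempty_iff_eq_empty]
      have h6 := hlt A hxA (B ∪ B₀) (by simp [hxB, hB2])
        (Finset.union_subset (hBA'.trans hA'A) hB4)
      rw [Finset.inter_union_distrib_left, Finset.card_union_of_disjoint
        (hdis.mono Finset.inter_subset_right Finset.inter_subset_right)] at h6
      have := hX A hA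
      omega
  · refine ⟨(h + 1) / 2, le_rfl, by omega, fun B hB h1 h3 h4 => ?_, ?_⟩
    · have := hb_le B hB h1 h3 h4
      omega
    · intro A' hA' hxA' hA'A hcA' B hB hxB hBt hBA'
      have := hb_le B hB hxB hBt (hBA'.trans hA'A)
      omega

/-- For a good level, both sampling steps isolate the set that contains `x` with probability at
least `k ^ (-4)`, and then the invariant is preserved. -/
theorem doubleSample_focused
    (hlam : ∀ A ∈ 𝓛, ∀ B ∈ 𝓛, (A ∩ B).Nonempty → A ⊆ B ∨ B ⊆ A)
    (hsing : ∀ e, {e} ∈ 𝓛 ∧ c {e} ≤ 1) (hpos : ∀ A ∈ 𝓛, 1 ≤ c A)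
    {X A : Finset E} {x : E} (hX : ∀ A ∈ 𝓛, (X ∩ A).card ≤ c A) (hx : x ∈ X) (hk : X.card ≤ k)
    {Z : Finset (Finset E)} (hZ : Z ⊆ 𝓛) (hA : Focused 𝓛 c X x Z A) (h2 : 2 ≤ height c Z) :
    ∃ i, (height c Z + 1) / 2 ≤ i ∧ i < height c Z ∧
      ((k : ℝ≥0∞)⁻¹) ^ 4 ≤ (doubleSample 𝓛 c k Z i).toOuterMeasure
        {Z' | Z' ⊆ 𝓛 ∧ ∃ A', Focused 𝓛 c X x Z' A'} := by
  obtain ⟨hAZ, hxA, hAX, hAB⟩ := hA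
  obtain ⟨i, hi1, hi2, hi3, hi4⟩ := exists_good_level hlam hX hx hxA (hZ hAZ)
    (h := height c Z) (Finset.le_sup (f := c) hAZ : c A ≤ height c Z) h2
  refine ⟨i, hi1, hi2, ?_⟩
  obtain ⟨A₁, hA₁, hxA₁⟩ := exists_maximal_mem_refinement (c := c) (i := i) (hsing x).1
    ⟨A, hAZ, Finset.singleton_subset_iff.2 hxA⟩ ((hsing x).2.trans (by omega))
  rw [Finset.singleton_subset_iff] at hxA₁
  rw [show 4 = 2 + 2 from rfl, pow_add]
  refine mul_le_toOuterMeasure_bind (sample_refinement_isolate hlam hA₁ hxA₁ hx hk) ?_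
  rintro Z₁ - ⟨hZ₁, hA₁Z₁, hZ₁X⟩
  obtain ⟨A₂, hA₂, hxA₂⟩ := exists_maximal_mem_refinement (c := c) (i := height c Z - i)
    (hsing x).1 ⟨A₁, hA₁Z₁, Finset.singleton_subset_iff.2 hxA₁⟩ ((hsing x).2.trans (by omega))
  rw [Finset.singleton_subset_iff] at hxA₂
  refine (sample_refinement_isolate hlam hA₂ hxA₂ hx hk).trans ?_
  refine PMF.toOuterMeasure_mono _ ?_
  rintro Z₂ ⟨⟨hZ₂, hA₂Z₂, hZ₂X⟩, -⟩
  refine ⟨fun D hD => (mem_refinement.1 (hZ₂ hD)).1.1, A₂, hA₂Z₂, hxA₂, hZ₂X, ?_⟩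
  rintro B hB hxB hBt ⟨D, hD, e, he⟩
  obtain ⟨heD, heB⟩ := Finset.mem_inter.1 he
  have hBX : (X ∩ B).Nonempty := Finset.card_pos.1 ((hpos B hB).trans hBt)
  obtain ⟨⟨hD𝓛, ⟨D₁, hD₁, hDD₁⟩, hcD⟩, hDmax⟩ := mem_refinement.1 (hZ₂ hD)
  obtain ⟨⟨hD₁𝓛, ⟨D₀, hD₀, hD₁D₀⟩, hcD₁⟩, hD₁max⟩ := mem_refinement.1 (hZ₁ hD₁)
  -- a set is included in `A₂` as soon as it is included in a member of `Z₂`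
  have hin : B ⊆ D → B ⊆ A₂ := fun h =>
    (hZ₂X D hD (hBX.mono (Finset.inter_subset_inter_left h))) ▸ h
  rcases hlam B hB D hD𝓛 ⟨e, Finset.mem_inter.2 ⟨heB, heD⟩⟩ with h | h
  · exact hin h
  have hBA : B ⊆ A := hAB B hB hxB hBt
    ⟨D₀, hD₀, e, Finset.mem_inter.2 ⟨hD₁D₀ (hDD₁ heD), heB⟩⟩
  have hin₁ : B ⊆ D₁ → B ⊆ A₂ := fun h5 => by
    have h6 : D₁ = A₁ := hZ₁X D₁ hD₁ (hBX.mono (Finset.inter_subset_inter_left h5))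
    subst h6
    have hm := mem_refinement.1 hA₁
    obtain ⟨D', hD', hsub⟩ := hm.1.2.1
    have h7 : D' = A := hAX D' hD' ⟨x, Finset.mem_inter.2 ⟨hx, hsub hxA₁⟩⟩
    have h8 := hi4 D₁ hD₁𝓛 hxA₁ (h7 ▸ hsub) hcD₁ B hB hxB hBt h5
    exact hin (hDmax B hB ⟨D₁, hD₁, h5⟩ h8 h).ge
  rcases hlam B hB D₁ hD₁𝓛 ⟨e, Finset.mem_inter.2 ⟨heB, hDD₁ heD⟩⟩ with h5 | h5
  · exact hin₁ h5
  · exact hin₁ (hD₁max B hB ⟨A, hAZ, hBA⟩ (hi3 B hB hxB hBt hBA) h5).ge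

theorem le_toOuterMeasure_unionOver {α : Type} [DecidableEq α] {f : ℕ → PMF (Finset α)}
    {P : α → Prop} {q : ℝ≥0∞} {i : ℕ} {l : List ℕ} (hi : i ∈ l)
    (hq : q ≤ (f i).toOuterMeasure {Y | ∃ y ∈ Y, P y}) :
    q ≤ (unionOver f l).toOuterMeasure {Y | ∃ y ∈ Y, P y} := by
  induction l with
  | nil => simp at hi
  | cons j l ih =>
    rw [unionOver]
    rcases List.mem_cons.1 hi with rfl | hi
    · rw [← mul_one q]
      refine mul_le_toOuterMeasure_bind hq fun Y _ hY => ?_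
      obtain ⟨y, hy, hP⟩ := hY
      refine (toOuterMeasure_eq_one_of_forall fun Y' hY' => ?_).ge
      obtain ⟨Y₂, _, h⟩ := (PMF.mem_support_bind_iff _ _ _).1 hY'
      rw [PMF.mem_support_pure_iff] at h
      exact h ▸ ⟨y, Finset.mem_union_left _ hy, hP⟩
    · rw [← one_mul q]
      refine mul_le_toOuterMeasure_bind
        (toOuterMeasure_eq_one_of_forall (A := Set.univ) (by simp)).ge fun Y _ _ => ?_
      rw [← mul_one q]
      refine mul_le_toOuterMeasure_bind (ih hi) fun Y' _ hY' => ?_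
      obtain ⟨y, hy, hP⟩ := hY'
      refine (toOuterMeasure_eq_one_of_forall fun Y' hY' => ?_).ge
      rw [PMF.mem_support_pure_iff] at hY'
      exact hY' ▸ ⟨y, Finset.mem_union_right _ hy, hP⟩

theorem card_le_of_mem_support_unionOver {α : Type} [DecidableEq α] {f : ℕ → PMF (Finset α)}
    {N : ℕ} {l : List ℕ} (hf : ∀ i ∈ l, ∀ Y ∈ (f i).support, Y.card ≤ N) {Y : Finset α}
    (hY : Y ∈ (unionOver f l).support) : Y.card ≤ l.length * N := by
  induction l generalizing Y with
  | nil =>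
    rw [unionOver, PMF.mem_support_pure_iff] at hY
    simp [hY]
  | cons j l ih =>
    obtain ⟨Y₁, hY₁, h⟩ := (PMF.mem_support_bind_iff _ _ _).1 hY
    obtain ⟨Y₂, hY₂, h⟩ := (PMF.mem_support_bind_iff _ _ _).1 h
    rw [PMF.mem_support_pure_iff] at h
    have h1 := hf j (by simp) Y₁ hY₁
    have h2 := ih (fun i hi => hf i (by simp [hi])) hY₂
    have h3 := Finset.card_union_le Y₁ Y₂
    rw [h, List.length_cons, add_mul]
    omega

/-- Each level of the recursion at least halves the height and multiplies the number of sets by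
at most `height / 2`. -/
theorem card_le_of_mem_support_findCandidateAux {fuel : ℕ} {Z : Finset (Finset E)}
    (hk : height c Z ≤ k) {𝒴 : Finset (Finset E)}
    (h𝒴 : 𝒴 ∈ (findCandidateAux 𝓛 c k fuel Z).support) :
    𝒴.card ≤ k ^ Nat.log 2 (height c Z) := by
  induction fuel generalizing Z 𝒴 with
  | zero =>
    rw [findCandidateAux, PMF.mem_support_pure_iff] at h𝒴
    rw [h𝒴, Finset.card_singleton]
    rcases Nat.lt_or_ge (height c Z) 2 with h | h
    · simp [Nat.log_of_lt h]
    · exact Nat.one_le_pow _ _ (by omega)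
  | succ fuel ih =>
    rw [findCandidateAux] at h𝒴
    split_ifs at h𝒴 with h
    · rw [PMF.mem_support_pure_iff] at h𝒴
      rw [h𝒴, Finset.card_singleton, Nat.log_of_lt (by omega), pow_zero]
    · set h₀ := height c Z with hh₀
      have hN : ∀ i ∈ List.Ico ((h₀ + 1) / 2) h₀,
          ∀ Y ∈ ((doubleSample 𝓛 c k Z i).bind (findCandidateAux 𝓛 c k fuel)).support,
          Y.card ≤ k ^ (Nat.log 2 h₀ - 1) := by
        intro i hi Y hY
        obtain ⟨Z', hZ', hY⟩ := (PMF.mem_support_bind_iff _ _ _).1 hY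
        have h1 := two_mul_height_le (List.Ico.mem.1 hi).1 hZ'
        refine (ih (by omega) hY).trans (Nat.pow_le_pow_right (by omega) ?_)
        rw [← Nat.log_div_base]
        exact Nat.log_mono_right (by omega)
      refine (card_le_of_mem_support_unionOver hN h𝒴).trans ?_
      rw [List.Ico.length]
      have hlog : 0 < Nat.log 2 h₀ := Nat.log_pos (by norm_num) (by omega)
      calc (h₀ - (h₀ + 1) / 2) * k ^ (Nat.log 2 h₀ - 1)
          ≤ k * k ^ (Nat.log 2 h₀ - 1) := by gcongr; omega
        _ = k ^ Nat.log 2 h₀ := by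
          rw [← pow_succ']
          congr 1
          omega

/-- The output contains a set with `x` that avoids all tight sets without `x`. -/
theorem le_toOuterMeasure_findCandidateAux
    (hlam : ∀ A ∈ 𝓛, ∀ B ∈ 𝓛, (A ∩ B).Nonempty → A ⊆ B ∨ B ⊆ A)
    (hsing : ∀ e, {e} ∈ 𝓛 ∧ c {e} ≤ 1) (hpos : ∀ A ∈ 𝓛, 1 ≤ c A)
    {X : Finset E} {x : E} (hX : ∀ A ∈ 𝓛, (X ∩ A).card ≤ c A) (hx : x ∈ X) (hk : X.card ≤ k)
    {fuel : ℕ} {Z : Finset (Finset E)} (hfuel : height c Z ≤ fuel) (hZ : Z ⊆ 𝓛) {A : Finset E}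
    (hA : Focused 𝓛 c X x Z A) :
    ((k : ℝ≥0∞)⁻¹) ^ (4 * Nat.log 2 (height c Z)) ≤
      (findCandidateAux 𝓛 c k fuel Z).toOuterMeasure
        {𝒴 | ∃ Y ∈ 𝒴, x ∈ Y ∧ ∀ B ∈ 𝓛, x ∉ B → c B ≤ (X ∩ B).card → Disjoint Y B} := by
  have hk1 : 1 ≤ k := (Finset.card_pos.2 ⟨x, hx⟩).trans_le hk
  have hkinv : (k : ℝ≥0∞)⁻¹ ≤ 1 := ENNReal.inv_le_one.2 (by exact_mod_cast hk1)
  have hbase : ∀ {Z : Finset (Finset E)} {A : Finset E}, Z ⊆ 𝓛 → Focused 𝓛 c X x Z A →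
      height c Z ≤ 1 → ((k : ℝ≥0∞)⁻¹) ^ (4 * Nat.log 2 (height c Z)) ≤
      (PMF.pure ({Z.sup id} : Finset (Finset E))).toOuterMeasure
        {𝒴 | ∃ Y ∈ 𝒴, x ∈ Y ∧ ∀ B ∈ 𝓛, x ∉ B → c B ≤ (X ∩ B).card → Disjoint Y B} := by
    intro Z A hZ hA h1
    refine le_trans (pow_le_one₀ (by simp) hkinv)
      (toOuterMeasure_eq_one_of_forall fun 𝒴 h𝒴 => ?_).ge
    rw [PMF.mem_support_pure_iff] at h𝒴
    subst h𝒴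
    obtain ⟨hAZ, hxA, hAX, hAB⟩ := hA
    refine ⟨_, Finset.mem_singleton_self _, Finset.mem_sup.2 ⟨A, hAZ, hxA⟩, ?_⟩
    intro B hB hxB hBt
    rw [Finset.disjoint_left]
    intro e he heB
    obtain ⟨D, hD, heD⟩ := Finset.mem_sup.1 he
    have hBA := hAB B hB hxB hBt ⟨D, hD, e, Finset.mem_inter.2 ⟨heD, heB⟩⟩
    have h2 : (X ∩ B).card + 1 ≤ (X ∩ A).card := by
      refine Finset.card_lt_card ⟨Finset.inter_subset_inter_left hBA, fun hs => hxB ?_⟩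
      exact (Finset.mem_inter.1 (hs (Finset.mem_inter.2 ⟨hx, hxA⟩))).2
    have h3 := hX A (hZ hAZ)
    have h4 : c A ≤ height c Z := Finset.le_sup (f := c) hAZ
    have h5 := hpos B hB
    omega
  induction fuel generalizing Z A with
  | zero => exact hbase hZ hA (by omega)
  | succ fuel ih =>
    rw [findCandidateAux]
    split_ifs with h
    · exact hbase hZ hA h
    · obtain ⟨i, hi1, hi2, hi⟩ := doubleSample_focused hlam hsing hpos hX hx hk hZ hA (by omega)
      refine le_toOuterMeasure_unionOver (List.Ico.mem.2 ⟨hi1, hi2⟩) ?_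
      have hlog : 0 < Nat.log 2 (height c Z) := Nat.log_pos (by norm_num) (by omega)
      rw [show 4 * Nat.log 2 (height c Z) = 4 + 4 * (Nat.log 2 (height c Z) - 1) by omega,
        pow_add]
      refine mul_le_toOuterMeasure_bind hi ?_
      rintro Z' hZ' ⟨hZ'𝓛, A', hA'⟩
      have h1 := two_mul_height_le hi1 hZ'
      refine le_trans ?_ (ih (by omega) hZ'𝓛 hA')
      refine pow_le_pow_of_le_one (by simp) hkinv ?_
      rw [← Nat.log_div_base]
      have := Nat.log_mono_right (b := 2) (show height c Z' ≤ height c Z / 2 by omega)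
      omega

end FindCandidate

/-! ### Normalized laminar families -/

theorem natCast_log_mul_le (a k : ℕ) :
    ((a * Nat.log 2 k : ℕ) : ℝ) ≤ a / Real.log 2 * Real.log k := by
  have h := Real.natLog_le_logb k 2
  rw [Real.logb] at h
  push_cast at h ⊢
  calc (a : ℝ) * Nat.log 2 k ≤ a * (Real.log k / Real.log 2) := by gcongr
    _ = _ := by ring

theorem pow_le_rpow_of_le {k e : ℕ} {y : ℝ} (hk : 1 ≤ k) (h : (e : ℝ) ≤ y) :
    ((k ^ e : ℕ) : ℝ) ≤ (k : ℝ) ^ y := by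
  rw [Nat.cast_pow, ← Real.rpow_natCast]
  exact Real.rpow_le_rpow_of_exponent_le (by exact_mod_cast hk) h

theorem ofReal_inv_rpow_le {k e : ℕ} {y : ℝ} (hk : 1 ≤ k) (h : (e : ℝ) ≤ y) :
    ENNReal.ofReal (1 / (k : ℝ) ^ y) ≤ ((k : ℝ≥0∞)⁻¹) ^ e := by
  have h1 := pow_le_rpow_of_le hk h
  have h0 : (0 : ℝ) < ((k ^ e : ℕ) : ℝ) := by exact_mod_cast Nat.pos_of_ne_zero (by positivity)
  calc ENNReal.ofReal (1 / (k : ℝ) ^ y) ≤ ENNReal.ofReal (1 / ((k ^ e : ℕ) : ℝ)) :=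
        ENNReal.ofReal_le_ofReal (one_div_le_one_div_of_le h0 h1)
    _ = ((k : ℝ≥0∞)⁻¹) ^ e := by
      rw [one_div, ENNReal.ofReal_inv_of_pos h0, ENNReal.ofReal_natCast, Nat.cast_pow,
        ENNReal.inv_pow]

section Normalization

variable {E : Type} [DecidableEq E]

/-- Swapping `x` for `y` violates the capacity of `A` only if `A` is tight and contains `y` but
not `x`. -/
theorem tight_of_exchange_violates {X A : Finset E} {x y : E} {c : ℕ} (hx : x ∈ X)
    (hXA : (X ∩ A).card ≤ c) (h : c < (insert y (X.erase x) ∩ A).card) :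
    y ∈ A ∧ x ∉ A ∧ c ≤ (X ∩ A).card := by
  have hyA : y ∈ A := by
    by_contra hyA
    rw [Finset.insert_inter_of_notMem hyA] at h
    have := Finset.card_le_card (Finset.inter_subset_inter_right (u := A) (X.erase_subset x))
    omega
  rw [Finset.insert_inter_of_mem hyA] at h
  have h1 := Finset.card_insert_le y (X.erase x ∩ A)
  refine ⟨hyA, fun hxA => ?_, ?_⟩
  · rw [Finset.erase_inter, Finset.card_erase_of_mem (Finset.mem_inter.2 ⟨hx, hxA⟩)] at h1
    have := Finset.card_pos.2 ⟨x, Finset.mem_inter.2 ⟨hx, hxA⟩⟩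
    rw [Finset.erase_inter] at h
    omega
  · have := Finset.card_le_card (Finset.inter_subset_inter_right (u := A) (X.erase_subset x))
    omega

theorem card_exchange_le {X : Finset E} {x y : E} (hx : x ∈ X) :
    (insert y (X.erase x)).card ≤ X.card := by
  have h1 := Finset.card_insert_le y (X.erase x)
  rw [Finset.card_erase_of_mem hx] at h1
  have := Finset.card_pos.2 ⟨x, hx⟩
  omega

variable [Fintype E] {L : LaminarRep E} {M : Matroid E} {k : ℕ}

theorem LaminarRep.mem_normSets {A : Finset E} :
    A ∈ L.normSets k ↔ (A = Finset.univ ∨ A ∈ L.sets ∨ ∃ e, A = {e}) ∧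
      ∀ B, (B = Finset.univ ∨ B ∈ L.sets ∨ ∃ e, B = {e}) → A ⊆ B →
        L.normCap k A ≤ L.normCap k B := by
  have h : ∀ A : Finset E, A ∈ insert Finset.univ
      (L.sets.toFinset ∪ Finset.univ.image fun e : E => ({e} : Finset E)) ↔
      (A = Finset.univ ∨ A ∈ L.sets ∨ ∃ e, A = {e}) := by
    intro A
    simp [eq_comm]
  simp only [LaminarRep.normSets, Finset.mem_filter, h]

theorem LaminarRep.one_le_normCap (hL : L.Represents M) (hloop : ∀ e, M.Indep {e}) (hk : 1 ≤ k)
    {A : Finset E} (hA : A = Finset.univ ∨ A ∈ L.sets ∨ ∃ e, A = {e}) :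
    1 ≤ L.normCap k A := by
  rw [LaminarRep.normCap]
  have hcap : ∀ B ∈ L.sets, 1 < B.card → 1 ≤ L.cap B := by
    intro B hB hcard
    obtain ⟨e, he⟩ := Finset.card_pos.1 (Nat.zero_lt_of_lt hcard)
    have := (hL.2 {e}).1 (by simpa using hloop e) B hB
    rwa [Finset.singleton_inter_of_mem he, Finset.card_singleton] at this
  split_ifs with h1 h2 h3
  · exact le_rfl
  · exact le_min (hcap A h3 (by omega)) hk
  · exact hk
  · rcases hA with h | h | ⟨e, rfl⟩
    · exact absurd h h2
    · exact hcap A h (by omega)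
    · simp at h1

/-- A set of at most `k` elements respects the normalized capacities if and only if it is
independent. -/
theorem LaminarRep.indep_iff_normCap (hL : L.Represents M) (hloop : ∀ e, M.Indep {e})
    {I : Finset E} (hI : I.card ≤ k) :
    M.Indep (I : Set E) ↔ ∀ A, (A = Finset.univ ∨ A ∈ L.sets ∨ ∃ e, A = {e}) →
      (I ∩ A).card ≤ L.normCap k A := by
  have hle : ∀ A : Finset E, (I ∩ A).card ≤ k := fun A =>
    (Finset.card_le_card Finset.inter_subset_left).trans hI
  have hle' : ∀ A : Finset E, (I ∩ A).card ≤ A.card := fun A =>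
    Finset.card_le_card Finset.inter_subset_right
  rw [hL.2]
  constructor
  · intro h A hA
    rw [LaminarRep.normCap]
    split_ifs with h1 h2 h3
    · exact (hle' A).trans h1
    · exact le_min (h A h3) (hle A)
    · exact hle A
    · rcases hA with hA | hA | ⟨e, rfl⟩
      · exact absurd hA h2
      · exact h A hA
      · simp at h1
  · intro h A hA
    have h0 := h A (Or.inr (Or.inl hA))
    rw [LaminarRep.normCap] at h0
    split_ifs at h0 with h1 h2
    · rcases Finset.eq_empty_or_nonempty A with rfl | ⟨e, he⟩
      · simp
      · have := (hL.2 {e}).1 (by simpa using hloop e) A hA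
        rw [Finset.singleton_inter_of_mem he, Finset.card_singleton] at this
        exact h0.trans this
    · exact h0.trans (min_le_left _ _)
    · exact h0

theorem LaminarRep.normSets_laminar :
    ∀ A ∈ L.normSets k, ∀ B ∈ L.normSets k, (A ∩ B).Nonempty → A ⊆ B ∨ B ⊆ A := by
  have hs : ∀ (e : E) (B : Finset E), (({e} : Finset E) ∩ B).Nonempty → {e} ⊆ B := by
    rintro e B ⟨f, hf⟩
    rw [Finset.mem_inter, Finset.mem_singleton] at hf
    exact Finset.singleton_subset_iff.2 (hf.1 ▸ hf.2)
  intro A hA B hB hAB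
  rcases (LaminarRep.mem_normSets.1 hA).1 with rfl | hA | ⟨e, rfl⟩
  · exact Or.inr (Finset.subset_univ _)
  · rcases (LaminarRep.mem_normSets.1 hB).1 with rfl | hB | ⟨e, rfl⟩
    · exact Or.inl (Finset.subset_univ _)
    · exact L.laminar A hA B hB hAB
    · exact Or.inr (hs e A (by rwa [Finset.inter_comm]))
  · exact Or.inl (hs e B hAB)

/-- A violated set of smallest normalized capacity is a member of the normalized family. -/
theorem LaminarRep.exists_mem_normSets_of_violates {I A : Finset E}
    (hA : A = Finset.univ ∨ A ∈ L.sets ∨ ∃ e, A = {e}) (h : L.normCap k A < (I ∩ A).card) :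
    ∃ B ∈ L.normSets k, L.normCap k B < (I ∩ B).card := by
  classical
  obtain ⟨B, hB, hmin⟩ := Finset.exists_min_image
    (Finset.univ.filter fun A => (A = Finset.univ ∨ A ∈ L.sets ∨ ∃ e, A = {e}) ∧
      L.normCap k A < (I ∩ A).card) (L.normCap k) ⟨A, by simpa using ⟨hA, h⟩⟩
  obtain ⟨-, hB1, hB2⟩ := Finset.mem_filter.1 hB
  refine ⟨B, LaminarRep.mem_normSets.2 ⟨hB1, fun D hD hBD => ?_⟩, hB2⟩
  by_contra hlt
  refine hlt (hmin D (Finset.mem_filter.2 ⟨Finset.mem_univ _, hD, ?_⟩))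
  exact (by omega : L.normCap k D < (I ∩ B).card).trans_le
    (Finset.card_le_card (Finset.inter_subset_inter_left hBD))

theorem LaminarRep.height_univ_le (hk : 1 ≤ k) :
    height (L.normCap k) {Finset.univ} ≤ k := by
  rw [height, Finset.sup_singleton, LaminarRep.normCap]
  split_ifs with h1 h2
  · exact hk
  · exact min_le_right _ _
  · exact le_rfl
  · exact absurd rfl h2

/-- The procedure finds an exchangeable set with probability at least `k ^ (-4 * log₂ k)`. -/
theorem LaminarRep.le_toOuterMeasure_findCandidate (hL : L.Represents M)
    (hloop : ∀ e, M.Indep {e}) {X : Finset E} (hX : M.Indep (X : Set E)) (hk : X.card ≤ k) {x : E}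
    (hx : x ∈ X) :
    ((k : ℝ≥0∞)⁻¹) ^ (4 * Nat.log 2 k) ≤
      (findCandidate (L.normSets k) (L.normCap k) k {Finset.univ}).toOuterMeasure
        {𝒴 | ∃ Y ∈ 𝒴, IsExchangeable M X x Y} := by
  have hk1 : 1 ≤ k := (Finset.card_pos.2 ⟨x, hx⟩).trans_le hk
  have hXc := (LaminarRep.indep_iff_normCap hL hloop hk).1 hX
  have hcap1 : ∀ e, L.normCap k {e} = 1 := fun e => by simp [LaminarRep.normCap]
  have hpos := fun A => LaminarRep.one_le_normCap (A := A) hL hloop hk1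
  have huniv : Finset.univ ∈ L.normSets k :=
    LaminarRep.mem_normSets.2 ⟨Or.inl rfl, fun B _ h => by
      rw [Finset.univ_subset_iff.1 h]⟩
  have main := le_toOuterMeasure_findCandidateAux (𝓛 := L.normSets k) (c := L.normCap k) (k := k)
    LaminarRep.normSets_laminar
    (fun e => ⟨LaminarRep.mem_normSets.2 ⟨Or.inr (Or.inr ⟨e, rfl⟩), fun B hB _ =>
      (hcap1 e).trans_le (hpos B hB)⟩, (hcap1 e).le⟩)
    (fun A hA => hpos A (LaminarRep.mem_normSets.1 hA).1)
    (fun A hA => hXc A (LaminarRep.mem_normSets.1 hA).1) hx hk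
    (le_refl (height (L.normCap k) {Finset.univ})) (by simpa using huniv) (A := Finset.univ)
    ⟨by simp, by simp, by simp, by simp⟩
  refine le_trans (pow_le_pow_of_le_one (by simp)
    (ENNReal.inv_le_one.2 (by exact_mod_cast hk1)) (Nat.mul_le_mul_left 4
    (Nat.log_mono_right (LaminarRep.height_univ_le hk1)))) (main.trans ?_)
  refine MeasureTheory.measure_mono ?_
  rintro 𝒴 ⟨Y, hY, hxY, hdis⟩
  refine ⟨Y, hY, hxY, fun y hy => ?_⟩
  by_contra hdep
  rw [LaminarRep.indep_iff_normCap hL hloop ((card_exchange_le hx).trans hk)] at hdep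
  push Not at hdep
  obtain ⟨A, hA, hAv⟩ := hdep
  obtain ⟨B, hB, hBv⟩ := LaminarRep.exists_mem_normSets_of_violates hA hAv
  obtain ⟨h1, h2, h3⟩ := tight_of_exchange_violates hx
    (hXc B (LaminarRep.mem_normSets.1 hB).1) hBv
  exact Finset.disjoint_left.1 (hdis B hB h2 h3) hy h1

end Normalization

/-! ### Big-step semantics of programs -/

section Semantics

variable {n : ℕ} {env : Env n}

/-- `BigStep env p σ T μ`: whatever its random choices, the program `p` started in the store `σ`
terminates within `T` steps, and `μ` is the law of the final store. -/
inductive BigStep (env : Env n) : Cmd → Store → ℕ → PMF Store → Prop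
  | skip (σ) : BigStep env .skip σ 1 (PMF.pure σ)
  | assign (x e σ) : BigStep env (.assign x e) σ 1 (PMF.pure (σ.setVar x (e.eval σ)))
  | put (a i j l e σ) : BigStep env (.put a i j l e) σ 1
      (PMF.pure (σ.setArr a (i.eval σ) (j.eval σ) (l.eval σ) (e.eval σ)))
  | rand (x e σ) : BigStep env (.rand x e) σ 1 ((uniformBelow (e.eval σ)).map fun v => σ.setVar x v)
  | query (x a i σ) : BigStep env (.query x a i) σ 1
      (PMF.pure (σ.setVar x (env.query (σ.row n a (i.eval σ)))))
  | compare (x e f σ) : BigStep env (.compare x e f) σ 1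
      (PMF.pure (σ.setVar x (env.compare (e.eval σ) (f.eval σ))))
  | seq {p q σ T₁ T₂ μ ν} : BigStep env p σ T₁ μ →
      (∀ σ' ∈ μ.support, BigStep env q σ' T₂ (ν σ')) →
      BigStep env (.seq p q) σ (T₁ + T₂ + 1) (μ.bind ν)
  | cond {e p q σ T μ} : BigStep env (if e.eval σ ≠ 0 then p else q) σ T μ →
      BigStep env (.cond e p q) σ (T + 1) μ
  | loopEnd {e p σ} : e.eval σ = 0 → BigStep env (.loop e p) σ 1 (PMF.pure σ)
  | loopStep {e p σ T₁ T₂ μ ν} : e.eval σ ≠ 0 → BigStep env p σ T₁ μ →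
      (∀ σ' ∈ μ.support, BigStep env (.loop e p) σ' T₂ (ν σ')) →
      BigStep env (.loop e p) σ (T₁ + T₂ + 1) (μ.bind ν)
  | mono {p σ T T' μ} : BigStep env p σ T μ → T ≤ T' → BigStep env p σ T' μ

/-- All runs from the configuration `s` halt within `T` steps in a store that satisfies `Q`, and
the expectation of `Φ` at the final store is at least `v`. -/
def Halts (env : Env n) (s : List Cmd × Store) (T : ℕ) (Q : Store → Prop) (Φ : Store → ℝ≥0∞)
    (v : ℝ≥0∞) : Prop :=
  (∀ s' ∈ (run env T s).support, s'.1 = [] ∧ Q s'.2) ∧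
    v ≤ expect (run env T s) fun s' => Φ s'.2

theorem run_succ' (T : ℕ) (s : List Cmd × Store) :
    run env (T + 1) s = (run env T s).bind (step env) := by
  induction T generalizing s with
  | zero => simp [run]
  | succ T ih =>
    exact (congrArg (step env s).bind (funext ih)).trans (PMF.bind_bind _ _ _).symm

theorem Halts.succ {s : List Cmd × Store} {T : ℕ} {Q : Store → Prop} {Φ : Store → ℝ≥0∞}
    {v : ℝ≥0∞} (h : Halts env s T Q Φ v) : Halts env s (T + 1) Q Φ v := by
  have hrun : run env (T + 1) s = run env T s := by
    rw [run_succ']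
    conv_rhs => rw [← PMF.bind_pure (run env T s)]
    ext s'
    rw [PMF.bind_apply, PMF.bind_apply]
    refine tsum_congr fun a => ?_
    by_cases ha : a ∈ (run env T s).support
    · obtain ⟨K, σ⟩ := a
      obtain rfl : K = [] := (h.1 _ ha).1
      rfl
    · rw [(PMF.apply_eq_zero_iff _ _).2 ha, zero_mul, zero_mul]
  rw [Halts, hrun]
  exact h

theorem Halts.mono {s : List Cmd × Store} {T T' : ℕ} {Q : Store → Prop} {Φ : Store → ℝ≥0∞}
    {v : ℝ≥0∞} (h : Halts env s T Q Φ v) (hT : T ≤ T') : Halts env s T' Q Φ v := by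
  induction hT with
  | refl => exact h
  | step _ ih => exact ih.succ

theorem Halts.of_step {α : Type*} {s : List Cmd × Store} {μ : PMF α} {f : α → List Cmd × Store}
    {T : ℕ} {Q : Store → Prop} {Φ : Store → ℝ≥0∞} {w : α → ℝ≥0∞} (hs : step env s = μ.map f)
    (h : ∀ a ∈ μ.support, Halts env (f a) T Q Φ (w a)) :
    Halts env s (T + 1) Q Φ (expect μ w) := by
  have hrun : run env (T + 1) s = μ.bind fun a => run env T (f a) := by
    rw [run, hs, PMF.bind_map]
    rfl
  rw [Halts, hrun]
  refine ⟨fun s' hs' => ?_, ?_⟩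
  · obtain ⟨a, ha, hs'⟩ := (PMF.mem_support_bind_iff _ _ _).1 hs'
    exact (h a ha).1 s' hs'
  · rw [expect_bind]
    exact expect_mono fun a ha => (h a ha).2

theorem Halts.of_step_pure {s s' : List Cmd × Store} {T : ℕ} {Q : Store → Prop}
    {Φ : Store → ℝ≥0∞} {v : ℝ≥0∞} (hs : step env s = PMF.pure s') (h : Halts env s' T Q Φ v) :
    Halts env s (T + 1) Q Φ v := by
  have := Halts.of_step (μ := PMF.pure s') (f := id) (w := fun _ => v) (T := T) (Q := Q) (Φ := Φ)
    (by rw [hs, PMF.pure_map]; rfl) (fun a ha => by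
      rw [PMF.mem_support_pure_iff] at ha
      exact ha ▸ h)
  rwa [expect_const] at this

/-- The small-step semantics follows the big-step semantics, in front of any continuation. -/
theorem BigStep.halts {p : Cmd} {σ : Store} {T : ℕ} {μ : PMF Store} (h : BigStep env p σ T μ)
    {K : List Cmd} {T' : ℕ} {Q : Store → Prop} {Φ w : Store → ℝ≥0∞}
    (hK : ∀ σ' ∈ μ.support, Halts env (K, σ') T' Q Φ (w σ')) :
    Halts env (p :: K, σ) (T + T') Q Φ (expect μ w) := by
  have hpure : ∀ {p : Cmd} {σ σ' : Store} {K : List Cmd} {T' : ℕ} {w : Store → ℝ≥0∞},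
      step env (p :: K, σ) = PMF.pure (K, σ') →
      (∀ σ'' ∈ (PMF.pure σ').support, Halts env (K, σ'') T' Q Φ (w σ'')) →
      Halts env (p :: K, σ) (1 + T') Q Φ (expect (PMF.pure σ') w) := by
    intro p σ σ' K T' w hs hK
    rw [expect_pure, add_comm]
    exact Halts.of_step_pure hs (hK σ' (by simp))
  have hseq : ∀ {p q : Cmd} {σ : Store} {T₁ T₂ : ℕ} {μ : PMF Store} {ν : Store → PMF Store}
      (_ : ∀ {K : List Cmd} {T' : ℕ} {w : Store → ℝ≥0∞},
        (∀ σ' ∈ μ.support, Halts env (K, σ') T' Q Φ (w σ')) →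
        Halts env (p :: K, σ) (T₁ + T') Q Φ (expect μ w))
      (_ : ∀ σ' ∈ μ.support, ∀ {K : List Cmd} {T' : ℕ} {w : Store → ℝ≥0∞},
        (∀ σ'' ∈ (ν σ').support, Halts env (K, σ'') T' Q Φ (w σ'')) →
        Halts env (q :: K, σ') (T₂ + T') Q Φ (expect (ν σ') w))
      {K : List Cmd} {T' : ℕ} {w : Store → ℝ≥0∞},
      (∀ σ' ∈ (μ.bind ν).support, Halts env (K, σ') T' Q Φ (w σ')) →
      Halts env (p :: q :: K, σ) (T₁ + (T₂ + T')) Q Φ (expect (μ.bind ν) w) := by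
    intro p q σ T₁ T₂ μ ν h1 h2 K T' w hK
    rw [expect_bind]
    exact h1 fun σ' hσ' => h2 σ' hσ' fun σ'' hσ'' =>
      hK σ'' ((PMF.mem_support_bind_iff _ _ _).2 ⟨σ', hσ', hσ''⟩)
  induction h generalizing K T' w with
  | skip | assign | put | query | compare => exact hpure rfl hK
  | rand x e σ =>
    rw [expect_map, add_comm]
    refine Halts.of_step (f := fun v => (K, σ.setVar x v)) rfl fun v hv => hK _ ?_
    exact (PMF.mem_support_map_iff _ _ _).2 ⟨v, hv, rfl⟩
  | seq _ _ ih1 ih2 =>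
    rw [add_right_comm, add_assoc _ _ T']
    exact Halts.of_step_pure rfl (hseq ih1 ih2 hK)
  | cond _ ih =>
    rw [add_right_comm]
    exact Halts.of_step_pure rfl (ih hK)
  | @loopEnd e p σ he =>
    refine hpure ?_ hK
    rw [step, if_neg (by simpa using he)]
  | loopStep he _ _ ih1 ih2 =>
    rw [add_right_comm, add_assoc _ _ T']
    refine Halts.of_step_pure ?_ (hseq ih1 ih2 hK)
    rw [step, if_pos he]
  | mono _ hT ih => exact (ih hK).mono (by omega)

/-! ### Frames -/

/-- The variables that a program may change. -/
def Cmd.vars : Cmd → Finset ℕ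
  | .skip => ∅
  | .assign x _ => {x}
  | .put .. => ∅
  | .rand x _ => {x}
  | .query x _ _ => {x}
  | .compare x _ _ => {x}
  | .seq p q => p.vars ∪ q.vars
  | .cond _ p q => p.vars ∪ q.vars
  | .loop _ p => p.vars

/-- The arrays that a program may change. -/
def Cmd.arrs : Cmd → Finset ℕ
  | .skip => ∅
  | .assign .. => ∅
  | .put a .. => {a}
  | .rand .. => ∅
  | .query .. => ∅
  | .compare .. => ∅
  | .seq p q => p.arrs ∪ q.arrs
  | .cond _ p q => p.arrs ∪ q.arrs
  | .loop _ p => p.arrs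

/-- The stores `σ` and `σ'` agree outside the variables in `V` and the arrays in `A`. -/
def AgreeOff (V A : Finset ℕ) (σ σ' : Store) : Prop :=
  (∀ x ∉ V, σ'.var x = σ.var x) ∧ ∀ a ∉ A, σ'.arr a = σ.arr a

theorem AgreeOff.refl (V A : Finset ℕ) (σ : Store) : AgreeOff V A σ σ :=
  ⟨fun _ _ => rfl, fun _ _ => rfl⟩

theorem AgreeOff.trans {V A V' A' : Finset ℕ} {σ₁ σ₂ σ₃ : Store} (h : AgreeOff V A σ₁ σ₂)
    (h' : AgreeOff V' A' σ₂ σ₃) : AgreeOff (V ∪ V') (A ∪ A') σ₁ σ₃ := by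
  refine ⟨fun x hx => ?_, fun a ha => ?_⟩
  · rw [Finset.notMem_union] at hx
    rw [h'.1 x hx.2, h.1 x hx.1]
  · rw [Finset.notMem_union] at ha
    rw [h'.2 a ha.2, h.2 a ha.1]

theorem AgreeOff.mono {V A V' A' : Finset ℕ} {σ₁ σ₂ : Store} (h : AgreeOff V A σ₁ σ₂)
    (hV : V ⊆ V') (hA : A ⊆ A') : AgreeOff V' A' σ₁ σ₂ :=
  ⟨fun x hx => h.1 x fun hx' => hx (hV hx'), fun a ha => h.2 a fun ha' => ha (hA ha')⟩

theorem agreeOff_setVar (σ : Store) (x v : ℕ) : AgreeOff {x} ∅ σ (σ.setVar x v) := by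
  refine ⟨fun y hy => ?_, fun _ _ => rfl⟩
  rw [Finset.mem_singleton] at hy
  simp [Store.setVar, hy]

theorem agreeOff_setArr (σ : Store) (a i j l v : ℕ) :
    AgreeOff ∅ {a} σ (σ.setArr a i j l v) := by
  refine ⟨fun _ _ => rfl, fun b hb => ?_⟩
  rw [Finset.mem_singleton] at hb
  simp [Store.setArr, hb]

theorem BigStep.agreeOff {p : Cmd} {σ : Store} {T : ℕ} {μ : PMF Store}
    (h : BigStep env p σ T μ) : ∀ σ' ∈ μ.support, AgreeOff p.vars p.arrs σ σ' := by
  induction h with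
  | skip =>
    intro σ' hσ'
    rw [PMF.mem_support_pure_iff] at hσ'
    exact hσ' ▸ AgreeOff.refl _ _ _
  | assign | query | compare =>
    intro σ' hσ'
    rw [PMF.mem_support_pure_iff] at hσ'
    exact hσ' ▸ agreeOff_setVar _ _ _
  | put =>
    intro σ' hσ'
    rw [PMF.mem_support_pure_iff] at hσ'
    exact hσ' ▸ agreeOff_setArr _ _ _ _ _ _
  | rand =>
    intro σ' hσ'
    obtain ⟨v, _, rfl⟩ := (PMF.mem_support_map_iff _ _ _).1 hσ'
    exact agreeOff_setVar _ _ _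
  | seq _ _ ih1 ih2 =>
    intro σ' hσ'
    obtain ⟨σ₁, hσ₁, hσ'⟩ := (PMF.mem_support_bind_iff _ _ _).1 hσ'
    exact (ih1 σ₁ hσ₁).trans (ih2 σ₁ hσ₁ σ' hσ')
  | @cond e p q σ T μ _ ih =>
    intro σ' hσ'
    refine (ih σ' hσ').mono ?_ ?_ <;> split_ifs <;>
      simp only [Cmd.vars, Cmd.arrs, Finset.subset_union_left, Finset.subset_union_right]
  | loopEnd =>
    intro σ' hσ'
    rw [PMF.mem_support_pure_iff] at hσ'
    exact hσ' ▸ AgreeOff.refl _ _ _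
  | loopStep _ _ _ ih1 ih2 =>
    intro σ' hσ'
    obtain ⟨σ₁, hσ₁, hσ'⟩ := (PMF.mem_support_bind_iff _ _ _).1 hσ'
    simpa [Cmd.vars, Cmd.arrs] using (ih1 σ₁ hσ₁).trans (ih2 σ₁ hσ₁ σ' hσ')
  | mono _ _ ih => exact ih

end Semantics

/-! ### Program logic -/

section Logic

variable {n : ℕ} {env : Env n}

/-- From the store `σ`, the program `p` terminates within `T` steps, whatever its random choices,
in a store that satisfies `Q`, and the expectation of `Φ` at the final store is at least `v`. -/
def Triple (env : Env n) (p : Cmd) (σ : Store) (T : ℕ) (Q : Store → Prop) (Φ : Store → ℝ≥0∞)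
    (v : ℝ≥0∞) : Prop :=
  ∃ μ, BigStep env p σ T μ ∧ (∀ σ' ∈ μ.support, Q σ') ∧ v ≤ expect μ Φ

/-- From the store `σ`, the program `p` terminates within `T` steps, whatever its random choices,
in a store that satisfies `Q`. -/
def Sure (env : Env n) (p : Cmd) (σ : Store) (T : ℕ) (Q : Store → Prop) : Prop :=
  Triple env p σ T Q (fun _ => 0) 0

theorem Triple.halts {p : Cmd} {σ : Store} {T : ℕ} {Q : Store → Prop} {Φ : Store → ℝ≥0∞}
    {v : ℝ≥0∞} (h : Triple env p σ T Q Φ v) : Halts env ([p], σ) T Q Φ v := by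
  obtain ⟨μ, h1, h2, h3⟩ := h
  have h4 := h1.halts (K := []) (T' := 0) (Q := Q) (Φ := Φ) (w := Φ) fun σ' hσ' => by
    refine ⟨fun s' hs' => ?_, ?_⟩
    · rw [run, PMF.mem_support_pure_iff] at hs'
      exact hs' ▸ ⟨rfl, h2 σ' hσ'⟩
    · rw [run, expect_pure]
  exact ⟨h4.1, h3.trans h4.2⟩

/-- The rule of consequence; in addition, the final store may be assumed to agree with the initial
one outside the variables and arrays that the program changes. -/
theorem Triple.conseq {p : Cmd} {σ : Store} {T T' : ℕ} {Q Q' : Store → Prop}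
    {Φ Φ' : Store → ℝ≥0∞} {v v' : ℝ≥0∞} (h : Triple env p σ T Q Φ v)
    (hQ : ∀ σ', Q σ' → AgreeOff p.vars p.arrs σ σ' → Q' σ' ∧ Φ σ' ≤ Φ' σ')
    (hv : v' ≤ v := by exact le_rfl)
    (hT : T ≤ T' := by exact le_rfl) : Triple env p σ T' Q' Φ' v' := by
  obtain ⟨μ, h1, h2, h3⟩ := h
  exact ⟨μ, h1.mono hT, fun σ' hσ' => (hQ σ' (h2 σ' hσ') (h1.agreeOff σ' hσ')).1, hv.trans
    (h3.trans (expect_mono fun σ' hσ' => (hQ σ' (h2 σ' hσ') (h1.agreeOff σ' hσ')).2))⟩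

theorem Sure.conseq {p : Cmd} {σ : Store} {T T' : ℕ} {Q Q' : Store → Prop}
    (h : Sure env p σ T Q) (hQ : ∀ σ', Q σ' → AgreeOff p.vars p.arrs σ σ' → Q' σ')
    (hT : T ≤ T' := by exact le_rfl) : Sure env p σ T' Q' :=
  Triple.conseq h (fun σ' h1 h2 => ⟨hQ σ' h1 h2, le_rfl⟩) le_rfl hT

theorem Triple.sure {p : Cmd} {σ : Store} {T : ℕ} {Q : Store → Prop} {Φ : Store → ℝ≥0∞}
    {v : ℝ≥0∞} (h : Triple env p σ T Q Φ v) : Sure env p σ T Q := by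
  obtain ⟨μ, h1, h2, -⟩ := h
  exact ⟨μ, h1, h2, zero_le⟩

theorem Sure.triple {p : Cmd} {σ : Store} {T : ℕ} {Q Q' : Store → Prop} {Φ : Store → ℝ≥0∞}
    {v : ℝ≥0∞} (h : Sure env p σ T Q)
    (hQ : ∀ σ', Q σ' → AgreeOff p.vars p.arrs σ σ' → Q' σ' ∧ v ≤ Φ σ') :
    Triple env p σ T Q' Φ v := by
  obtain ⟨μ, h1, h2, -⟩ := h
  exact ⟨μ, h1, fun σ' hσ' => (hQ σ' (h2 σ' hσ') (h1.agreeOff σ' hσ')).1,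
    le_expect fun σ' hσ' => (hQ σ' (h2 σ' hσ') (h1.agreeOff σ' hσ')).2⟩

/-- If an event has probability at least `q`, then a function that is at least `a` on the event
and at least `b ≤ a` elsewhere has expectation at least `q * a + (1 - q) * b`. -/
theorem Triple.convex {p : Cmd} {σ : Store} {T : ℕ} {Q : Store → Prop} {A : Set Store}
    {q a b : ℝ≥0∞} {Φ : Store → ℝ≥0∞} (h : Triple env p σ T Q (A.indicator 1) q) (hba : b ≤ a)
    (ha : ∀ σ', Q σ' → AgreeOff p.vars p.arrs σ σ' → σ' ∈ A → a ≤ Φ σ')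
    (hb : ∀ σ', Q σ' → AgreeOff p.vars p.arrs σ σ' → b ≤ Φ σ') :
    Triple env p σ T Q Φ (q * a + (1 - q) * b) := by
  obtain ⟨μ, h1, h2, h3⟩ := h
  refine ⟨μ, h1, h2, ?_⟩
  rw [expect_indicator] at h3
  exact convex_le_expect h3 hba (fun s hs hA => ha s (h2 s hs) (h1.agreeOff s hs) hA)
    fun s hs => hb s (h2 s hs) (h1.agreeOff s hs)

theorem Triple.skip {σ : Store} {Q : Store → Prop} {Φ : Store → ℝ≥0∞} {v : ℝ≥0∞} (hQ : Q σ)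
    (hv : v ≤ Φ σ) : Triple env .skip σ 1 Q Φ v :=
  ⟨_, .skip σ, by simpa using hQ, by rwa [expect_pure]⟩

theorem Triple.assign {x : ℕ} {e : Expr} {σ : Store} {Q : Store → Prop} {Φ : Store → ℝ≥0∞}
    {v : ℝ≥0∞} (hQ : Q (σ.setVar x (e.eval σ))) (hv : v ≤ Φ (σ.setVar x (e.eval σ))) :
    Triple env (.assign x e) σ 1 Q Φ v :=
  ⟨_, .assign x e σ, by simpa using hQ, by rwa [expect_pure]⟩

theorem Sure.skip {σ : Store} {Q : Store → Prop} (hQ : Q σ) : Sure env .skip σ 1 Q :=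
  Triple.skip hQ le_rfl

theorem Sure.assign {x : ℕ} {e : Expr} {σ : Store} {Q : Store → Prop}
    (hQ : Q (σ.setVar x (e.eval σ))) : Sure env (.assign x e) σ 1 Q :=
  Triple.assign hQ le_rfl

theorem Sure.put {a : ℕ} {i j l e : Expr} {σ : Store} {Q : Store → Prop}
    (hQ : Q (σ.setArr a (i.eval σ) (j.eval σ) (l.eval σ) (e.eval σ))) :
    Sure env (.put a i j l e) σ 1 Q :=
  ⟨_, .put a i j l e σ, by simpa using hQ, zero_le⟩

theorem Sure.query {x a : ℕ} {i : Expr} {σ : Store} {Q : Store → Prop}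
    (hQ : Q (σ.setVar x (env.query (σ.row n a (i.eval σ))))) : Sure env (.query x a i) σ 1 Q :=
  ⟨_, .query x a i σ, by simpa using hQ, zero_le⟩

theorem Sure.compare {x : ℕ} {e f : Expr} {σ : Store} {Q : Store → Prop}
    (hQ : Q (σ.setVar x (env.compare (e.eval σ) (f.eval σ)))) :
    Sure env (.compare x e f) σ 1 Q :=
  ⟨_, .compare x e f σ, by simpa using hQ, zero_le⟩

theorem uniformBelow_succ (m : ℕ) :
    uniformBelow (m + 1) = (PMF.uniformOfFintype (Fin (m + 1))).map Fin.val := by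
  exact PMF.map_id _

theorem lt_of_mem_support_uniformBelow {m v : ℕ} (hm : 0 < m)
    (hv : v ∈ (uniformBelow m).support) : v < m := by
  obtain ⟨m, rfl⟩ := Nat.exists_eq_succ_of_ne_zero hm.ne'
  rw [Nat.succ_eq_add_one, uniformBelow_succ] at hv
  obtain ⟨u, _, rfl⟩ := (PMF.mem_support_map_iff _ _ _).1 hv
  exact u.2

theorem expect_uniformBelow {m : ℕ} (hm : 0 < m) (w : ℕ → ℝ≥0∞) :
    expect (uniformBelow m) w = (m : ℝ≥0∞)⁻¹ * ∑ v ∈ Finset.range m, w v := by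
  obtain ⟨m, rfl⟩ := Nat.exists_eq_succ_of_ne_zero hm.ne'
  rw [Nat.succ_eq_add_one, uniformBelow_succ, expect_map, expect, tsum_fintype,
    Finset.sum_range, Finset.mul_sum]
  simp [PMF.uniformOfFintype_apply]

theorem Triple.rand {x : ℕ} {e : Expr} {σ : Store} {Q : Store → Prop} {Φ : Store → ℝ≥0∞} {m : ℕ}
    {v : ℝ≥0∞} (hm : e.eval σ = m) (hm0 : 0 < m) (hQ : ∀ u < m, Q (σ.setVar x u))
    (hv : v ≤ (m : ℝ≥0∞)⁻¹ * ∑ u ∈ Finset.range m, Φ (σ.setVar x u)) :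
    Triple env (.rand x e) σ 1 Q Φ v := by
  subst hm
  refine ⟨_, .rand x e σ, fun σ' hσ' => ?_, ?_⟩
  · obtain ⟨u, hu, rfl⟩ := (PMF.mem_support_map_iff _ _ _).1 hσ'
    exact hQ u (lt_of_mem_support_uniformBelow hm0 hu)
  · rwa [expect_map, expect_uniformBelow hm0]

theorem Triple.seq {p q : Cmd} {σ : Store} {T₁ T₂ : ℕ} {Q₁ Q : Store → Prop}
    {Φ₁ Φ : Store → ℝ≥0∞} {v : ℝ≥0∞} (hp : Triple env p σ T₁ Q₁ Φ₁ v)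
    (hq : ∀ σ', Q₁ σ' → AgreeOff p.vars p.arrs σ σ' → Triple env q σ' T₂ Q Φ (Φ₁ σ')) :
    Triple env (.seq p q) σ (T₁ + T₂ + 1) Q Φ v := by
  classical
  obtain ⟨μ, h1, h2, h3⟩ := hp
  have hq' : ∀ σ', ∃ ν : PMF Store, σ' ∈ μ.support → BigStep env q σ' T₂ ν ∧
      (∀ σ'' ∈ ν.support, Q σ'') ∧ Φ₁ σ' ≤ expect ν Φ := fun σ' => by
    by_cases hσ' : σ' ∈ μ.support
    · obtain ⟨ν, hν⟩ := hq σ' (h2 σ' hσ') (h1.agreeOff σ' hσ')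
      exact ⟨ν, fun _ => hν⟩
    · exact ⟨PMF.pure σ', fun h => absurd h hσ'⟩
  choose ν hν using hq'
  refine ⟨μ.bind ν, .seq h1 fun σ' hσ' => (hν σ' hσ').1, fun σ'' hσ'' => ?_, ?_⟩
  · obtain ⟨σ', hσ', hσ''⟩ := (PMF.mem_support_bind_iff _ _ _).1 hσ''
    exact (hν σ' hσ').2.1 σ'' hσ''
  · rw [expect_bind]
    exact h3.trans (expect_mono fun σ' hσ' => (hν σ' hσ').2.2)

theorem Sure.seq {p q : Cmd} {σ : Store} {T₁ T₂ : ℕ} {Q₁ Q : Store → Prop}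
    (hp : Sure env p σ T₁ Q₁)
    (hq : ∀ σ', Q₁ σ' → AgreeOff p.vars p.arrs σ σ' → Sure env q σ' T₂ Q) :
    Sure env (.seq p q) σ (T₁ + T₂ + 1) Q :=
  Triple.seq hp hq

/-- Sequencing with a first part whose outcome is known. -/
theorem Sure.seq_triple {p q : Cmd} {σ : Store} {T₁ T₂ : ℕ} {Q₁ Q : Store → Prop}
    {Φ : Store → ℝ≥0∞} {v : ℝ≥0∞} (hp : Sure env p σ T₁ Q₁)
    (hq : ∀ σ', Q₁ σ' → AgreeOff p.vars p.arrs σ σ' → Triple env q σ' T₂ Q Φ v) :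
    Triple env (.seq p q) σ (T₁ + T₂ + 1) Q Φ v :=
  Triple.seq (hp.triple (Φ := fun _ => v) fun _ h _ => ⟨h, le_rfl⟩) hq

theorem Triple.cond {e : Expr} {p q : Cmd} {σ : Store} {T : ℕ} {Q : Store → Prop}
    {Φ : Store → ℝ≥0∞} {v : ℝ≥0∞} (hp : e.eval σ ≠ 0 → Triple env p σ T Q Φ v)
    (hq : e.eval σ = 0 → Triple env q σ T Q Φ v) :
    Triple env (.cond e p q) σ (T + 1) Q Φ v := by
  have h : Triple env (if e.eval σ ≠ 0 then p else q) σ T Q Φ v := by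
    split_ifs with he
    · exact hp he
    · exact hq (not_not.1 he)
  obtain ⟨μ, h1, h2, h3⟩ := h
  exact ⟨μ, .cond h1, h2, h3⟩

theorem Sure.cond {e : Expr} {p q : Cmd} {σ : Store} {T : ℕ} {Q : Store → Prop}
    (hp : e.eval σ ≠ 0 → Sure env p σ T Q) (hq : e.eval σ = 0 → Sure env q σ T Q) :
    Sure env (.cond e p q) σ (T + 1) Q :=
  Triple.cond hp hq

theorem Sure.le {p : Cmd} {σ : Store} {T T' : ℕ} {Q : Store → Prop} (h : Sure env p σ T Q)
    (hT : T ≤ T') : Sure env p σ T' Q :=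
  h.conseq (fun _ h _ => h) hT

theorem Triple.le {p : Cmd} {σ : Store} {T T' : ℕ} {Q : Store → Prop} {Φ : Store → ℝ≥0∞}
    {v : ℝ≥0∞} (h : Triple env p σ T Q Φ v) (hT : T ≤ T') : Triple env p σ T' Q Φ v :=
  h.conseq (fun _ h _ => ⟨h, le_rfl⟩) le_rfl hT

theorem indicator_one_le {α β : Type*} {A : Set α} {B : Set β} {s : α} {t : β}
    (h : s ∈ A → t ∈ B) : A.indicator (1 : α → ℝ≥0∞) s ≤ B.indicator 1 t := by
  by_cases hs : s ∈ A
  · rw [Set.indicator_of_mem hs, Set.indicator_of_mem (h hs), Pi.one_apply, Pi.one_apply]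
  · rw [Set.indicator_of_notMem hs]
    exact zero_le

/-- `for x = 0, …, e - 1 do p`. -/
def Cmd.times (x : ℕ) (e : Expr) (p : Cmd) : Cmd :=
  .seq (.assign x (.num 0))
    (.loop (.sub e (.var x)) (.seq p (.assign x (.add (.var x) (.num 1)))))

/-- A time bound for a `for` loop with `N` iterations, each of which takes time `t`. It is defined
over all semirings, so that it makes sense for polynomials, too. -/
def loopTime {R : Type*} [Semiring R] (N t : R) : R := N * (t + 3) + 3

/-- The rule for `for` loops, with an invariant `I i` and a potential `Φ i` whose expectation does
not decrease. -/
theorem Triple.times {x : ℕ} {e : Expr} {p : Cmd} {σ : Store} {N D t : ℕ}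
    (I : ℕ → Store → Prop) (Φ : ℕ → Store → ℝ≥0∞) (hx : x ∉ p.vars)
    (he : ∀ σ', AgreeOff (insert x p.vars) p.arrs σ σ' → e.eval σ' = N) (hN : N ≤ D)
    (h0 : I 0 (σ.setVar x 0))
    (hstep : ∀ i < N, ∀ σ', AgreeOff (insert x p.vars) p.arrs σ σ' → σ'.var x = i → I i σ' →
      Triple env p σ' t (fun σ'' => I (i + 1) (σ''.setVar x (i + 1)))
        (fun σ'' => Φ (i + 1) (σ''.setVar x (i + 1))) (Φ i σ')) :
    Triple env (.times x e p) σ (loopTime D t) (I N) (Φ N) (Φ 0 (σ.setVar x 0)) := by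
  have key : ∀ d i, i + d = N → ∀ σ', AgreeOff (insert x p.vars) p.arrs σ σ' → σ'.var x = i →
      I i σ' → Triple env (.loop (.sub e (.var x)) (.seq p (.assign x (.add (.var x) (.num 1)))))
        σ' (d * (t + 3) + 1) (I N) (Φ N) (Φ i σ') := by
    intro d
    induction d with
    | zero =>
      intro i hi σ' hσ' hxi hI
      obtain rfl : i = N := by omega
      refine ⟨PMF.pure σ', (BigStep.loopEnd ?_).mono (by omega), by simpa using hI,
        by rw [expect_pure]⟩
      rw [Expr.eval, he σ' hσ', Expr.eval, hxi, Nat.sub_self]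
    | succ d ih =>
      intro i hi σ' hσ' hxi hI
      have hbody : Triple env (.seq p (.assign x (.add (.var x) (.num 1)))) σ' (t + 1 + 1)
          (fun σ'' => I (i + 1) σ'' ∧ σ''.var x = i + 1 ∧
            AgreeOff (insert x p.vars) p.arrs σ σ'') (Φ (i + 1)) (Φ i σ') := by
        refine Triple.seq (hstep i (by omega) σ' hσ' hxi hI) fun σ'' hσ'' hag => ?_
        have hx' : σ''.var x = i := by rw [hag.1 x hx, hxi]
        refine Triple.assign ?_ ?_ <;> simp only [Expr.eval, hx']
        · refine ⟨hσ'', by simp [Store.setVar], ?_⟩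
          have := (hσ'.trans hag).trans (agreeOff_setVar σ'' x (i + 1))
          refine this.mono ?_ ?_
          · intro y
            simp only [Finset.mem_union, Finset.mem_insert, Finset.mem_singleton]
            tauto
          · intro y
            simp
        · exact le_rfl
      obtain ⟨μ, h1, h2, h3⟩ := hbody
      have hq' : ∀ σ', ∃ ν : PMF Store, σ' ∈ μ.support →
          BigStep env (.loop (.sub e (.var x)) (.seq p (.assign x (.add (.var x) (.num 1)))))
            σ' (d * (t + 3) + 1) ν ∧
          (∀ σ'' ∈ ν.support, I N σ'') ∧ Φ (i + 1) σ' ≤ expect ν (Φ N) := fun σ' => by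
        by_cases hσ' : σ' ∈ μ.support
        · obtain ⟨hI, hx, hag⟩ := h2 σ' hσ'
          obtain ⟨ν, hν⟩ := ih (i + 1) (by omega) σ' hag hx hI
          exact ⟨ν, fun _ => hν⟩
        · exact ⟨PMF.pure σ', fun h => absurd h hσ'⟩
      choose ν hν using hq'
      refine ⟨μ.bind ν, (BigStep.loopStep ?_ h1 fun σ' hσ' => (hν σ' hσ').1).mono ?_,
        fun σ'' hσ'' => ?_, ?_⟩
      · rw [Expr.eval, he σ' hσ', Expr.eval, hxi]
        omega
      · rw [add_mul]
        omega
      · obtain ⟨σ', hσ', hσ''⟩ := (PMF.mem_support_bind_iff _ _ _).1 hσ''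
        exact (hν σ' hσ').2.1 σ'' hσ''
      · rw [expect_bind]
        exact h3.trans (expect_mono fun σ' hσ' => (hν σ' hσ').2.2)
  have hassign : Triple env (.assign x (.num 0)) σ 1 (fun σ' => σ' = σ.setVar x 0)
      (Φ 0) (Φ 0 (σ.setVar x 0)) := Triple.assign rfl le_rfl
  refine (Triple.seq hassign (Q := I N) (Φ := Φ N) (T₂ := N * (t + 3) + 1) ?_).le ?_
  · rintro σ' rfl -
    refine key N 0 (by omega) _ ?_ (by simp [Store.setVar]) h0
    exact (agreeOff_setVar σ x 0).mono (by simp) (by simp)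
  · have := Nat.mul_le_mul_right (t + 3) hN
    simp only [loopTime]
    omega

theorem Sure.times {x : ℕ} {e : Expr} {p : Cmd} {σ : Store} {N D t : ℕ}
    (I : ℕ → Store → Prop) (hx : x ∉ p.vars)
    (he : ∀ σ', AgreeOff (insert x p.vars) p.arrs σ σ' → e.eval σ' = N) (hN : N ≤ D)
    (h0 : I 0 (σ.setVar x 0))
    (hstep : ∀ i < N, ∀ σ', AgreeOff (insert x p.vars) p.arrs σ σ' → σ'.var x = i → I i σ' →
      Sure env p σ' t (fun σ'' => I (i + 1) (σ''.setVar x (i + 1)))) :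
    Sure env (.times x e p) σ (loopTime D t) (I N) :=
  Triple.times I (fun _ _ => 0) hx he hN h0 hstep

@[simp] theorem setVar_var_self (σ : Store) (x v : ℕ) : (σ.setVar x v).var x = v := by
  simp [Store.setVar]

theorem setVar_var_of_ne {σ : Store} {x y v : ℕ} (h : y ≠ x) :
    (σ.setVar x v).var y = σ.var y := by
  simp [Store.setVar, h]

@[simp] theorem setVar_arr (σ : Store) (x v : ℕ) : (σ.setVar x v).arr = σ.arr := rfl

@[simp] theorem setArr_var (σ : Store) (a i j l v : ℕ) : (σ.setArr a i j l v).var = σ.var := rfl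

theorem setArr_arr_of_ne {σ : Store} {a b i j l v : ℕ} (h : b ≠ a) :
    (σ.setArr a i j l v).arr b = σ.arr b := by
  simp [Store.setArr, h]

theorem setArr_arr_self (σ : Store) (a i j l v j' : ℕ) :
    (σ.setArr a i j l v).arr a i j' l = if j' = j then v else σ.arr a i j' l := by
  simp [Store.setArr]

theorem mem_row {σ : Store} {a i : ℕ} {e : Fin n} : e ∈ σ.row n a i ↔ σ.arr a i e 0 ≠ 0 := by
  simp [Store.row]

end Logic

/-! ### Separating levels of a laminar matroid -/

section Levels

variable {E : Type} [DecidableEq E] {L : LaminarRep E}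

/-- Level `i` separates `B` from `x`: the capacity of `B` is at most `i`, and the sets of capacity
at most `i` that contain `x` are disjoint from `B`. -/
def LaminarRep.Separates (L : LaminarRep E) (x : E) (B : Finset E) (i : ℕ) : Prop :=
  L.cap B ≤ i ∧ ∀ A ∈ L.sets, L.cap A ≤ i → x ∈ A → Disjoint A B

theorem card_inter_lt {X A B : Finset E} {x : E} (hx : x ∈ X) (hxA : x ∈ A) (hxB : x ∉ B)
    (hBA : B ⊆ A) : (X ∩ B).card < (X ∩ A).card :=
  Finset.card_lt_card ⟨Finset.inter_subset_inter_left hBA, fun hs =>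
    hxB (Finset.mem_inter.1 (hs (Finset.mem_inter.2 ⟨hx, hxA⟩))).2⟩

theorem card_inter_add_card_inter {X A B : Finset E} (h : Disjoint A B) :
    (X ∩ A).card + (X ∩ B).card = (X ∩ (A ∪ B)).card := by
  rw [Finset.inter_union_distrib_left, Finset.card_union_of_disjoint
    (h.mono Finset.inter_subset_right Finset.inter_subset_right)]

/-- All tight sets without `x` can be separated from `x` with `log₂ k` levels. The levels are found
from below: a smallest set `A'` that includes `x` and a set not yet separated has twice as many
elements of `X` as its predecessor `A`, and the level just below its capacity separates all sets of
smaller capacity. -/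
theorem LaminarRep.exists_levels {X : Finset E} {x : E} {k : ℕ}
    (hX : ∀ A ∈ L.sets, (X ∩ A).card ≤ L.cap A) (hx : x ∈ X) (hk : X.card ≤ k) :
    ∃ lv : ℕ → ℕ, (∀ s, lv s < k) ∧
      ∀ B ∈ L.sets, x ∉ B → 1 ≤ L.cap B → L.cap B ≤ (X ∩ B).card →
        ∃ s < Nat.log 2 k, L.Separates x B (lv s) := by
  classical
  have hk1 : 1 ≤ k := (Finset.card_pos.2 ⟨x, hx⟩).trans_le hk
  have hBk : ∀ B : Finset E, x ∉ B → (X ∩ B).card < k := fun B hxB =>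
    (card_inter_lt hx (Finset.mem_union_right B hx) hxB Finset.subset_union_left).trans_le
      ((Finset.card_le_card Finset.inter_subset_left).trans hk)
  have claim : ∀ j, ∃ lv : ℕ → ℕ, (∀ s, lv s < k) ∧ ∃ A : Finset E, (A ∈ L.sets ∨ A = {x}) ∧
      x ∈ A ∧ ∀ B ∈ L.sets, x ∉ B → 1 ≤ L.cap B → L.cap B ≤ (X ∩ B).card →
        (∃ s < j, L.Separates x B (lv s)) ∨
          2 ^ j ≤ (X ∩ A).card ∧ Disjoint A B ∧ (X ∩ A).card ≤ L.cap B := by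
    intro j
    induction j with
    | zero =>
      refine ⟨fun _ => 0, fun _ => hk1, {x}, Or.inr rfl, by simp, ?_⟩
      intro B hB hxB h1 h2
      have : X ∩ {x} = {x} := Finset.inter_singleton_of_mem hx
      exact Or.inr (by simp [this, hxB, h1])
    | succ j ih =>
      obtain ⟨lv, hlv, A, hA, hxA, hAB⟩ := ih
      have hold : ∀ (i : ℕ) (B : Finset E), (∃ s < j, L.Separates x B (lv s)) →
          ∃ s < j + 1, L.Separates x B (Function.update lv j i s) := by
        rintro i B ⟨s, hs, h⟩
        exact ⟨s, by omega, by rwa [Function.update_of_ne hs.ne]⟩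
      have hnew : ∀ (i : ℕ) (B : Finset E), L.Separates x B i →
          ∃ s < j + 1, L.Separates x B (Function.update lv j i s) := fun i B h =>
        ⟨j, by omega, by rwa [Function.update_self]⟩
      have hlt : ∀ i < k, ∀ s, Function.update lv j i s < k := by
        intro i hi s
        by_cases hs : s = j
        · rwa [hs, Function.update_self]
        · rw [Function.update_of_ne hs]
          exact hlv s
      set 𝒮 := L.sets.toFinset.filter fun A' => x ∈ A' ∧ ∃ B ∈ L.sets, x ∉ B ∧ 1 ≤ L.cap B ∧
        L.cap B ≤ (X ∩ B).card ∧ (¬ ∃ s < j, L.Separates x B (lv s)) ∧ ¬ Disjoint A' B with h𝒮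
      rcases Finset.eq_empty_or_nonempty 𝒮 with hemp | hne
      · refine ⟨Function.update lv j (k - 1), hlt _ (by omega), A, hA, hxA, ?_⟩
        intro B hB hxB h1 h2
        by_cases hs : ∃ s < j, L.Separates x B (lv s)
        · exact Or.inl (hold _ B hs)
        · refine Or.inl (hnew _ B ⟨?_, fun A' hA' _ hxA' => ?_⟩)
          · have := hBk B hxB
            omega
          · by_contra hdis
            have : A' ∈ 𝒮 := Finset.mem_filter.2
              ⟨List.mem_toFinset.2 hA', hxA', B, hB, hxB, h1, h2, hs, hdis⟩
            simp [hemp] at this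
      · obtain ⟨A', hA'𝒮, hmin⟩ := Finset.exists_min_image 𝒮 L.cap hne
        obtain ⟨hA', hxA', B₀, hB₀, hxB₀, hB₀1, hB₀2, hB₀s, hB₀A'⟩ := Finset.mem_filter.1 hA'𝒮
        rw [List.mem_toFinset] at hA'
        have hsub : ∀ B ∈ L.sets, x ∉ B → ¬ Disjoint A' B → B ⊆ A' := by
          intro B hB hxB h
          rw [Finset.not_disjoint_iff_nonempty_inter] at h
          exact (L.laminar A' hA' B hB h).resolve_left fun h => hxB (h hxA')
        obtain ⟨hj, hdis, hle⟩ := (hAB B₀ hB₀ hxB₀ hB₀1 hB₀2).resolve_left hB₀s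
        have hAA' : A ⊆ A' := by
          rcases hA with hA | rfl
          · refine (L.laminar A hA A' hA' ⟨x, Finset.mem_inter.2 ⟨hxA, hxA'⟩⟩).resolve_right
              fun h => hB₀A' (hdis.mono_left h)
          · simpa using hxA'
        have hdouble : 2 ^ (j + 1) ≤ (X ∩ A').card := by
          have h1 := card_inter_add_card_inter (X := X) hdis
          have h2 : (X ∩ (A ∪ B₀)).card ≤ (X ∩ A').card := Finset.card_le_card
            (Finset.inter_subset_inter_left (Finset.union_subset hAA' (hsub B₀ hB₀ hxB₀ hB₀A')))
          rw [pow_succ]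
          omega
        have hcapA' := hX A' hA'
        refine ⟨Function.update lv j (min (L.cap A' - 1) (k - 1)), hlt _ (by omega), A',
          Or.inl hA', hxA', ?_⟩
        intro B hB hxB h1 h2
        by_cases hs : ∃ s < j, L.Separates x B (lv s)
        · exact Or.inl (hold _ B hs)
        · by_cases hcap : L.cap B < L.cap A'
          · refine Or.inl (hnew _ B ⟨?_, fun D hD hDc hxD => ?_⟩)
            · have := hBk B hxB
              omega
            · by_contra hDB
              have := hmin D (Finset.mem_filter.2
                ⟨List.mem_toFinset.2 hD, hxD, B, hB, hxB, h1, h2, hs, hDB⟩)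
              omega
          · refine Or.inr ⟨hdouble, ?_, by omega⟩
            by_contra hdis'
            have := card_inter_lt hx hxA' hxB (hsub B hB hxB hdis')
            omega
  obtain ⟨lv, hlv, A, -, hxA, hAB⟩ := claim (Nat.log 2 k)
  refine ⟨lv, hlv, fun B hB hxB h1 h2 => (hAB B hB hxB h1 h2).resolve_right ?_⟩
  rintro ⟨h3, h4, h5⟩
  have h6 := card_inter_add_card_inter (X := X) h4
  have h7 : (X ∩ (A ∪ B)).card ≤ X.card := Finset.card_le_card Finset.inter_subset_left
  have h8 := Nat.lt_pow_succ_log_self (b := 2) (by norm_num) k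
  rw [pow_succ] at h8
  omega

theorem LaminarRep.indep_exchange {M : Matroid E} (hL : L.Represents M) {X : Finset E}
    (hX : M.Indep (X : Set E)) {x y : E} (hx : x ∈ X)
    (h : ∀ A ∈ L.sets, x ∉ A → L.cap A ≤ (X ∩ A).card → y ∉ A) :
    M.Indep ((insert y (X.erase x) : Finset E) : Set E) := by
  rw [hL.2]
  intro A hA
  by_contra hlt
  obtain ⟨h1, h2, h3⟩ := tight_of_exchange_violates hx ((hL.2 X).1 hX A hA) (not_le.1 hlt)
  exact h A hA h2 h3 h1

/-- The classes of this relation are the inclusionwise maximal sets of capacity at most `i`. -/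
def LaminarRep.Rel (L : LaminarRep E) (i : ℕ) (e f : E) : Prop :=
  e = f ∨ ∃ A ∈ L.sets, L.cap A ≤ i ∧ e ∈ A ∧ f ∈ A

theorem LaminarRep.Rel.symm {i : ℕ} {e f : E} (h : L.Rel i e f) : L.Rel i f e := by
  rcases h with rfl | ⟨A, h1, h2, h3, h4⟩
  · exact Or.inl rfl
  · exact Or.inr ⟨A, h1, h2, h4, h3⟩

theorem LaminarRep.Rel.trans {i : ℕ} {e f g : E} (h : L.Rel i e f) (h' : L.Rel i f g) :
    L.Rel i e g := by
  rcases h with rfl | ⟨A, h1, h2, h3, h4⟩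
  · exact h'
  rcases h' with rfl | ⟨B, h5, h6, h7, h8⟩
  · exact Or.inr ⟨A, h1, h2, h3, h4⟩
  rcases L.laminar A h1 B h5 ⟨f, Finset.mem_inter.2 ⟨h4, h7⟩⟩ with h | h
  · exact Or.inr ⟨B, h5, h6, h h3, h8⟩
  · exact Or.inr ⟨A, h1, h2, h3, h h8⟩

/-- A laminar family of distinct sets has at most `n * n + 1` members, as a nonempty member is
determined by its smallest element and its size. -/
theorem LaminarRep.length_sets_le {n : ℕ} (L : LaminarRep (Fin n)) :
    L.sets.length ≤ n * n + 1 := by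
  classical
  rw [← List.toFinset_card_of_nodup L.nodup]
  have h1 : (L.sets.toFinset.erase ∅).card ≤ n * n := by
    let f : Finset (Fin n) → ℕ × ℕ := fun A =>
      ((if h : A.Nonempty then (A.min' h : ℕ) else 0), A.card - 1)
    have hf : ∀ A ∈ L.sets.toFinset.erase ∅, f A ∈ Finset.range n ×ˢ Finset.range n := by
      intro A hA
      have hne := Finset.nonempty_iff_ne_empty.2 (Finset.mem_erase.1 hA).1
      have hc : A.card ≤ n := by simpa using Finset.card_le_univ A
      have := hne.card_pos
      simp only [f, dif_pos hne, Finset.mem_product, Finset.mem_range, Fin.is_lt, true_and]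
      omega
    refine (Finset.card_le_card_of_injOn f hf ?_).trans (by simp)
    intro A hA B hB hAB
    obtain ⟨hA1, hA2⟩ := Finset.mem_erase.1 (Finset.mem_coe.1 hA)
    obtain ⟨hB1, hB2⟩ := Finset.mem_erase.1 (Finset.mem_coe.1 hB)
    have hA3 := Finset.nonempty_iff_ne_empty.2 hA1
    have hB3 := Finset.nonempty_iff_ne_empty.2 hB1
    simp only [f, dif_pos hA3, dif_pos hB3, Prod.mk.injEq] at hAB
    have hmin : A.min' hA3 = B.min' hB3 := Fin.ext hAB.1
    have hcard : A.card = B.card := by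
      have := hA3.card_pos
      have := hB3.card_pos
      omega
    rcases L.laminar A (List.mem_toFinset.1 hA2) B (List.mem_toFinset.1 hB2)
      ⟨A.min' hA3, Finset.mem_inter.2 ⟨A.min'_mem hA3, hmin ▸ B.min'_mem hB3⟩⟩ with h | h
    · exact Finset.eq_of_subset_of_card_le h hcard.ge
    · exact (Finset.eq_of_subset_of_card_le h hcard.le).symm
  have := Finset.pred_card_le_card_erase (s := L.sets.toFinset) (a := ∅)
  omega

end Levels

/-! ### Coins for the classes of a level -/

section Coins

open Classical in
/-- The probability that the coin that is tossed for `e` is as desired. Only the coin of the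
smallest element of a class matters: it has to be `0` for the class of `x`, and it has to be
different from `0` for the classes of other elements of `X`. -/
noncomputable def coinWeight {n : ℕ} (L : LaminarRep (Fin n)) (i K : ℕ) (X : Finset (Fin n))
    (x e : Fin n) : ℝ≥0∞ :=
  if ∀ f < e, ¬ L.Rel i e f then
    if L.Rel i e x then (K : ℝ≥0∞)⁻¹
    else if ∃ f ∈ X, L.Rel i e f then ((1 - (K : ℝ≥0)⁻¹ : ℝ≥0) : ℝ≥0∞) else 1
  else 1

theorem prod_coinWeight_ge {n : ℕ} (L : LaminarRep (Fin n)) (i : ℕ) {K : ℕ} {X : Finset (Fin n)}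
    {x : Fin n} (hx : x ∈ X) (hK : X.card ≤ K) :
    ((K : ℝ≥0∞)⁻¹) ^ 2 ≤ ∏ e, coinWeight L i K X x e := by
  classical
  have hK1 : 1 ≤ K := (Finset.card_pos.2 ⟨x, hx⟩).trans_le hK
  have hinv : (K : ℝ≥0∞)⁻¹ ≤ 1 := ENNReal.inv_le_one.2 (by exact_mod_cast hK1)
  have hsplit : ∀ e, coinWeight L i K X x e =
      (if (∀ f < e, ¬ L.Rel i e f) ∧ L.Rel i e x then (K : ℝ≥0∞)⁻¹ else 1) *
      (if (∀ f < e, ¬ L.Rel i e f) ∧ ¬ L.Rel i e x ∧ ∃ f ∈ X, L.Rel i e f then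
        ((1 - (K : ℝ≥0)⁻¹ : ℝ≥0) : ℝ≥0∞) else 1) := by
    intro e
    rw [coinWeight]
    split_ifs <;> simp_all
  -- distinct smallest elements of classes are not related
  have hmin : ∀ e f : Fin n, (∀ g < e, ¬ L.Rel i e g) → (∀ g < f, ¬ L.Rel i f g) →
      L.Rel i e f → e = f := by
    intro e f he hf h
    rcases lt_trichotomy e f with h1 | h1 | h1
    · exact absurd h.symm (hf e h1)
    · exact h1
    · exact absurd h (he f h1)
  simp only [hsplit, Finset.prod_mul_distrib, Finset.prod_ite, Finset.prod_const, one_pow,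
    mul_one]
  have h1 : (Finset.univ.filter fun e => (∀ f < e, ¬ L.Rel i e f) ∧ L.Rel i e x).card ≤ 1 := by
    refine Finset.card_le_one.2 fun e he f hf => ?_
    obtain ⟨-, he1, he2⟩ := Finset.mem_filter.1 he
    obtain ⟨-, hf1, hf2⟩ := Finset.mem_filter.1 hf
    exact hmin e f he1 hf1 (he2.trans hf2.symm)
  have h2 : (Finset.univ.filter fun e => (∀ f < e, ¬ L.Rel i e f) ∧ ¬ L.Rel i e x ∧
      ∃ f ∈ X, L.Rel i e f).card + 1 ≤ K := by
    refine le_trans ?_ hK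
    rw [← Finset.card_erase_add_one hx]
    refine Nat.add_le_add_right ?_ 1
    have hex : ∀ e ∈ Finset.univ.filter fun e => (∀ f < e, ¬ L.Rel i e f) ∧ ¬ L.Rel i e x ∧
        ∃ f ∈ X, L.Rel i e f, ∃ f, f ∈ X ∧ L.Rel i e f := fun e he =>
      (Finset.mem_filter.1 he).2.2.2
    have : Nonempty (Fin n) := ⟨x⟩
    choose! g hg using hex
    refine Finset.card_le_card_of_injOn g (fun e he => ?_) fun e he f hf hef => ?_
    · have := (Finset.mem_filter.1 he).2.2.1
      refine Finset.mem_erase.2 ⟨fun h => this ?_, (hg e he).1⟩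
      exact h ▸ (hg e he).2
    · refine hmin e f (Finset.mem_filter.1 he).2.1 (Finset.mem_filter.1 hf).2.1 ?_
      have h3 := (hg f hf).2
      rw [← hef] at h3
      exact (hg e he).2.trans h3.symm
  rw [sq]
  refine mul_le_mul' ?_ ?_
  · exact (pow_one ((K : ℝ≥0∞)⁻¹)).symm.le.trans (pow_le_pow_of_le_one (by simp) hinv h1)
  · have := inv_le_one_sub_inv_pow hK1 h2
    have h3 : (K : ℝ≥0∞)⁻¹ = (((K : ℝ≥0)⁻¹ : ℝ≥0) : ℝ≥0∞) := by
      rw [ENNReal.coe_inv (by positivity)]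
      simp
    rw [h3, ← ENNReal.coe_pow, ENNReal.coe_le_coe]
    exact this

theorem coinWeight_mul_le {n : ℕ} (L : LaminarRep (Fin n)) (i : ℕ) {K : ℕ} (hK : 0 < K)
    (X : Finset (Fin n)) (x e : Fin n) (r : ℝ≥0∞) {φ : ℕ → ℝ≥0∞}
    (hφ : ∀ u, ((∀ f < e, ¬ L.Rel i e f) → (L.Rel i e x → u = 0) ∧
      (¬ L.Rel i e x → (∃ f ∈ X, L.Rel i e f) → u ≠ 0)) → r ≤ φ u) :
    coinWeight L i K X x e * r ≤ (K : ℝ≥0∞)⁻¹ * ∑ u ∈ Finset.range K, φ u := by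
  have hK0 : (K : ℝ≥0∞) ≠ 0 := by exact_mod_cast hK.ne'
  have hall : (∀ u, r ≤ φ u) → 1 * r ≤ (K : ℝ≥0∞)⁻¹ * ∑ u ∈ Finset.range K, φ u := by
    intro h
    calc 1 * r = (K : ℝ≥0∞)⁻¹ * ∑ u ∈ Finset.range K, r := by
          rw [Finset.sum_const, Finset.card_range, nsmul_eq_mul, ← mul_assoc,
            ENNReal.inv_mul_cancel hK0 (by simp)]
      _ ≤ _ := by
        gcongr
        exact h _
  rw [coinWeight]
  split_ifs with h1 h2 h3
  · gcongr
    refine (hφ 0 fun _ => ⟨fun _ => rfl, fun h => absurd h2 h⟩).trans ?_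
    exact Finset.single_le_sum (f := φ) (fun _ _ => zero_le) (Finset.mem_range.2 hK)
  · have h4 : ((1 - (K : ℝ≥0)⁻¹ : ℝ≥0) : ℝ≥0∞) = (K : ℝ≥0∞)⁻¹ * (K - 1 : ℕ) := by
      have h5 : (1 - (K : ℝ≥0)⁻¹ : ℝ≥0) = (K : ℝ≥0)⁻¹ * (K - 1 : ℕ) := by
        rw [Nat.cast_tsub, mul_tsub, inv_mul_cancel₀ (by exact_mod_cast hK.ne')]
        simp
      rw [h5, ENNReal.coe_mul, ENNReal.coe_inv (by exact_mod_cast hK.ne')]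
      simp
    rw [h4, mul_assoc]
    gcongr
    calc ((K - 1 : ℕ) : ℝ≥0∞) * r = ∑ u ∈ (Finset.range K).erase 0, r := by
          rw [Finset.sum_const, Finset.card_erase_of_mem (Finset.mem_range.2 hK),
            Finset.card_range, nsmul_eq_mul]
      _ ≤ ∑ u ∈ (Finset.range K).erase 0, φ u := Finset.sum_le_sum fun u hu =>
        hφ u fun _ => ⟨fun h => absurd h h2, fun _ _ => (Finset.mem_erase.1 hu).1⟩
      _ ≤ _ := Finset.sum_le_sum_of_subset (Finset.erase_subset _ _)
  · exact hall fun u => hφ u fun _ => ⟨fun h => absurd h h2, fun _ h => absurd h h3⟩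
  · exact hall fun u => hφ u fun h => absurd h h1

end Coins

/-! ### Guessing an exchangeable set of a laminar matroid -/

section Guess

variable {n : ℕ} {env : Env n}

/-- The arrays `0`, `1`, `2` hold an explicit representation of `L` with index `i`. -/
structure Encodes (σ : Store) (i : ℕ) (L : LaminarRep (Fin n)) : Prop where
  len : σ.arr 0 i 0 0 = L.sets.length
  cap : ∀ (j : ℕ) (hj : j < L.sets.length), σ.arr 1 i j 0 = L.cap L.sets[j]
  mem : ∀ (j : ℕ) (hj : j < L.sets.length) (s : Fin n), σ.arr 2 i j s ≠ 0 ↔ s ∈ L.sets[j]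

theorem Encodes.of_agree {σ σ' : Store} {i : ℕ} {L : LaminarRep (Fin n)} (h : Encodes σ i L)
    {V A : Finset ℕ} (hag : AgreeOff V A σ σ') (hA : 0 ∉ A ∧ 1 ∉ A ∧ 2 ∉ A) :
    Encodes σ' i L := by
  obtain ⟨h0, h1, h2⟩ := hA
  refine ⟨?_, ?_, ?_⟩
  · rw [hag.2 0 h0, h.len]
  · rw [hag.2 1 h1]
    exact h.cap
  · rw [hag.2 2 h2]
    exact h.mem

theorem Encodes.setVar {σ : Store} {i : ℕ} {L : LaminarRep (Fin n)} (h : Encodes σ i L)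
    (x v : ℕ) : Encodes (σ.setVar x v) i L :=
  ⟨h.len, h.cap, h.mem⟩

/-- Inner loop of `lookupCoin`: for a set that contains the element in variable `10`, copy the coin
of a smaller member of the set. -/
def lookupInSet : Cmd :=
  .times 12 (.var 10) (.cond (.get 2 (.var 7) (.var 13) (.var 12))
    (.assign 11 (.get 5 (.num 0) (.var 12) (.num 0))) .skip)

/-- If the element in variable `10` has a smaller relative with respect to the level in variable
`9`, replace the coin in variable `11` by the coin of a relative. -/
def lookupCoin : Cmd :=
  .times 13 (.get 0 (.var 7) (.num 0) (.num 0))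
    (.cond (.sub (.get 1 (.var 7) (.var 13) (.num 0)) (.var 9)) .skip
      (.cond (.get 2 (.var 7) (.var 13) (.var 10)) lookupInSet .skip))

/-- One round: pick a random level, toss a coin for each of its classes, and remove the elements
whose coin is not `0` from the candidate set in array `4`. -/
def guessRound : Cmd :=
  .seq (.rand 9 (.var 3))
    (.times 10 (.var 0) (.seq (.rand 11 (.var 3)) (.seq lookupCoin
      (.seq (.put 5 (.num 0) (.var 10) (.num 0) (.var 11))
        (.cond (.var 11) (.put 4 (.num 0) (.var 10) (.num 0) (.num 0)) .skip)))))

/-- Remove the members of sets of capacity `0` from the candidate set. These sets are disjoint from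
`X`, so that no coin of an element of `X` can be expected to remove them. -/
def removeLoops : Cmd :=
  .times 13 (.get 0 (.var 7) (.num 0) (.num 0))
    (.cond (.get 1 (.var 7) (.var 13) (.num 0)) .skip
      (.times 10 (.var 0) (.cond (.get 2 (.var 7) (.var 13) (.var 10))
        (.put 4 (.num 0) (.var 10) (.num 0) (.num 0)) .skip)))

/-- Shrink the candidate set to a guess of an exchangeable set for the laminar matroid whose index
is in variable `7`. -/
def guess : Cmd := .seq (.times 8 (.var 4) guessRound) removeLoops

theorem lookupInSet_spec {σ : Store} {i lvl j D : ℕ} {L : LaminarRep (Fin n)} {e : Fin n}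
    (hL : Encodes σ i L) (h7 : σ.var 7 = i) (h13 : σ.var 13 = j) (hj : j < L.sets.length)
    (h10 : σ.var 10 = e) (hlvl : L.cap L.sets[j] ≤ lvl) (he : e ∈ L.sets[j]) (hD : n ≤ D) :
    Sure env lookupInSet σ (loopTime D 2) fun σ' =>
      (∃ f < e, L.Rel lvl e f ∧ σ'.var 11 = σ.arr 5 0 f 0) ∨
        (∀ f < e, f ∉ L.sets[j]) ∧ σ'.var 11 = σ.var 11 := by
  refine (Sure.times (N := e) (D := D) (t := 2) (fun m σ' =>
    (∃ f < e, L.Rel lvl e f ∧ σ'.var 11 = σ.arr 5 0 f 0) ∨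
        (∀ f < e, (f : ℕ) < m → f ∉ L.sets[j]) ∧ σ'.var 11 = σ.var 11) (by decide)
    ?_ (e.2.le.trans hD) ?_ ?_).conseq ?_
  · intro σ' hag
    rw [Expr.eval, hag.1 10 (by decide), h10]
  · exact Or.inr ⟨fun f _ h => absurd h (by omega), setVar_var_of_ne (by decide)⟩
  · intro m hm σ' hag hm' hI
    have h2 : σ'.arr 2 (σ'.var 7) (σ'.var 13) m ≠ 0 ↔
        (⟨m, hm.trans e.2⟩ : Fin n) ∈ L.sets[j] := by
      rw [hag.2 2 (by decide), hag.1 7 (by decide), hag.1 13 (by decide), h7, h13]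
      exact hL.mem j hj ⟨m, hm.trans e.2⟩
    refine Sure.cond (fun hc => Sure.assign (Or.inl ?_)) (fun hc => Sure.skip ?_)
    · simp only [Expr.eval, hm'] at hc
      refine ⟨⟨m, hm.trans e.2⟩, hm, Or.inr ⟨_, List.getElem_mem hj, hlvl, he, h2.1 hc⟩, ?_⟩
      rw [setVar_var_of_ne (by decide), setVar_var_self]
      simp only [Expr.eval, hm', hag.2 5 (by decide)]
    · simp only [Expr.eval, hm'] at hc
      simp only [setVar_var_of_ne (show 11 ≠ 12 by decide)]
      refine hI.imp_right fun hI => ⟨fun f hf hfm => ?_, hI.2⟩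
      rcases Nat.lt_succ_iff_lt_or_eq.1 hfm with h | h
      · exact hI.1 f hf h
      · intro hmem
        exact h2.2 (by simpa only [← h] using hmem) hc
  · intro σ' hσ' _
    exact hσ'.imp_right fun h => ⟨fun f hf => h.1 f hf hf, h.2⟩

theorem lookupCoin_spec {σ : Store} {i lvl D : ℕ} {L : LaminarRep (Fin n)} {e : Fin n}
    (hL : Encodes σ i L) (h7 : σ.var 7 = i) (h9 : σ.var 9 = lvl)
    (h10 : σ.var 10 = e) (hD : n ≤ D) (hlen : L.sets.length ≤ D) :
    Sure env lookupCoin σ (loopTime D (loopTime D 2 + 2)) fun σ' =>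
      (∃ f < e, L.Rel lvl e f ∧ σ'.var 11 = σ.arr 5 0 f 0) ∨
        (∀ f < e, ¬ L.Rel lvl e f) ∧ σ'.var 11 = σ.var 11 := by
  refine (Sure.times (N := L.sets.length) (D := D) (fun m σ' =>
    (∃ f < e, L.Rel lvl e f ∧ σ'.var 11 = σ.arr 5 0 f 0) ∨
      (∀ (j : ℕ) (hj : j < L.sets.length), j < m → L.cap L.sets[j] ≤ lvl → e ∈ L.sets[j] →
        ∀ f < e, f ∉ L.sets[j]) ∧ σ'.var 11 = σ.var 11) (by decide)
    ?_ hlen ?_ ?_).conseq ?_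
  · intro σ' hag
    simp only [Expr.eval]
    rw [hag.1 7 (by decide), hag.2 0 (by decide), h7, hL.len]
  · exact Or.inr ⟨fun _ _ h => absurd h (by omega), setVar_var_of_ne (by decide)⟩
  · intro m hm σ' hag hm' hI
    have hL' : Encodes σ' i L := hL.of_agree hag (by decide)
    have h7' : σ'.var 7 = i := by rw [hag.1 7 (by decide), h7]
    have h9' : σ'.var 9 = lvl := by rw [hag.1 9 (by decide), h9]
    have h10' : σ'.var 10 = e := by rw [hag.1 10 (by decide), h10]
    have h5' : σ'.arr 5 = σ.arr 5 := hag.2 5 (by decide)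
    -- the invariant is kept if the new set is irrelevant
    have hskip : (L.cap L.sets[m] ≤ lvl → e ∈ L.sets[m] → ∀ f < e, f ∉ L.sets[m]) →
        ∀ v, v = σ'.var 11 → 
        (∃ f < e, L.Rel lvl e f ∧ v = σ.arr 5 0 f 0) ∨
      (∀ (j : ℕ) (hj : j < L.sets.length), j < m + 1 → L.cap L.sets[j] ≤ lvl → e ∈ L.sets[j] →
        ∀ f < e, f ∉ L.sets[j]) ∧ v = σ.var 11 := by
      rintro h v rfl
      refine hI.imp_right fun hI => ⟨fun j hj hjm => ?_, hI.2⟩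
      rcases Nat.lt_succ_iff_lt_or_eq.1 hjm with h' | rfl
      · exact hI.1 j hj h'
      · exact h
    refine Sure.cond (fun hc => ?_) (fun hc => ?_)
    · refine (Sure.skip (hskip (fun hle => ?_) _ (setVar_var_of_ne (by decide)))).le (by omega)
      simp only [Expr.eval, h7', hm', hL'.cap m hm, h9'] at hc
      omega
    · simp only [Expr.eval, h7', hm', hL'.cap m hm, h9'] at hc
      have hcap : L.cap L.sets[m] ≤ lvl := by omega
      refine Sure.cond (fun he => ?_) (fun he => ?_)
      · simp only [Expr.eval, h7', hm', h10', hL'.mem m hm] at he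
        refine (lookupInSet_spec hL' h7' hm' hm h10' hcap he hD).conseq fun σ'' hσ'' _ => ?_
        simp only [setVar_var_of_ne (show 11 ≠ 13 by decide)]
        rw [h5'] at hσ''
        rcases hσ'' with h | h
        · exact Or.inl h
        · exact hskip (fun _ _ => h.1) _ h.2
      · have he' : e ∉ L.sets[m] := by
          rw [← hL'.mem m hm e]
          simpa only [Expr.eval, h7', hm', h10', ne_eq, not_not] using he
        exact (Sure.skip (hskip (fun _ he => absurd he he') _
          (setVar_var_of_ne (by decide)))).le (by simp [loopTime])
  · intro σ' hσ' _
    refine hσ'.imp_right fun h => ⟨?_, h.2⟩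
    rintro f hf (rfl | ⟨A, hA, hcap, he, hf'⟩)
    · exact lt_irrefl _ hf
    · obtain ⟨j, hj, rfl⟩ := List.getElem_of_mem hA
      exact h.1 j hj hj hcap he f hf hf'

end Guess

section Guess

variable {n : ℕ} {env : Env n}

/-- The element `e` belongs to the candidate set in row `0` of array `4`. -/
def Cand (σ : Store) (e : ℕ) : Prop := σ.arr 4 0 e 0 ≠ 0

/-- The coins of the first `m` elements are as desired: `0` for the class of `x`, and different
from `0` for the classes of other elements of `X`. -/
def GoodCoins (L : LaminarRep (Fin n)) (lvl : ℕ) (X : Finset (Fin n)) (x : Fin n) (m : ℕ)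
    (σ : Store) : Prop :=
  ∀ e : Fin n, (e : ℕ) < m → (L.Rel lvl e x → σ.arr 5 0 e 0 = 0) ∧
    (¬ L.Rel lvl e x → (∃ f ∈ X, L.Rel lvl e f) → σ.arr 5 0 e 0 ≠ 0)

/-- The time bound for the coins of one round. -/
def coinTime {R : Type*} [Semiring R] (D : R) : R :=
  loopTime D (loopTime D (loopTime D 2 + 2) + 7)

/-- The coin of `e` is that of a smaller relative if there is one, and the random number in variable
`11` otherwise. -/
theorem tossCoin_spec {σ : Store} {i lvl D : ℕ} {L : LaminarRep (Fin n)} {e : Fin n}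
    (hL : Encodes σ i L) (h7 : σ.var 7 = i) (h9 : σ.var 9 = lvl)
    (h10 : σ.var 10 = e) (hD : n ≤ D) (hlen : L.sets.length ≤ D) :
    Sure env (.seq lookupCoin (.seq (.put 5 (.num 0) (.var 10) (.num 0) (.var 11))
        (.cond (.var 11) (.put 4 (.num 0) (.var 10) (.num 0) (.num 0)) .skip))) σ
      (loopTime D (loopTime D 2 + 2) + 5) fun σ' => ∃ c,
        ((∃ f < e, L.Rel lvl e f ∧ c = σ.arr 5 0 f 0) ∨
          (∀ f < e, ¬ L.Rel lvl e f) ∧ c = σ.var 11) ∧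
        (∀ j : ℕ, σ'.arr 5 0 j 0 = if j = e then c else σ.arr 5 0 j 0) ∧
        ∀ j, Cand σ' j ↔ Cand σ j ∧ (j = e → c = 0) := by
  refine (Sure.seq (T₂ := 4) (lookupCoin_spec hL h7 h9 h10 hD hlen) fun σ₁ hσ₁ hag => ?_).le
    (by omega)
  have h10' : σ₁.var 10 = e := by rw [hag.1 10 (by decide), h10]
  have h5 : σ₁.arr 5 = σ.arr 5 := hag.2 5 (by decide)
  have h4 : σ₁.arr 4 = σ.arr 4 := hag.2 4 (by decide)
  refine Sure.seq (T₁ := 1) (T₂ := 2)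
    (Q₁ := fun σ' => σ' = σ₁.setArr 5 0 e 0 (σ₁.var 11)) (Sure.put ?_) ?_
  · simp only [Expr.eval, h10']
  · rintro σ₂ rfl -
    have hcoin : ∀ j, (σ₁.setArr 5 0 e 0 (σ₁.var 11)).arr 5 0 j 0 =
        if j = e then σ₁.var 11 else σ.arr 5 0 j 0 := fun j => by
      rw [setArr_arr_self, h5]
    have hcand : ∀ j, Cand (σ₁.setArr 5 0 e 0 (σ₁.var 11)) j ↔ Cand σ j := fun j => by
      rw [Cand, setArr_arr_of_ne (by decide), h4, Cand]
    refine Sure.cond (fun hc => Sure.put ⟨σ₁.var 11, hσ₁, ?_, ?_⟩)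
      (fun hc => Sure.skip ⟨σ₁.var 11, hσ₁, hcoin, fun j => ?_⟩)
    · intro j
      rw [setArr_arr_of_ne (by decide), hcoin]
    · intro j
      simp only [Expr.eval, setArr_var, h10'] at hc ⊢
      rw [← hcand, Cand, setArr_arr_self, Cand]
      by_cases hj : j = e <;> simp [hj, hc]
    · simp only [Expr.eval, setArr_var] at hc
      rw [hcand]
      simp [hc]

/-- The coins are all good with at least the product of the probabilities for single elements; the
candidates that remain are those whose coin is `0`. -/
theorem tossCoins_spec {σ : Store} {i lvl K D : ℕ} {L : LaminarRep (Fin n)} {X : Finset (Fin n)}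
    {x : Fin n} (hL : Encodes σ i L) (h0 : σ.var 0 = n) (h3 : σ.var 3 = K) (hK : 0 < K)
    (h7 : σ.var 7 = i) (h9 : σ.var 9 = lvl) (hD : n ≤ D) (hlen : L.sets.length ≤ D) :
    Triple env (.times 10 (.var 0) (.seq (.rand 11 (.var 3)) (.seq lookupCoin
      (.seq (.put 5 (.num 0) (.var 10) (.num 0) (.var 11))
        (.cond (.var 11) (.put 4 (.num 0) (.var 10) (.num 0) (.num 0)) .skip))))) σ (coinTime D)
      (fun σ' => ∀ e : Fin n, Cand σ' e ↔ Cand σ e ∧ σ'.arr 5 0 e 0 = 0)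
      (Set.indicator {σ' | GoodCoins L lvl X x n σ'} 1) (∏ e, coinWeight L lvl K X x e) := by
  classical
  set wt : ℕ → ℝ≥0∞ := fun m => if h : m < n then coinWeight L lvl K X x ⟨m, h⟩ else 1 with hwt
  have hprod : ∏ e, coinWeight L lvl K X x e = ∏ m ∈ Finset.Ico 0 n, wt m := by
    rw [← Finset.range_eq_Ico, Finset.prod_range]
    exact Finset.prod_congr rfl fun e _ => by simp [hwt]
  -- elements of the same class get the same coin, as a coin is copied from a smaller relative
  set I : ℕ → Store → Prop := fun m σ' =>
    (∀ e f : Fin n, (e : ℕ) < m → (f : ℕ) < m → L.Rel lvl e f →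
      σ'.arr 5 0 e 0 = σ'.arr 5 0 f 0) ∧
    ∀ e : Fin n, Cand σ' e ↔ Cand σ e ∧ ((e : ℕ) < m → σ'.arr 5 0 e 0 = 0) with hI
  set Φ : ℕ → Store → ℝ≥0∞ := fun m σ' =>
    if GoodCoins L lvl X x m σ' then ∏ j ∈ Finset.Ico m n, wt j else 0 with hΦ
  refine (Triple.times (N := n) (D := D) (t := loopTime D (loopTime D 2 + 2) + 7) I Φ (by decide)
    (fun σ' hag => ?_) hD ?_ ?_).conseq ?_ ?_
  · rw [Expr.eval, hag.1 0 (by decide), h0]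
  · refine ⟨fun e f h => absurd h (by omega), fun e => ?_⟩
    simp [Cand]
  · intro m hm σ' hag hm' hIm
    have h3' : σ'.var 3 = K := by rw [hag.1 3 (by decide), h3]
    set e : Fin n := ⟨m, hm⟩ with he
    set okay : ℕ → Prop := fun u => (∀ f < e, ¬ L.Rel lvl e f) → (L.Rel lvl e x → u = 0) ∧
      (¬ L.Rel lvl e x → (∃ f ∈ X, L.Rel lvl e f) → u ≠ 0) with hokay
    -- the effect of one iteration, for the random number `u`
    have hbody : ∀ u, ∀ σ₂, (∃ c, ((∃ f < e, L.Rel lvl e f ∧ c = σ'.arr 5 0 f 0) ∨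
          (∀ f < e, ¬ L.Rel lvl e f) ∧ c = u) ∧
        (∀ j : ℕ, σ₂.arr 5 0 j 0 = if j = e then c else σ'.arr 5 0 j 0) ∧
        ∀ j, Cand σ₂ j ↔ Cand σ' j ∧ (j = e → c = 0)) → I (m + 1) σ₂ ∧
        (GoodCoins L lvl X x m σ' → okay u → GoodCoins L lvl X x (m + 1) σ₂) := by
      rintro u σ₂ ⟨c, hc, hcoin, hcand⟩
      have hcf : ∀ f : Fin n, (f : ℕ) < m → L.Rel lvl e f → c = σ'.arr 5 0 f 0 := by
        intro f hf hef
        rcases hc with ⟨g, hg, heg, rfl⟩ | ⟨hno, _⟩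
        · exact hIm.1 g f hg hf (heg.symm.trans hef)
        · exact absurd hef (hno f hf)
      have hlt : ∀ f : Fin n, (f : ℕ) < m + 1 → (f : ℕ) < m ∧ (f : ℕ) ≠ e ∨ f = e := by
        intro f hf
        rcases Nat.lt_succ_iff_lt_or_eq.1 hf with h | h
        · exact Or.inl ⟨h, h.ne⟩
        · exact Or.inr (Fin.ext h)
      refine ⟨⟨fun f g hf hg hfg => ?_, fun f => ?_⟩, fun hgood hu f hf => ?_⟩
      · rw [hcoin, hcoin]
        rcases hlt f hf with ⟨hf, hf'⟩ | rfl <;> rcases hlt g hg with ⟨hg, hg'⟩ | rfl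
        · rw [if_neg hf', if_neg hg', hIm.1 f g hf hg hfg]
        · rw [if_neg hf', if_pos rfl, hcf f hf hfg.symm]
        · rw [if_pos rfl, if_neg hg', hcf g hg hfg]
        · rfl
      · rw [hcand, hcoin, hIm.2, and_assoc]
        refine and_congr_right fun _ => ?_
        by_cases hfe : f = e
        · subst hfe
          simp [he]
        · have hfm : (f : ℕ) ≠ m := fun h => hfe (Fin.ext h)
          have hfe' : (f : ℕ) ≠ e := hfm
          simp only [hfe', if_false, false_imp_iff, and_true]
          exact ⟨fun h hf => h (by omega), fun h hf => h (by omega)⟩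
      · rw [hcoin]
        rcases hlt f hf with ⟨hf, hf'⟩ | rfl
        · rw [if_neg hf']
          exact hgood f hf
        · rw [if_pos rfl]
          rcases hc with ⟨g, hg, heg, rfl⟩ | ⟨hno, rfl⟩
          · refine ⟨fun h => (hgood g hg).1 (heg.symm.trans h), ?_⟩
            rintro h ⟨f, hf, hef⟩
            exact (hgood g hg).2 (fun h' => h (heg.trans h')) ⟨f, hf, heg.symm.trans hef⟩
          · exact hu hno
    have hI' : ∀ σ₂ : Store, ∀ v, I (m + 1) (σ₂.setVar 10 v) ↔ I (m + 1) σ₂ := fun _ _ => Iff.rfl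
    have hbody' := fun u => tossCoin_spec (env := env) (σ := σ'.setVar 11 u) (e := e)
      ((hL.of_agree hag (by decide)).setVar 11 u)
      (by rw [setVar_var_of_ne (by decide), hag.1 7 (by decide), h7])
      (by rw [setVar_var_of_ne (by decide), hag.1 9 (by decide), h9])
      (by rw [setVar_var_of_ne (by decide), hm']) hD hlen
    simp only [setVar_var_self, setVar_arr] at hbody'
    set r : ℝ≥0∞ := if GoodCoins L lvl X x m σ' then ∏ j ∈ Finset.Ico (m + 1) n, wt j else 0
      with hr
    have hv : Φ m σ' ≤ (K : ℝ≥0∞)⁻¹ * ∑ u ∈ Finset.range K, if okay u then r else 0 := by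
      refine le_trans ?_ (coinWeight_mul_le L lvl hK X x e r (φ := fun u => if okay u then r else 0)
        fun u hu => (if_pos hu).ge)
      simp only [hΦ, hr]
      split_ifs with hg
      · rw [Finset.prod_eq_prod_Ico_succ_bot hm]
        simp [hwt, hm, he]
      · exact zero_le
    refine (Triple.seq (T₁ := 1) (T₂ := loopTime D (loopTime D 2 + 2) + 5)
      (Q₁ := fun τ => ∃ u, τ = σ'.setVar 11 u)
      (Φ₁ := fun τ => if okay (τ.var 11) then r else 0)
      (Triple.rand (by rw [Expr.eval, h3']) hK (fun u _ => ⟨u, rfl⟩)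
        (by simpa only [setVar_var_self] using hv)) ?_).le (by omega)
    rintro _ ⟨u, rfl⟩ -
    rw [setVar_var_self]
    refine (hbody' u).triple fun σ₂ hσ₂ _ => ?_
    obtain ⟨h1, h2⟩ := hbody u σ₂ hσ₂
    refine ⟨h1, ?_⟩
    split_ifs with hu
    · simp only [hr, hΦ]
      split_ifs with hg hg' hg'
      · exact le_rfl
      · exact absurd (h2 hg hu) hg'
      · exact zero_le
      · exact le_rfl
    · exact zero_le
  · intro σ' hσ' _
    refine ⟨fun e => ?_, ?_⟩
    · rw [hσ'.2 e]
      simp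
    · by_cases hg : GoodCoins L lvl X x n σ' <;> simp [hΦ, hg]
  · rw [hprod]
    simp only [hΦ]
    rw [if_pos]
    intro e he
    omega

end Guess

section Guess

variable {n : ℕ} {env : Env n}

/-- No candidate belongs to a set that meets `X` and is separated from `x` by the level `lvl`. -/
def Removed (L : LaminarRep (Fin n)) (X : Finset (Fin n)) (x : Fin n) (lvl : ℕ) (σ : Store) :
    Prop :=
  ∀ B ∈ L.sets, (X ∩ B).Nonempty → x ∉ B → L.Separates x B lvl → ∀ e ∈ B, ¬ Cand σ e

/-- A round removes what the level `lvl` can separate from `x`, and keeps `x`, with probability at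
least `K ^ (-3)`: one factor for guessing the level, two for the coins. -/
theorem guessRound_spec {σ : Store} {i lvl K D : ℕ} {L : LaminarRep (Fin n)} {X : Finset (Fin n)}
    {x : Fin n} (hL : Encodes σ i L) (h0 : σ.var 0 = n) (h3 : σ.var 3 = K) (h7 : σ.var 7 = i)
    (hx : x ∈ X) (hK : X.card ≤ K) (hlvl : lvl < K) (hD : n ≤ D) (hlen : L.sets.length ≤ D) :
    Triple env guessRound σ (coinTime D + 2) (fun σ' => ∀ e : Fin n, Cand σ' e → Cand σ e)
      (Set.indicator {σ' | (Cand σ x → Cand σ' x) ∧ Removed L X x lvl σ'} 1)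
      (((K : ℝ≥0∞)⁻¹) ^ 3) := by
  classical
  have hK0 : 0 < K := by omega
  have htoss := fun u => tossCoins_spec (env := env) (σ := σ.setVar 9 u) (lvl := u) (X := X)
    (x := x) (hL.setVar 9 u) ((setVar_var_of_ne (by decide)).trans h0)
    ((setVar_var_of_ne (by decide)).trans h3) hK0 ((setVar_var_of_ne (by decide)).trans h7)
    (setVar_var_self _ _ _) hD hlen
  refine (Triple.seq (T₁ := 1) (T₂ := coinTime D) (Q₁ := fun τ => ∃ u, τ = σ.setVar 9 u)
    (Φ₁ := fun τ => if τ.var 9 = lvl then ((K : ℝ≥0∞)⁻¹) ^ 2 else 0)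
    (Triple.rand (by rw [Expr.eval, h3]) hK0 (fun u _ => ⟨u, rfl⟩) ?_) ?_).le (by omega)
  · simp only [setVar_var_self]
    rw [Finset.sum_ite_eq' (Finset.range K) lvl, if_pos (Finset.mem_range.2 hlvl), pow_succ']
  · rintro _ ⟨u, rfl⟩ -
    rw [setVar_var_self]
    split_ifs with hu
    · subst hu
      refine (htoss u).conseq (fun σ' hσ' _ => ⟨fun e he => ((hσ' e).1 he).1, ?_⟩)
        (prod_coinWeight_ge L u hx hK)
      refine indicator_one_le fun hg => ?_
      refine ⟨fun hc => (hσ' x).2 ⟨hc, (hg x x.2).1 (Or.inl rfl)⟩, ?_⟩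
      rintro B hB ⟨f, hf⟩ hxB ⟨hcap, hsep⟩ e he hc
      obtain ⟨hfX, hfB⟩ := Finset.mem_inter.1 hf
      refine (hg e e.2).2 ?_ ⟨f, hfX, Or.inr ⟨B, hB, hcap, he, hfB⟩⟩ ((hσ' e).1 hc).2
      rintro (rfl | ⟨A, hA, hAc, heA, hxA⟩)
      · exact hxB he
      · exact Finset.disjoint_left.1 (hsep A hA hAc hxA) heA he
    · exact (htoss u).sure.triple fun σ' hσ' _ => ⟨fun e he => ((hσ' e).1 he).1, zero_le⟩

theorem removeLoops_spec {σ : Store} {i D : ℕ} {L : LaminarRep (Fin n)}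
    (hL : Encodes σ i L) (h0 : σ.var 0 = n) (h7 : σ.var 7 = i) (hD : n ≤ D)
    (hlen : L.sets.length ≤ D) :
    Sure env removeLoops σ (loopTime D (loopTime D 2 + 1)) fun σ' => ∀ e : Fin n,
      Cand σ' e ↔ Cand σ e ∧ ∀ A ∈ L.sets, L.cap A = 0 → e ∉ A := by
  refine (Sure.times (N := L.sets.length) (D := D) (fun m σ' => ∀ e : Fin n,
    Cand σ' e ↔ Cand σ e ∧ ∀ (j : ℕ) (hj : j < L.sets.length), j < m → L.cap L.sets[j] = 0 →
      e ∉ L.sets[j]) (by decide) ?_ hlen ?_ ?_).conseq ?_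
  · intro σ' hag
    simp only [Expr.eval]
    rw [hag.1 7 (by decide), hag.2 0 (by decide), h7, hL.len]
  · intro e
    simp [Cand]
  · intro m hm σ' hag hm' hI
    have hL' : Encodes σ' i L := hL.of_agree hag (by decide)
    have h7' : σ'.var 7 = i := by rw [hag.1 7 (by decide), h7]
    have h0' : σ'.var 0 = n := by rw [hag.1 0 (by decide), h0]
    have hsplit : ∀ e : Fin n, (∀ (j : ℕ) (hj : j < L.sets.length), j < m + 1 →
        L.cap L.sets[j] = 0 → e ∉ L.sets[j]) ↔ (∀ (j : ℕ) (hj : j < L.sets.length), j < m →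
        L.cap L.sets[j] = 0 → e ∉ L.sets[j]) ∧ (L.cap L.sets[m] = 0 → e ∉ L.sets[m]) := by
      intro e
      refine ⟨fun h => ⟨fun j hj hjm => h j hj (by omega), h m hm (by omega)⟩,
        fun h j hj hjm => ?_⟩
      rcases Nat.lt_succ_iff_lt_or_eq.1 hjm with h' | rfl
      · exact h.1 j hj h'
      · exact h.2
    refine Sure.cond (fun hc => (Sure.skip fun e => ?_).le (by simp [loopTime])) (fun hc => ?_)
    · simp only [Expr.eval, h7', hm', hL'.cap m hm] at hc
      rw [hsplit, ← and_assoc, ← hI e]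
      simp [hc, Cand]
    · simp only [Expr.eval, h7', hm', hL'.cap m hm] at hc
      refine (Sure.times (N := n) (D := D) (t := 2) (fun u τ => ∀ e : Fin n,
        Cand τ e ↔ Cand σ' e ∧ ((e : ℕ) < u → e ∉ L.sets[m])) (by decide) ?_ hD ?_ ?_).conseq ?_
      · intro τ hag'
        rw [Expr.eval, hag'.1 0 (by decide), h0']
      · intro e
        simp [Cand]
      · intro u hu τ hag' hu' hJ
        have hmem : τ.arr 2 (τ.var 7) (τ.var 13) u ≠ 0 ↔ (⟨u, hu⟩ : Fin n) ∈ L.sets[m] := by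
          rw [hag'.1 7 (by decide), hag'.1 13 (by decide), hag'.2 2 (by decide), h7', hm']
          exact hL'.mem m hm ⟨u, hu⟩
        refine Sure.cond (fun hc' => Sure.put fun e => ?_) (fun hc' => Sure.skip fun e => ?_)
        · simp only [Expr.eval, hu'] at hc' ⊢
          change Cand (τ.setArr 4 0 u 0 0) e ↔ _
          rw [Cand, setArr_arr_self]
          by_cases he : (e : ℕ) = u
          · obtain rfl : e = ⟨u, hu⟩ := Fin.ext he
            simp [hmem.1 hc']
          · rw [if_neg he, ← Cand, hJ e]
            refine and_congr_right fun _ => ⟨fun h h' => h (by omega), fun h h' => h (by omega)⟩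
        · simp only [Expr.eval, hu'] at hc'
          change Cand τ e ↔ _
          rw [hJ e]
          refine and_congr_right fun _ => ⟨fun h h' => ?_, fun h h' => h (by omega)⟩
          rcases Nat.lt_succ_iff_lt_or_eq.1 h' with h' | h'
          · exact h h'
          · obtain rfl : e = ⟨u, hu⟩ := Fin.ext h'
            exact fun hmem' => hmem.2 hmem' hc'
      · intro τ hτ _ e
        change Cand τ e ↔ _
        rw [hτ e, hsplit, ← and_assoc, ← hI e]
        simp [hc]
  · intro σ' hσ' _ e
    rw [hσ' e]
    refine and_congr_right fun _ => ⟨fun h A hA => ?_, fun h j hj _ => h _ (List.getElem_mem hj)⟩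
    obtain ⟨j, hj, rfl⟩ := List.getElem_of_mem hA
    exact h j hj hj

/-- The time bound for a guess. -/
def guessTime {R : Type*} [Semiring R] (D : R) : R :=
  loopTime D (coinTime D + 2) + loopTime D (loopTime D 2 + 1) + 1

theorem guess_rounds_spec {σ : Store} {i l K D : ℕ} {L : LaminarRep (Fin n)} {X : Finset (Fin n)}
    {x : Fin n} {lv : ℕ → ℕ} (hL : Encodes σ i L) (h0 : σ.var 0 = n) (h3 : σ.var 3 = K)
    (h4 : σ.var 4 = l) (h7 : σ.var 7 = i) (hx : x ∈ X) (hK : X.card ≤ K) (hlv : ∀ s, lv s < K)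
    (hD : n ≤ D) (hlen : L.sets.length ≤ D) (hl : l ≤ D) :
    Triple env guess σ (guessTime D)
      (fun σ' => (∀ e : Fin n, Cand σ' e → Cand σ e) ∧
        ∀ e : Fin n, Cand σ' e → ∀ A ∈ L.sets, L.cap A = 0 → e ∉ A)
      (Set.indicator {σ' | (Cand σ x → (∀ A ∈ L.sets, L.cap A = 0 → x ∉ A) → Cand σ' x) ∧
        ∀ s < l, Removed L X x (lv s) σ'} 1)
      (((K : ℝ≥0∞)⁻¹) ^ (3 * l)) := by
  classical
  set G : ℕ → Set Store := fun m => {σ' | (Cand σ x → Cand σ' x) ∧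
    ∀ s < m, Removed L X x (lv s) σ'} with hG
  have hmono : ∀ {σ₁ σ₂ : Store} {v : ℕ}, (∀ e : Fin n, Cand σ₂ e → Cand σ₁ e) →
      Removed L X x v σ₁ → Removed L X x v σ₂ := fun h hR B hB h1 h2 h3 e he hc =>
    hR B hB h1 h2 h3 e he (h e hc)
  have hloop : Triple env (.times 8 (.var 4) guessRound) σ (loopTime D (coinTime D + 2))
      (fun σ' => ∀ e : Fin n, Cand σ' e → Cand σ e) ((G l).indicator 1)
      (((K : ℝ≥0∞)⁻¹) ^ (3 * l)) := by
    refine (Triple.times (N := l) (D := D) (t := coinTime D + 2)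
      (fun _ σ' => ∀ e : Fin n, Cand σ' e → Cand σ e)
      (fun m σ' => if σ' ∈ G m then ((K : ℝ≥0∞)⁻¹) ^ (3 * (l - m)) else 0) (by decide)
      (fun σ' hag => ?_) hl ?_ ?_).conseq ?_ ?_
    · rw [Expr.eval, hag.1 4 (by decide), h4]
    · exact fun e h => h
    · intro m hm σ' hag hm' hI
      have hround := guessRound_spec (env := env) (hL.of_agree hag (by decide))
        ((hag.1 0 (by decide)).trans h0) ((hag.1 3 (by decide)).trans h3)
        ((hag.1 7 (by decide)).trans h7) hx hK (hlv m) hD hlen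
      split_ifs with hgood
      · have := hround.convex (a := ((K : ℝ≥0∞)⁻¹) ^ (3 * (l - (m + 1)))) (b := 0)
          (Φ := fun σ'' => if σ''.setVar 8 (m + 1) ∈ G (m + 1) then
            ((K : ℝ≥0∞)⁻¹) ^ (3 * (l - (m + 1))) else 0) zero_le ?_ (fun _ _ _ => zero_le)
        · refine this.conseq (fun σ'' hσ'' _ => ⟨fun e he => hI e (hσ'' e he), le_rfl⟩) ?_
          rw [mul_zero, add_zero, ← pow_add]
          exact (congrArg _ (by omega)).le
        · rintro σ'' hσ'' - ⟨h1, h2⟩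
          rw [if_pos]
          refine ⟨fun h => h1 (hgood.1 h), fun s hs => ?_⟩
          rcases Nat.lt_succ_iff_lt_or_eq.1 hs with hs | rfl
          · exact hmono (σ₁ := σ') (fun e he => hσ'' e he) (hgood.2 s hs)
          · exact h2
      · exact hround.sure.triple fun σ'' hσ'' _ => ⟨fun e he => hI e (hσ'' e he), zero_le⟩
    · intro σ' hσ' _
      refine ⟨hσ', ?_⟩
      by_cases h : σ' ∈ G l <;> simp [h]
    · rw [if_pos]
      · simp
      · exact ⟨fun h => h, fun s hs => absurd hs (by omega)⟩
  refine Triple.seq hloop fun σ' hσ' hag => ?_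
  refine (removeLoops_spec (hL.of_agree hag (by decide)) ((hag.1 0 (by decide)).trans h0)
    ((hag.1 7 (by decide)).trans h7) hD hlen).triple fun σ'' hσ'' _ => ?_
  refine ⟨⟨fun e he => hσ' e ((hσ'' e).1 he).1, fun e he => ((hσ'' e).1 he).2⟩, ?_⟩
  exact indicator_one_le fun h => ⟨fun hc hloop => (hσ'' x).2 ⟨h.1 hc, hloop⟩, fun s hs =>
    hmono (fun e he => ((hσ'' e).1 he).1) (h.2 s hs)⟩

/-- With probability at least `K ^ (-3 * log₂ K)`, the remaining candidates form an exchangeable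
set that contains `x`. -/
theorem guess_spec {σ : Store} {i K D : ℕ} {L : LaminarRep (Fin n)} {M : Matroid (Fin n)}
    {X : Finset (Fin n)} {x : Fin n} (hM : L.Represents M) (hX : M.Indep (X : Set (Fin n)))
    (hL : Encodes σ i L) (h0 : σ.var 0 = n) (h3 : σ.var 3 = K)
    (h4 : σ.var 4 = Nat.log 2 K) (h7 : σ.var 7 = i) (hx : x ∈ X) (hK : X.card ≤ K)
    (hD : n ≤ D) (hlen : L.sets.length ≤ D) (hKD : Nat.log 2 K ≤ D) :
    Triple env guess σ (guessTime D) (fun σ' => ∀ e : Fin n, Cand σ' e → Cand σ e)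
      (Set.indicator {σ' | (Cand σ x → Cand σ' x) ∧
        ∀ y : Fin n, Cand σ' y → M.Indep ((insert y (X.erase x) : Finset (Fin n)) : Set (Fin n))} 1)
      (((K : ℝ≥0∞)⁻¹) ^ (3 * Nat.log 2 K)) := by
  have hXc := (hM.2 X).1 hX
  obtain ⟨lv, hlv, hsep⟩ := LaminarRep.exists_levels hXc hx hK
  have hxloop : ∀ A ∈ L.sets, L.cap A = 0 → x ∉ A := by
    intro A hA hA0 hxA
    have := hXc A hA
    have := Finset.card_pos.2 ⟨x, Finset.mem_inter.2 ⟨hx, hxA⟩⟩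
    omega
  refine (guess_rounds_spec hL h0 h3 h4 h7 hx hK hlv hD hlen hKD).conseq
    fun σ' hσ' _ => ⟨hσ'.1, ?_⟩
  refine indicator_one_le ?_
  rintro ⟨h1, h2⟩
  refine ⟨fun h => h1 h hxloop, fun y hy => LaminarRep.indep_exchange hM hX hx ?_⟩
  intro A hA hxA hAt hyA
  have hA0 : L.cap A ≠ 0 := fun h => hσ'.2 y hy A hA h hyA
  obtain ⟨s, hs, hsep⟩ := hsep A hA hxA (by omega) hAt
  exact h2 s hs A hA (Finset.card_pos.1 (by omega)) hxA hsep y hyA hy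

end Guess

section Guess

variable {n : ℕ} {env : Env n}

theorem guess_sure {σ : Store} {i K D : ℕ} {L : LaminarRep (Fin n)}
    (hL : Encodes σ i L) (h0 : σ.var 0 = n) (h3 : σ.var 3 = K)
    (h4 : σ.var 4 = Nat.log 2 K) (h7 : σ.var 7 = i) (hKn : K ≤ n) (hK : 0 < n → 0 < K)
    (hD : n ≤ D) (hlen : L.sets.length ≤ D) :
    Sure env guess σ (guessTime D) (fun σ' => ∀ e : Fin n, Cand σ' e → Cand σ e) := by
  rcases Nat.eq_zero_or_pos n with rfl | hn
  · obtain rfl : K = 0 := by omega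
    refine Sure.seq (Sure.times (N := 0) (D := D) (fun _ _ => True) (by decide) (fun σ' hag => ?_)
      (by omega) trivial (fun m hm => absurd hm (by omega))) fun σ' _ hag =>
      (removeLoops_spec (hL.of_agree hag (by decide)) ((hag.1 0 (by decide)).trans h0)
        ((hag.1 7 (by decide)).trans h7) hD hlen).conseq fun _ _ _ e => e.elim0
    rw [Expr.eval, hag.1 4 (by decide), h4, Nat.log_zero_right]
  · exact (guess_rounds_spec (X := {⟨0, hn⟩}) (lv := fun _ => 0) hL h0 h3 h4 h7
      (Finset.mem_singleton_self _) (by rw [Finset.card_singleton]; exact hK hn)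
      (fun _ => hK hn) hD hlen
      ((Nat.log_le_self 2 K).trans (hKn.trans hD))).sure.conseq fun _ h _ => h.1

end Guess

/-! ### The algorithm for candidate sets -/

section Candidates

variable {n : ℕ} {env : Env n}

/-- Set variable `3` to `K = min k n` and variable `4` to `log₂ K`. -/
def setup : Cmd :=
  .seq (.assign 3 (.sub (.var 1) (.sub (.var 1) (.var 0))))
    (.seq (.assign 4 (.num 0)) (.seq (.assign 5 (.num 1))
      (.times 6 (.var 3) (.cond (.sub (.add (.var 5) (.var 5)) (.var 3)) .skip
        (.seq (.assign 5 (.add (.var 5) (.var 5))) (.assign 4 (.add (.var 4) (.num 1))))))))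

theorem setup_spec {σ : Store} {k D : ℕ} (h0 : σ.var 0 = n) (h1 : σ.var 1 = k) (hD : n ≤ D) :
    Sure env setup σ (loopTime D 4 + 6) fun σ' =>
      σ'.var 3 = min k n ∧ σ'.var 4 = Nat.log 2 (min k n) := by
  set K := min k n with hK
  refine (Sure.seq (T₁ := 1) (T₂ := loopTime D 4 + 4) (Q₁ := fun τ => τ.var 3 = K)
    (Sure.assign ?_) fun τ hτ _ => (Sure.seq (T₁ := 1) (T₂ := loopTime D 4 + 2)
      (Q₁ := fun τ => τ.var 3 = K ∧ τ.var 4 = 0) (Sure.assign ?_) fun τ hτ _ =>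
        (Sure.seq (T₁ := 1) (T₂ := loopTime D 4)
          (Q₁ := fun τ => τ.var 3 = K ∧ τ.var 4 = 0 ∧ τ.var 5 = 1) (Sure.assign ?_)
            fun τ hτ _ => ?_).le (by omega)).le (by omega)).le (by omega)
  · simp only [setVar_var_self, Expr.eval, h0, h1]
    omega
  · exact ⟨(setVar_var_of_ne (by decide)).trans hτ, setVar_var_self _ _ _⟩
  · exact ⟨(setVar_var_of_ne (by decide)).trans hτ.1, (setVar_var_of_ne (by decide)).trans hτ.2,
      setVar_var_self _ _ _⟩
  obtain ⟨h3, h4, h5⟩ := hτ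
  refine (Sure.times (N := K) (D := D) (t := 4) (fun m τ' => τ'.var 5 = 2 ^ τ'.var 4 ∧
    (K ≠ 0 → τ'.var 5 ≤ K) ∧ τ'.var 4 ≤ m ∧ (τ'.var 4 = m ∨ K < 2 * τ'.var 5)) (by decide)
    (fun σ' hag => ?_) (by omega) ?_ ?_).conseq ?_
  · rw [Expr.eval, hag.1 3 (by decide), h3]
  · simp only [setVar_var_of_ne (show 5 ≠ 6 by decide), setVar_var_of_ne (show 4 ≠ 6 by decide),
      h4, h5]
    simp only [pow_zero, le_refl, true_or, and_true, true_and]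
    omega
  · rintro m hm σ' hag hm' ⟨hI1, hI2, hI4, hI3⟩
    have h3' : σ'.var 3 = K := by rw [hag.1 3 (by decide), h3]
    refine Sure.cond (fun hc => (Sure.skip ?_).le (by omega)) (fun hc => ?_)
    · simp only [Expr.eval, h3'] at hc
      simp only [setVar_var_of_ne (show 5 ≠ 6 by decide), setVar_var_of_ne (show 4 ≠ 6 by decide)]
      exact ⟨hI1, hI2, by omega, Or.inr (by omega)⟩
    · simp only [Expr.eval, h3'] at hc
      refine Sure.seq (T₁ := 1) (T₂ := 1) (Q₁ := fun τ => τ.var 4 = σ'.var 4 ∧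
        τ.var 5 = σ'.var 5 + σ'.var 5) (Sure.assign ?_) fun τ hτ _ => Sure.assign ?_
      · exact ⟨setVar_var_of_ne (by decide), setVar_var_self _ _ _⟩
      · simp only [setVar_var_of_ne (show 5 ≠ 6 by decide), setVar_var_self, Expr.eval,
          setVar_var_of_ne (show 4 ≠ 6 by decide), setVar_var_of_ne (show 5 ≠ 4 by decide),
          hτ.1, hτ.2]
        refine ⟨by rw [pow_succ, ← hI1]; ring, fun _ => by omega, by omega, ?_⟩
        rcases hI3 with h | h
        · exact Or.inl (by omega)
        · exact Or.inr (by omega)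
  · rintro σ' ⟨hI1, hI2, hI4, hI3⟩ hag
    refine ⟨(hag.1 3 (by decide)).trans h3, ?_⟩
    rcases Nat.eq_zero_or_pos K with h | h
    · rw [h, Nat.log_zero_right]
      omega
    · have h2 : 2 ^ σ'.var 4 ≤ K := hI1 ▸ hI2 h.ne'
      rcases hI3 with h' | h'
      · rw [h'] at h2
        exact absurd (Nat.lt_two_pow_self (n := K)) (by omega)
      · rw [hI1] at h'
        exact (Nat.log_eq_of_pow_le_of_lt_pow h2 (by rw [pow_succ]; omega)).symm

/-- Let all elements be candidates. -/
def initCand : Cmd := .times 10 (.var 0) (.put 4 (.num 0) (.var 10) (.num 0) (.num 1))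

theorem initCand_spec {σ : Store} {D : ℕ} (h0 : σ.var 0 = n) (hD : n ≤ D) :
    Sure env initCand σ (loopTime D 1) fun σ' => ∀ e : Fin n, Cand σ' e := by
  refine (Sure.times (N := n) (D := D) (t := 1) (fun m τ => ∀ e : Fin n, (e : ℕ) < m → Cand τ e)
    (by decide) (fun σ' hag => ?_) hD (fun e he => absurd he (by omega)) ?_).conseq
    fun σ' h _ e => h e e.2
  · rw [Expr.eval, hag.1 0 (by decide), h0]
  · intro m hm σ' hag hm' hI
    refine Sure.put fun e he => ?_
    change Cand (σ'.setArr 4 0 (σ'.var 10) 0 1) e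
    rw [Cand, setArr_arr_self, hm']
    split_ifs with h
    · exact one_ne_zero
    · exact hI e (by omega)

/-- The algorithm for candidate sets: output a single guess. -/
def candidates : Cmd :=
  .seq setup (.seq (.assign 7 (.num 0)) (.seq initCand (.seq guess
    (.seq (.times 10 (.var 0) (.put 3 (.num 0) (.var 10) (.num 0)
      (.get 4 (.num 0) (.var 10) (.num 0)))) (.assign 0 (.num 1))))))

/-- The time bound for `candidates`. -/
def candidatesTime {R : Type*} [Semiring R] (D : R) : R :=
  loopTime D 4 + loopTime D 1 + guessTime D + loopTime D 1 + 13

theorem candidates_spec {σ : Store} {k D : ℕ} {L : LaminarRep (Fin n)} (hL : Encodes σ 0 L)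
    (h0 : σ.var 0 = n) (h1 : σ.var 1 = k) (hD : n ≤ D) {G : Set (Finset (Fin n))} {v : ℝ≥0∞}
    (hguess : ∀ σ : Store, Encodes σ 0 L → σ.var 0 = n → σ.var 3 = min k n →
      σ.var 4 = Nat.log 2 (min k n) → σ.var 7 = 0 → (∀ e : Fin n, Cand σ e) →
      Triple env guess σ (guessTime D) (fun _ => True)
        (Set.indicator {σ' | σ'.row n 4 0 ∈ G} 1) v) :
    Triple env candidates σ (candidatesTime D) (fun σ' => σ'.var 0 = 1)
      (Set.indicator {σ' | σ'.row n 3 0 ∈ G} 1) v := by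
  refine (Sure.seq_triple (setup_spec h0 h1 hD)
    (T₂ := loopTime D 1 + guessTime D + loopTime D 1 + 6) fun σ₁ hσ₁ hag₁ => ?_).le
    (by simp only [candidatesTime]; omega)
  have h0₁ := (hag₁.1 0 (by decide)).trans h0
  refine (Sure.seq_triple (T₁ := 1) (T₂ := loopTime D 1 + guessTime D + loopTime D 1 + 4)
    (Q₁ := fun τ => τ.var 7 = 0) (Sure.assign (setVar_var_self _ _ _))
    fun σ₂ hσ₂ hag₂ => ?_).le (by omega)
  have h0₂ := (hag₂.1 0 (by decide)).trans h0₁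
  refine (Sure.seq_triple (T₂ := guessTime D + loopTime D 1 + 3) (initCand_spec h0₂ hD)
    fun σ₃ hσ₃ hag₃ => ?_).le (by omega)
  have h0₃ := (hag₃.1 0 (by decide)).trans h0₂
  refine (Triple.seq (T₂ := loopTime D 1 + 2) (hguess σ₃ (((hL.of_agree hag₁ (by decide)).of_agree
      hag₂ (by decide)).of_agree hag₃ (by decide)) h0₃
      (by rw [hag₃.1 3 (by decide), hag₂.1 3 (by decide), hσ₁.1])
      (by rw [hag₃.1 4 (by decide), hag₂.1 4 (by decide), hσ₁.2])
      (by rw [hag₃.1 7 (by decide), hσ₂]) hσ₃) fun σ₄ _ hag₄ => ?_).le (by omega)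
  have h0₄ := (hag₄.1 0 (by decide)).trans h0₃
  refine Sure.triple (Q := fun σ' => σ'.var 0 = 1 ∧ σ'.row n 3 0 = σ₄.row n 4 0) ?_
    fun σ' hσ' _ => ⟨hσ'.1, indicator_one_le fun h => ?_⟩
  · refine (Sure.seq (T₁ := loopTime D 1) (T₂ := 1) (Sure.times (N := n) (D := D) (t := 1)
      (fun m τ => ∀ e : Fin n, (e : ℕ) < m → (τ.arr 3 0 e 0 ≠ 0 ↔ σ₄.arr 4 0 e 0 ≠ 0))
      (by decide) (fun σ' hag => ?_) hD (fun e he => absurd he (by omega)) ?_)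
      fun σ₅ hσ₅ hag₅ => Sure.assign ⟨setVar_var_self _ _ _, ?_⟩).le (by omega)
    · rw [Expr.eval, hag.1 0 (by decide), h0₄]
    · intro m hm σ' hag hm' hI
      refine Sure.put fun e he => ?_
      simp only [setVar_arr, Expr.eval, hm', hag.2 4 (by decide)]
      rw [setArr_arr_self]
      split_ifs with h
      · rw [h]
      · exact hI e (by omega)
    · ext e
      rw [mem_row, mem_row]
      exact hσ₅ e e.2
  · change σ'.row n 3 0 ∈ G
    rw [hσ'.2]
    exact h

theorem encodes_initialStore {m k : ℕ} (L : Fin m → LaminarRep (Fin n)) (i : Fin m) :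
    Encodes (initialStore k L) i (L i) := by
  refine ⟨?_, fun j hj => ?_, fun j hj s => ?_⟩
  · simp [initialStore]
  · simp [initialStore, hj]
  · simp [initialStore, hj]

theorem outputFamily_eq {s : List Cmd × Store} (h : s.2.var 0 = 1) :
    outputFamily n s = {s.2.row n 3 0} := by
  rw [outputFamily, h]
  rfl

/-- The program `candidates` is a polynomial-time algorithm for candidate sets. -/
theorem candidates_correct : ∃ (C : ℝ) (P : Cmd) (p : Polynomial ℕ), ∀ (n k : ℕ), 1 ≤ k →
      ∀ (M : Matroid (Fin n)) (L : LaminarRep (Fin n)), L.Represents M →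
        HaltsWithin (Env.trivial n) P (initialStore k fun _ : Fin 1 => L) (p.eval n) ∧
        (∀ s ∈ (run (Env.trivial n) (p.eval n)
            ([P], initialStore k fun _ : Fin 1 => L)).support,
          ((outputFamily n s).card : ℝ) ≤ (k : ℝ) ^ (C * Real.log k)) ∧
        ∀ X : Finset (Fin n), M.Indep (X : Set (Fin n)) → X.card ≤ k → ∀ x ∈ X,
          ENNReal.ofReal (1 / (k : ℝ) ^ (C * Real.log k)) ≤
            (run (Env.trivial n) (p.eval n)
              ([P], initialStore k fun _ : Fin 1 => L)).toOuterMeasure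
                {s | ∃ Y ∈ outputFamily n s, IsExchangeable M X x Y} := by
  refine ⟨(3 : ℕ) / Real.log 2, candidates,
    candidatesTime (Polynomial.X * Polynomial.X + 1 : Polynomial ℕ), fun n k hk M L hM => ?_⟩
  set D := n * n + 1 with hD
  have htime : (candidatesTime (Polynomial.X * Polynomial.X + 1 : Polynomial ℕ)).eval n =
      candidatesTime D := by
    simp [candidatesTime, guessTime, coinTime, loopTime, hD]
  have hnD : n ≤ D := by nlinarith
  have hlen : L.sets.length ≤ D := L.length_sets_le
  have hL := encodes_initialStore (k := k) (fun _ : Fin 1 => L) 0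
  have h0 : (initialStore k fun _ : Fin 1 => L).var 0 = n := rfl
  have h1 : (initialStore k fun _ : Fin 1 => L).var 1 = k := rfl
  rw [htime]
  have hsure := (candidates_spec (env := Env.trivial n) (G := ∅) (v := 0) hL h0 h1 hnD
    fun σ hL h0 h3 h4 h7 _ => (guess_sure hL h0 h3 h4 h7 (min_le_right _ _)
      (fun hn => lt_min hk hn) hnD hlen).triple fun _ _ _ => ⟨trivial, zero_le⟩).halts
  refine ⟨fun s hs => (hsure.1 s hs).1, fun s hs => ?_, fun X hX hXk x hx => ?_⟩
  · rw [outputFamily_eq (hsure.1 s hs).2, Finset.card_singleton, Nat.cast_one]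
    exact Real.one_le_rpow (by exact_mod_cast hk) (mul_nonneg (by positivity)
      (Real.log_natCast_nonneg k))
  · have hXK : X.card ≤ min k n := le_min hXk (by simpa using Finset.card_le_univ X)
    have hK1 : 1 ≤ min k n := (Finset.card_pos.2 ⟨x, hx⟩).trans_le hXK
    have := (candidates_spec (env := Env.trivial n) (G := {Y | IsExchangeable M X x Y}) hL h0 h1
      hnD fun σ hL h0 h3 h4 h7 hc => (guess_spec hM hX hL h0 h3 h4 h7 hx hXK hnD hlen
        ((Nat.log_le_self 2 _).trans ((min_le_right _ _).trans hnD))).conseq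
        fun σ' _ _ => ⟨trivial, indicator_one_le fun h => ⟨?_, fun y hy => h.2 y ?_⟩⟩).halts
    · refine (ofReal_inv_rpow_le hk (natCast_log_mul_le 3 k)).trans (le_trans ?_ (this.2.trans ?_))
      · refine le_trans (pow_le_pow_of_le_one (by simp)
          (ENNReal.inv_le_one.2 (by exact_mod_cast hk))
          (Nat.mul_le_mul_left 3 (Nat.log_mono_right (min_le_left k n)))) ?_
        gcongr
        exact min_le_left k n
      · rw [← expect_indicator]
        refine expect_mono fun s hs => indicator_one_le fun h => ⟨s.2.row n 3 0, ?_, h⟩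
        rw [outputFamily_eq (this.1 s hs).2]
        exact Finset.mem_singleton_self _
    · exact mem_row.2 (h.1 (hc x))
    · exact mem_row.1 hy

end Candidates

/-! ### The greedy algorithm -/

section Greedy

variable {n : ℕ}

/-- The environment of a matroid with weights. -/
def Env.ofMatroid (M : Matroid (Fin n)) (w : Fin n → ℝ≥0) : Env n :=
  ⟨fun S => M.Indep (S : Set (Fin n)), w⟩

/-- The element `e` of `U` extends the independent set `B`. -/
def Extends (M : Matroid (Fin n)) (U : Fin n → Prop) (B : Finset (Fin n)) (e : Fin n) : Prop :=
  U e ∧ e ∉ B ∧ M.Indep ((insert e B : Finset (Fin n)) : Set (Fin n))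

/-- The invariant of the greedy algorithm after `g` steps: an element of `U` that is heavier than
some element of `B` is spanned by the elements of `B` that are at least as heavy. -/
structure GreedyInv (M : Matroid (Fin n)) (w : Fin n → ℝ≥0) (U : Fin n → Prop) (g : ℕ)
    (B : Finset (Fin n)) : Prop where
  indep : M.Indep (B : Set (Fin n))
  mem : ∀ b ∈ B, U b
  card_le : B.card ≤ g
  card_eq : B.card = g ∨ ∀ e, ¬ Extends M U B e
  span : ∀ e, U e → ∀ b ∈ B, w b < w e → e ∈ M.closure {b' | b' ∈ B ∧ w e ≤ w b'}

variable {M : Matroid (Fin n)} {w : Fin n → ℝ≥0} {U : Fin n → Prop} {g : ℕ} {B : Finset (Fin n)}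

theorem mem_closure_of_not_extends (hE : M.E = Set.univ) (hB : M.Indep (B : Set (Fin n)))
    {e : Fin n} (hU : U e) (he : ¬ Extends M U B e) : e ∈ M.closure (B : Set (Fin n)) := by
  by_cases heB : e ∈ B
  · exact M.mem_closure_of_mem' heB (by simp [hE])
  · by_contra hcl
    refine he ⟨hU, heB, ?_⟩
    rw [Finset.coe_insert, hB.insert_indep_iff]
    exact Or.inl ⟨by simp [hE], hcl⟩

theorem GreedyInv.empty : GreedyInv M w U 0 ∅ :=
  ⟨by simp, by simp, by simp, Or.inl rfl, by simp⟩

theorem GreedyInv.skip (h : GreedyInv M w U g B) (hno : ∀ e, ¬ Extends M U B e) :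
    GreedyInv M w U (g + 1) B :=
  ⟨h.indep, h.mem, h.card_le.trans (Nat.le_succ g), Or.inr hno, h.span⟩

theorem GreedyInv.extend (hE : M.E = Set.univ) (h : GreedyInv M w U g B) {b : Fin n}
    (hb : Extends M U B b) (hmax : ∀ e, Extends M U B e → w e ≤ w b) :
    GreedyInv M w U (g + 1) (insert b B) := by
  have hcard := Finset.card_insert_of_notMem hb.2.1
  refine ⟨hb.2.2, ?_, ?_, Or.inl ?_, ?_⟩
  · intro b' hb'
    rcases Finset.mem_insert.1 hb' with rfl | hb'
    · exact hb.1
    · exact h.mem b' hb'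
  · have := h.card_le
    omega
  · rw [hcard]
    exact congrArg (· + 1) (h.card_eq.resolve_right fun hno => hno b hb)
  · intro e hUe b' hb' hlt
    have hmono : M.closure {b' | b' ∈ B ∧ w e ≤ w b'} ⊆
        M.closure {b' | b' ∈ insert b B ∧ w e ≤ w b'} :=
      M.closure_subset_closure fun d (hd : d ∈ B ∧ _) => ⟨Finset.mem_insert_of_mem hd.1, hd.2⟩
    by_cases hex : ∃ b₀ ∈ B, w b₀ < w e
    · obtain ⟨b₀, hb₀, hlt₀⟩ := hex
      exact hmono (h.span e hUe b₀ hb₀ hlt₀)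
    · push Not at hex
      -- now `b` is the only lighter element, so `e` cannot extend `B`
      rcases Finset.mem_insert.1 hb' with rfl | hb'
      · refine hmono ?_
        have := mem_closure_of_not_extends hE h.indep hUe fun he => (hmax e he).not_gt hlt
        refine M.closure_subset_closure ?_ this
        exact fun d hd => ⟨hd, hex d hd⟩
      · exact absurd hlt (hex b' hb').not_gt

/-- After at least `|X|` steps, the greedy set contains a replacement for each element of `X` that
belongs to `U`. -/
theorem GreedyInv.exists_replacement (hE : M.E = Set.univ) (h : GreedyInv M w U g B)
    {X : Finset (Fin n)} (hX : M.Indep (X : Set (Fin n))) (hXg : X.card ≤ g) {x : Fin n}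
    (hx : x ∈ X) (hUx : U x) :
    ∃ y ∈ B, w x ≤ w y ∧ y ∉ X.erase x ∧
      M.Indep ((insert y (X.erase x) : Finset (Fin n)) : Set (Fin n)) := by
  have hXx : M.Indep ((X.erase x : Finset (Fin n)) : Set (Fin n)) :=
    hX.subset (by exact_mod_cast X.erase_subset x)
  have hspan : x ∈ M.closure {b | b ∈ B ∧ w x ≤ w b} → ∃ y ∈ B, w x ≤ w y ∧ y ∉ X.erase x ∧
      M.Indep ((insert y (X.erase x) : Finset (Fin n)) : Set (Fin n)) := by
    intro hcl
    have hex : ∃ y, (y ∈ B ∧ w x ≤ w y) ∧ y ∉ M.closure (X.erase x : Finset (Fin n)) := by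
      by_contra hno
      push Not at hno
      have h1 := M.closure_subset_closure_of_subset_closure
        (X := {b | b ∈ B ∧ w x ≤ w b}) (Y := (X.erase x : Finset (Fin n))) hno
      have h2 := hX.notMem_closure_sdiff_of_mem (Finset.mem_coe.2 hx)
      rw [Finset.coe_erase] at h1
      exact h2 (h1 hcl)
    obtain ⟨y, ⟨hyB, hwy⟩, hy⟩ := hex
    refine ⟨y, hyB, hwy, fun hyX => hy (M.mem_closure_of_mem' hyX (by simp [hE])), ?_⟩
    rw [Finset.coe_insert, hXx.insert_indep_iff]
    exact Or.inl ⟨by simp [hE], hy⟩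
  by_cases hex : ∃ b ∈ B, w b < w x
  · obtain ⟨b, hb, hlt⟩ := hex
    exact hspan (h.span x hUx b hb hlt)
  · push Not at hex
    rcases h.card_eq with hcard | hno
    · have hlt : (X.erase x).card < B.card := by
        rw [Finset.card_erase_of_mem hx]
        have := Finset.card_pos.2 ⟨x, hx⟩
        omega
      obtain ⟨y, hyB, hyX, hy⟩ := hXx.augment_finset h.indep hlt
      exact ⟨y, hyB, hex y hyB, hyX, by rwa [Finset.coe_insert]⟩
    · refine hspan (M.closure_subset_closure ?_
        (mem_closure_of_not_extends hE h.indep hUx (hno x)))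
      exact fun d hd => ⟨hd, hex d hd⟩

end Greedy

section Greedy

variable {n : ℕ} {M : Matroid (Fin n)} {w : Fin n → ℝ≥0}

/-- Let variable `16` be a heaviest candidate that extends the set in row `0` of array `6`, or `n`
if there is none. -/
def findBest : Cmd :=
  .seq (.assign 16 (.var 0)) (.times 10 (.var 0)
    (.cond (.get 4 (.num 0) (.var 10) (.num 0))
      (.cond (.get 6 (.num 0) (.var 10) (.num 0)) .skip
        (.seq (.put 6 (.num 0) (.var 10) (.num 0) (.num 1))
          (.seq (.query 17 6 (.num 0))
            (.seq (.put 6 (.num 0) (.var 10) (.num 0) (.num 0))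
              (.cond (.var 17) (.seq (.compare 18 (.var 10) (.var 16))
                (.cond (.var 18) .skip (.assign 16 (.var 10)))) .skip)))))
      .skip))

/-- One step of the greedy algorithm; the new element is also added to the output set. -/
def greedyStep : Cmd :=
  .seq findBest (.cond (.sub (.var 0) (.var 16))
    (.seq (.put 6 (.num 0) (.var 16) (.num 0) (.num 1))
      (.put 3 (.num 0) (.var 16) (.num 0) (.num 1))) .skip)

/-- Compute a greedy set of at most `K` candidates and add it to the output set. -/
def greedy : Cmd :=
  .seq (.times 10 (.var 0) (.put 6 (.num 0) (.var 10) (.num 0) (.num 0)))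
    (.times 15 (.var 3) greedyStep)

theorem row_congr {σ σ' : Store} {a i : ℕ} (h : ∀ e : Fin n, σ'.arr a i e 0 = σ.arr a i e 0) :
    σ'.row n a i = σ.row n a i := by
  ext e
  rw [mem_row, mem_row, h]

theorem row_setArr_one {σ : Store} {a i : ℕ} (e : Fin n) :
    (σ.setArr a i e 0 1).row n a i = insert e (σ.row n a i) := by
  ext f
  rw [mem_row, setArr_arr_self, Finset.mem_insert, mem_row]
  by_cases h : f = e
  · simp [h]
  · have : (f : ℕ) ≠ e := fun h' => h (Fin.ext h')
    simp [h, this]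

theorem query_ne_zero_iff (S : Finset (Fin n)) :
    (Env.ofMatroid M w).query S ≠ 0 ↔ M.Indep (S : Set (Fin n)) := by
  by_cases h : M.Indep (S : Set (Fin n)) <;> simp [Env.query, Env.ofMatroid, h]

theorem compare_ne_zero_iff (e : Fin n) (b : ℕ) :
    (Env.ofMatroid M w).compare e b ≠ 0 ↔ ∃ hb : b < n, w e ≤ w ⟨b, hb⟩ := by
  simp [Env.compare, Env.ofMatroid]

/-- The value `b` is a heaviest element among the first `m` elements that extend `B`, or it is `n`
if there is none. -/
def IsBest (M : Matroid (Fin n)) (w : Fin n → ℝ≥0) (U : Fin n → Prop) (B : Finset (Fin n))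
    (m b : ℕ) : Prop :=
  (b = n ∧ ∀ e : Fin n, (e : ℕ) < m → ¬ Extends M U B e) ∨
    ∃ hb : b < n, Extends M U B ⟨b, hb⟩ ∧
      ∀ e : Fin n, (e : ℕ) < m → Extends M U B e → w e ≤ w ⟨b, hb⟩

theorem IsBest.keep {U : Fin n → Prop} {B : Finset (Fin n)} {b : ℕ} {e : Fin n}
    (h : IsBest M w U B e b) (he : Extends M U B e → ∃ hb : b < n, w e ≤ w ⟨b, hb⟩) :
    IsBest M w U B (e + 1) b := by
  have hlt : ∀ f : Fin n, (f : ℕ) < e + 1 → (f : ℕ) < e ∨ f = e := fun f hf =>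
    (Nat.lt_succ_iff_lt_or_eq.1 hf).imp_right Fin.ext
  rcases h with ⟨rfl, h⟩ | ⟨hb, hbE, h⟩
  · refine Or.inl ⟨rfl, fun f hf => ?_⟩
    rcases hlt f hf with hf | rfl
    · exact h f hf
    · exact fun hE => absurd (he hE).1 (lt_irrefl _)
  · refine Or.inr ⟨hb, hbE, fun f hf hfE => ?_⟩
    rcases hlt f hf with hf | rfl
    · exact h f hf hfE
    · exact (he hfE).2

theorem IsBest.replace {U : Fin n → Prop} {B : Finset (Fin n)} {b : ℕ} {e : Fin n}
    (h : IsBest M w U B e b) (hE : Extends M U B e) (he : ¬ ∃ hb : b < n, w e ≤ w ⟨b, hb⟩) :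
    IsBest M w U B (e + 1) e := by
  refine Or.inr ⟨e.2, hE, fun f hf hfE => ?_⟩
  rcases Nat.lt_succ_iff_lt_or_eq.1 hf with hf | hf
  · rcases h with ⟨rfl, h⟩ | ⟨hb, -, h⟩
    · exact absurd hfE (h f hf)
    · push Not at he
      exact (h f hf hfE).trans (he hb).le
  · rw [Fin.ext hf]

theorem findBest_spec {σ : Store} {D : ℕ} (h0 : σ.var 0 = n) (hD : n ≤ D) :
    Sure (Env.ofMatroid M w) findBest σ (loopTime D 13 + 2) fun σ' =>
      IsBest M w (fun e => Cand σ e) (σ.row n 6 0) n (σ'.var 16) ∧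
        ∀ e : Fin n, σ'.arr 6 0 e 0 = σ.arr 6 0 e 0 := by
  refine (Sure.seq (T₁ := 1) (T₂ := loopTime D 13) (Q₁ := fun τ => τ = σ.setVar 16 n)
    (Sure.assign (by rw [Expr.eval, h0])) ?_).le (by omega)
  rintro _ rfl -
  refine (Sure.times (N := n) (D := D) (t := 13) (fun m τ =>
    IsBest M w (fun e => Cand σ e) (σ.row n 6 0) m (τ.var 16) ∧
      ∀ e : ℕ, τ.arr 6 0 e 0 = σ.arr 6 0 e 0) (by decide) (fun σ' hag => ?_) hD ?_ ?_).conseq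
      fun σ' h _ => ⟨h.1, fun e => h.2 e⟩
  · rw [Expr.eval, hag.1 0 (by decide), setVar_var_of_ne (by decide), h0]
  · rw [setVar_var_of_ne (by decide), setVar_var_self]
    exact ⟨Or.inl ⟨rfl, fun e he => absurd he (by omega)⟩, fun _ => rfl⟩
  · rintro m hm σ' hag hm' ⟨hbest, hrow⟩
    obtain ⟨e, rfl⟩ : ∃ e : Fin n, m = e := ⟨⟨m, hm⟩, rfl⟩
    have h4 : σ'.arr 4 = σ.arr 4 := hag.2 4 (by decide)
    have hrow' : σ'.row n 6 0 = σ.row n 6 0 := row_congr fun e => hrow e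
    -- nothing changes if the element does not extend the set
    have hskip : ∀ τ : Store, τ.var 16 = σ'.var 16 → (∀ j : ℕ, τ.arr 6 0 j 0 = σ.arr 6 0 j 0) →
        ¬ Extends M (fun e => Cand σ e) (σ.row n 6 0) e →
        IsBest M w (fun e => Cand σ e) (σ.row n 6 0) (e + 1) ((τ.setVar 10 (e + 1)).var 16) ∧
          ∀ j : ℕ, (τ.setVar 10 (e + 1)).arr 6 0 j 0 = σ.arr 6 0 j 0 := by
      intro τ hτ hτ' hE
      rw [setVar_var_of_ne (by decide), hτ]
      exact ⟨hbest.keep fun h => absurd h hE, hτ'⟩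
    refine Sure.cond (fun hc => Sure.cond (fun hc' => (Sure.skip (hskip σ' rfl hrow ?_)).le
      (by omega)) fun hc' => ?_) fun hc => (Sure.skip (hskip σ' rfl hrow ?_)).le (by omega)
    · intro hE
      simp only [Expr.eval, hm', hrow] at hc'
      exact hE.2.1 (mem_row.2 hc')
    · simp only [Expr.eval, hm', hrow, h4] at hc hc'
      have hEiff : Extends M (fun e => Cand σ e) (σ.row n 6 0) e ↔
          M.Indep ((insert e (σ.row n 6 0) : Finset (Fin n)) : Set (Fin n)) :=
        ⟨fun h => h.2.2, fun h => ⟨hc, fun hmem => mem_row.1 hmem hc', h⟩⟩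
      set q := (Env.ofMatroid M w).query (insert e (σ.row n 6 0)) with hq
      refine (Sure.seq (T₁ := 1) (T₂ := 9) (Q₁ := fun τ => τ = σ'.setArr 6 0 e 0 1)
        (Sure.put (by simp only [Expr.eval, hm'])) ?_).le (by omega)
      rintro _ rfl -
      refine (Sure.seq (T₁ := 1) (T₂ := 7)
        (Q₁ := fun τ => τ = (σ'.setArr 6 0 e 0 1).setVar 17 q)
        (Sure.query (by simp only [Expr.eval, row_setArr_one, hrow', hq])) ?_).le (by omega)
      rintro _ rfl -
      refine (Sure.seq (T₁ := 1) (T₂ := 5)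
        (Q₁ := fun τ => τ = ((σ'.setArr 6 0 e 0 1).setVar 17 q).setArr 6 0 e 0 0)
        (Sure.put (by simp only [Expr.eval, setVar_var_of_ne (show 10 ≠ 17 by decide),
          setArr_var, hm'])) ?_).le (by omega)
      rintro _ rfl -
      set τ := ((σ'.setArr 6 0 e 0 1).setVar 17 q).setArr 6 0 e 0 0 with hτ
      have hτ16 : τ.var 16 = σ'.var 16 := by
        rw [hτ, setArr_var, setVar_var_of_ne (by decide), setArr_var]
      have hτ10 : τ.var 10 = e := by
        rw [hτ, setArr_var, setVar_var_of_ne (by decide), setArr_var, hm']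
      have hτ6 : ∀ j : ℕ, τ.arr 6 0 j 0 = σ.arr 6 0 j 0 := by
        intro j
        rw [hτ, setArr_arr_self, setVar_arr, setArr_arr_self]
        split_ifs with hj
        · rw [hj, hc']
        · exact hrow j
      refine Sure.cond (fun hc₁ => ?_) fun hc₁ => (Sure.skip (hskip τ hτ16 hτ6 ?_)).le (by omega)
      · simp only [Expr.eval, hτ, setArr_var, setVar_var_self] at hc₁
        have hE := hEiff.2 ((query_ne_zero_iff _).1 hc₁)
        refine (Sure.seq (T₁ := 1) (T₂ := 2)
          (Q₁ := fun τ' => τ' = τ.setVar 18 ((Env.ofMatroid M w).compare e (σ'.var 16)))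
          (Sure.compare (by simp only [Expr.eval, hτ10, hτ16])) ?_).le (by omega)
        rintro _ rfl -
        refine Sure.cond (fun hc₂ => Sure.skip ?_) fun hc₂ => Sure.assign ?_
        · rw [Expr.eval, setVar_var_self, compare_ne_zero_iff] at hc₂
          rw [setVar_var_of_ne (by decide), setVar_var_of_ne (by decide), hτ16]
          exact ⟨hbest.keep fun _ => hc₂, hτ6⟩
        · rw [Expr.eval, setVar_var_self, ← not_ne_iff, compare_ne_zero_iff] at hc₂
          rw [setVar_var_of_ne (by decide), setVar_var_self, Expr.eval,
            setVar_var_of_ne (by decide), hτ10]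
          exact ⟨hbest.replace hE hc₂, hτ6⟩
      · simp only [Expr.eval, hτ, setArr_var, setVar_var_self] at hc₁
        rw [hEiff, ← query_ne_zero_iff (w := w)]
        exact not_ne_iff.2 hc₁
    · intro hE
      simp only [Expr.eval, hm', h4] at hc
      exact hE.1 hc

theorem greedyStep_spec {σ : Store} {D g : ℕ} (hE : M.E = Set.univ) (h0 : σ.var 0 = n)
    (hD : n ≤ D) (hI : GreedyInv M w (fun e => Cand σ e) g (σ.row n 6 0)) :
    Sure (Env.ofMatroid M w) greedyStep σ (loopTime D 13 + 7) fun σ' =>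
      ∃ B, σ'.row n 6 0 = B ∧ GreedyInv M w (fun e => Cand σ e) (g + 1) B ∧
        ∃ S ⊆ B, B = σ.row n 6 0 ∪ S ∧ σ'.row n 3 0 = σ.row n 3 0 ∪ S := by
  refine (Sure.seq (T₂ := 4) (findBest_spec h0 hD) fun σ₁ hσ₁ hag => ?_).le (by omega)
  obtain ⟨hbest, hrow⟩ := hσ₁
  have h6 : σ₁.row n 6 0 = σ.row n 6 0 := row_congr hrow
  have h3 : σ₁.row n 3 0 = σ.row n 3 0 := row_congr fun e => by rw [hag.2 3 (by decide)]
  have h0' : σ₁.var 0 = n := (hag.1 0 (by decide)).trans h0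
  refine Sure.cond (fun hc => ?_) fun hc => (Sure.skip ?_).le (by omega)
  · simp only [Expr.eval, h0'] at hc
    obtain ⟨hb, hbE, hmax⟩ := hbest.resolve_left fun h => hc (by rw [h.1]; omega)
    refine Sure.seq (T₁ := 1) (T₂ := 1) (Q₁ := fun τ => τ = σ₁.setArr 6 0 (σ₁.var 16) 0 1)
      (Sure.put rfl) ?_
    rintro _ rfl -
    refine Sure.put ⟨_, rfl, ?_⟩
    simp only [Expr.eval, setArr_var]
    have hr6 : ((σ₁.setArr 6 0 (σ₁.var 16) 0 1).setArr 3 0 (σ₁.var 16) 0 1).row n 6 0 =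
        insert ⟨σ₁.var 16, hb⟩ (σ.row n 6 0) := by
      rw [row_congr (σ := σ₁.setArr 6 0 (σ₁.var 16) 0 1)
        fun e => by rw [setArr_arr_of_ne (by decide)], ← h6]
      exact row_setArr_one ⟨σ₁.var 16, hb⟩
    have hr3 : ((σ₁.setArr 6 0 (σ₁.var 16) 0 1).setArr 3 0 (σ₁.var 16) 0 1).row n 3 0 =
        insert ⟨σ₁.var 16, hb⟩ (σ.row n 3 0) := by
      rw [← h3, ← row_congr (σ := σ₁) (σ' := σ₁.setArr 6 0 (σ₁.var 16) 0 1)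
        fun e => by rw [setArr_arr_of_ne (by decide)]]
      exact row_setArr_one ⟨σ₁.var 16, hb⟩
    rw [hr6, hr3]
    refine ⟨hI.extend hE hbE fun e he => hmax e e.2 he, {⟨σ₁.var 16, hb⟩}, by simp, ?_, ?_⟩ <;>
    rw [Finset.insert_eq, Finset.union_comm]
  · simp only [Expr.eval, h0'] at hc
    refine ⟨_, h6, hI.skip ?_, ∅, by simp, by simp, by simp [h3]⟩
    rcases hbest with ⟨-, h⟩ | ⟨hb, -⟩
    · exact fun e => h e e.2
    · omega

/-- The time bound for `greedy`. -/
def greedyTime {R : Type*} [Semiring R] (D : R) : R :=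
  loopTime D 1 + loopTime D (loopTime D 13 + 7) + 1

theorem greedy_spec {σ : Store} {D K : ℕ} (hE : M.E = Set.univ) (h0 : σ.var 0 = n)
    (h3 : σ.var 3 = K) (hD : n ≤ D) (hK : K ≤ D) :
    Sure (Env.ofMatroid M w) greedy σ (greedyTime D) fun σ' =>
      ∃ B, GreedyInv M w (fun e => Cand σ e) K B ∧ σ'.row n 3 0 = σ.row n 3 0 ∪ B := by
  refine Sure.seq (T₁ := loopTime D 1) (T₂ := loopTime D (loopTime D 13 + 7))
    (Q₁ := fun τ => τ.row n 6 0 = ∅) ?_ fun σ₁ hσ₁ hag₁ => ?_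
  · refine (Sure.times (N := n) (D := D) (t := 1) (fun m τ => ∀ e : Fin n, (e : ℕ) < m →
      τ.arr 6 0 e 0 = 0) (by decide) (fun σ' hag => ?_) hD (fun e he => absurd he (by omega))
      ?_).conseq fun σ' h _ => ?_
    · rw [Expr.eval, hag.1 0 (by decide), h0]
    · intro m hm σ' hag hm' hI
      refine Sure.put fun e he => ?_
      simp only [setVar_arr, Expr.eval, hm']
      rw [setArr_arr_self]
      split_ifs with h
      · rfl
      · exact hI e (by omega)
    · refine Finset.eq_empty_of_forall_notMem fun e he => ?_
      exact mem_row.1 he (h e e.2)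
  · have hc : ∀ τ : Store, AgreeOff (insert 15 greedyStep.vars) greedyStep.arrs σ₁ τ →
        (fun e : Fin n => Cand τ e) = fun e : Fin n => Cand σ e := fun τ hag => by
      funext e
      rw [Cand, hag.2 4 (by decide), hag₁.2 4 (by decide), Cand]
    refine (Sure.times (N := K) (D := D) (t := loopTime D 13 + 7) (fun g τ =>
      GreedyInv M w (fun e => Cand σ e) g (τ.row n 6 0) ∧
        τ.row n 3 0 = σ.row n 3 0 ∪ τ.row n 6 0) (by decide) (fun σ' hag => ?_) hK ?_ ?_).conseq
        fun σ' h _ => ⟨_, h.1, h.2⟩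
    · rw [Expr.eval, hag.1 3 (by decide), hag₁.1 3 (by decide), h3]
    · have h6 : (σ₁.setVar 15 0).row n 6 0 = ∅ := hσ₁
      rw [h6, Finset.union_empty]
      exact ⟨GreedyInv.empty, row_congr fun e => by
        rw [setVar_arr, hag₁.2 3 (by decide)]⟩
    · rintro g hg σ' hag hg' ⟨hI, hR⟩
      refine (greedyStep_spec (g := g) hE (by rw [hag.1 0 (by decide), hag₁.1 0 (by decide), h0])
        hD (by rwa [hc σ' hag])).conseq ?_
      rintro σ'' ⟨B, hB, hB', S, hS, hBS, h3'⟩ -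
      change GreedyInv M w (fun e => Cand σ e) (g + 1) (σ''.row n 6 0) ∧
        σ''.row n 3 0 = σ.row n 3 0 ∪ σ''.row n 6 0
      rw [hc σ' hag] at hB'
      rw [hB, h3', hR, Finset.union_assoc, ← hBS]
      exact ⟨hB', rfl⟩

end Greedy

/-! ### Partial exchanges and repeated trials -/

section Progress

variable {E : Type} [DecidableEq E] {t : ℕ}

/-- The sequence `y₀, …, y_{j-1}, x_j, …, x_{t-1}`. -/
def mixed (x y : Fin t → E) (j : ℕ) (i : Fin t) : E := if (i : ℕ) < j then y i else x i

/-- The first `j` elements of the sequence `x` can be exchanged for elements of `R`. -/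
def Exchanged (F : Set (Finset E)) (w : E → ℝ≥0) (x : Fin t → E) (R : Finset E) (j : ℕ) : Prop :=
  ∃ y : Fin t → E, ∀ i : Fin t, (i : ℕ) < j →
    y i ∈ R ∧ w (x i) ≤ w (y i) ∧ (exchanged x y i).card = t ∧ exchanged x y i ∈ F

variable {F : Set (Finset E)} {w : E → ℝ≥0} {x y : Fin t → E} {R : Finset E} {j : ℕ}

theorem exchanged_eq_image_mixed (i : Fin t) :
    exchanged x y i = Finset.univ.image (mixed x y (i + 1)) := by
  rw [exchanged]
  refine Finset.image_congr fun l _ => ?_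
  simp only [mixed, Fin.le_def, Nat.lt_succ_iff]

theorem Exchanged.zero : Exchanged F w x R 0 := ⟨x, fun i hi => absurd hi (by omega)⟩

theorem Exchanged.mono (h : Exchanged F w x R j) {R' : Finset E} (hR : R ⊆ R') :
    Exchanged F w x R' j := by
  obtain ⟨y, hy⟩ := h
  exact ⟨y, fun i hi => ⟨hR (hy i hi).1, (hy i hi).2⟩⟩

/-- The current set after `j` exchanges, and the condition for one more exchange. -/
theorem Exchanged.exists_current (hx : Function.Injective x) (hF : Finset.univ.image x ∈ F)
    (hj : j < t) (h : Exchanged F w x R j) :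
    ∃ X ∈ F, X.card = t ∧ x ⟨j, hj⟩ ∈ X ∧ ∀ R', R ⊆ R' → ∀ z ∈ R', w (x ⟨j, hj⟩) ≤ w z →
      z ∉ X.erase (x ⟨j, hj⟩) → insert z (X.erase (x ⟨j, hj⟩)) ∈ F →
        Exchanged F w x R' (j + 1) := by
  obtain ⟨y, hy⟩ := h
  have hX : (Finset.univ.image (mixed x y j)).card = t ∧ Finset.univ.image (mixed x y j) ∈ F := by
    rcases Nat.eq_zero_or_pos j with rfl | hj0
    · have : mixed x y 0 = x := by
        funext i
        simp [mixed]
      rw [this]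
      exact ⟨by rw [Finset.card_image_of_injective _ hx]; simp, hF⟩
    · have := hy ⟨j - 1, by omega⟩ (by simp; omega)
      rw [exchanged_eq_image_mixed] at this
      simp only [show j - 1 + 1 = j by omega] at this
      exact this.2.2
  have hinj : Function.Injective (mixed x y j) := by
    rw [← Set.injOn_univ, ← Finset.coe_univ]
    exact Finset.card_image_iff.1 (by rw [hX.1]; simp)
  have hxj : mixed x y j ⟨j, hj⟩ = x ⟨j, hj⟩ := if_neg (lt_irrefl j)
  have hmem : x ⟨j, hj⟩ ∈ Finset.univ.image (mixed x y j) :=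
    Finset.mem_image.2 ⟨⟨j, hj⟩, Finset.mem_univ _, hxj⟩
  refine ⟨_, hX.2, hX.1, hmem, fun R' hR z hz hwz hzX hzF => ?_⟩
  refine ⟨Function.update y ⟨j, hj⟩ z, fun i hi => ?_⟩
  rcases (Nat.lt_succ_iff.1 hi).lt_or_eq with h | h
  · have hne : i ≠ ⟨j, hj⟩ := fun h' => by simp [h'] at h
    have heq : exchanged x (Function.update y ⟨j, hj⟩ z) i = exchanged x y i := by
      rw [exchanged, exchanged]
      refine Finset.image_congr fun l _ => ?_
      by_cases hl : l ≤ i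
      · have : l ≠ ⟨j, hj⟩ := fun h' => by
          rw [h'] at hl
          exact absurd (Fin.le_def.1 hl) (not_le.2 h)
        simp only [hl, if_true, Function.update_of_ne this]
      · simp only [hl, if_false]
    rw [heq, Function.update_of_ne hne]
    exact ⟨hR (hy i h).1, (hy i h).2⟩
  · obtain rfl : i = ⟨j, hj⟩ := Fin.ext h
    have heq : exchanged x (Function.update y ⟨j, hj⟩ z) ⟨j, hj⟩ =
        insert z ((Finset.univ.image (mixed x y j)).erase (x ⟨j, hj⟩)) := by
      rw [exchanged_eq_image_mixed]
      ext e
      simp only [Finset.mem_image, Finset.mem_univ, true_and, Finset.mem_insert, Finset.mem_erase]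
      have hne : ∀ l : Fin t, l ≠ ⟨j, hj⟩ →
          mixed x (Function.update y ⟨j, hj⟩ z) (j + 1) l = mixed x y j l := fun l hl => by
        have hl' : (l : ℕ) ≠ j := fun h' => hl (Fin.ext h')
        simp only [mixed, Function.update_of_ne hl]
        exact if_congr (by omega) rfl rfl
      have hself : mixed x (Function.update y ⟨j, hj⟩ z) (j + 1) ⟨j, hj⟩ = z := by
        simp [mixed]
      constructor
      · rintro ⟨l, rfl⟩
        by_cases hl : l = ⟨j, hj⟩
        · rw [hl]
          exact Or.inl hself
        · refine Or.inr ⟨?_, l, (hne l hl).symm⟩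
          rw [hne l hl, ← hxj]
          exact fun h' => hl (hinj h')
      · rintro (rfl | ⟨h', l, rfl⟩)
        · exact ⟨_, hself⟩
        · refine ⟨l, hne l fun hl => h' ?_⟩
          rw [hl, hxj]
    rw [heq, Function.update_self]
    refine ⟨hz, hwz, ?_, hzF⟩
    rw [Finset.card_insert_of_notMem hzX, Finset.card_erase_of_mem hmem, hX.1]
    omega

end Progress

section Trials

/-- The probability that at least `r` of `m` independent trials with success probability `q` are
successful. -/
noncomputable def successProb (q : ℝ≥0∞) : ℕ → ℕ → ℝ≥0∞
  | 0, _ => 1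
  | _ + 1, 0 => 0
  | r + 1, m + 1 => q * successProb q r m + (1 - q) * successProb q (r + 1) m

theorem successProb_succ_le {q : ℝ≥0∞} (hq : q ≤ 1) (r m : ℕ) :
    successProb q (r + 1) m ≤ successProb q r m := by
  induction m generalizing r with
  | zero => cases r <;> simp [successProb]
  | succ m ih =>
    have hsum : ∀ a, q * a + (1 - q) * a = a := fun a => by
      rw [← add_mul, add_tsub_cancel_of_le hq, one_mul]
    cases r with
    | zero =>
      calc successProb q 1 (m + 1)
          = q * successProb q 0 m + (1 - q) * successProb q 1 m := rfl
        _ ≤ q * successProb q 0 m + (1 - q) * successProb q 0 m := by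
          gcongr
          exact ih 0
        _ = successProb q 0 (m + 1) := by rw [hsum, successProb, successProb]
    | succ r =>
      rw [successProb, successProb]
      gcongr
      · exact ih r
      · exact ih (r + 1)

theorem successProb_antitone {q : ℝ≥0∞} (hq : q ≤ 1) (m : ℕ) :
    Antitone fun r => successProb q r m :=
  antitone_nat_of_succ_le fun r => successProb_succ_le hq r m

/-- The exponential moment bound for the lower tail. -/
theorem ofReal_le_successProb {q : ℝ} (hq0 : 0 ≤ q) (hq1 : q ≤ 1) (r m : ℕ) :
    ENNReal.ofReal (1 - 2 ^ r * (1 - q / 2) ^ m) ≤ successProb (ENNReal.ofReal q) r m := by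
  induction m generalizing r with
  | zero =>
    cases r with
    | zero => simp [successProb]
    | succ r =>
      rw [successProb, ENNReal.ofReal_eq_zero.2]
      have : (1 : ℝ) ≤ 2 ^ (r + 1) := one_le_pow₀ (by norm_num)
      rw [pow_zero, mul_one]
      linarith
  | succ m ih =>
    cases r with
    | zero =>
      rw [successProb, ENNReal.ofReal_le_one]
      have : 0 ≤ (1 - q / 2) ^ (m + 1) := pow_nonneg (by linarith) _
      linarith
    | succ r =>
      rw [successProb]
      calc ENNReal.ofReal (1 - 2 ^ (r + 1) * (1 - q / 2) ^ (m + 1))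
          = ENNReal.ofReal (q * (1 - 2 ^ r * (1 - q / 2) ^ m) +
              (1 - q) * (1 - 2 ^ (r + 1) * (1 - q / 2) ^ m)) := by
            congr 1
            ring
        _ ≤ ENNReal.ofReal (q * (1 - 2 ^ r * (1 - q / 2) ^ m)) +
              ENNReal.ofReal ((1 - q) * (1 - 2 ^ (r + 1) * (1 - q / 2) ^ m)) :=
            ENNReal.ofReal_add_le
        _ ≤ _ := by
          rw [ENNReal.ofReal_mul hq0, ENNReal.ofReal_mul (by linarith),
            ENNReal.ofReal_sub _ hq0, ENNReal.ofReal_one]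
          gcongr
          · exact ih r
          · exact ih (r + 1)

/-- With success probability `K ^ (-3lm)`, where `l = log₂ K`, a number of `K ^ (4(m+1)l)` trials
suffices for `K` successes. -/
theorem two_thirds_le_successProb {K m r : ℕ} (hK : 1 ≤ K) (hr : r ≤ K) :
    2 / 3 ≤ successProb (((K : ℝ≥0∞)⁻¹) ^ (3 * Nat.log 2 K * m)) r
      (K ^ (4 * (m + 1) * Nat.log 2 K)) := by
  rcases hK.eq_or_lt with rfl | hK2
  · have h23 : (2 / 3 : ℝ≥0∞) ≤ 1 := by
      rw [ENNReal.div_le_iff (by norm_num) (by norm_num)]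
      norm_num
    have : r = 0 ∨ r = 1 := by omega
    rcases this with rfl | rfl <;> simpa [successProb] using h23
  · set l := Nat.log 2 K with hl
    have hl1 : 1 ≤ l := Nat.log_pos (by norm_num) hK2
    have hK0 : (0 : ℝ) < K := by exact_mod_cast hK
    have hK2' : (2 : ℝ) ≤ K := by exact_mod_cast hK2
    set q : ℝ := ((K : ℝ)⁻¹) ^ (3 * l * m) with hq
    have hq0 : 0 ≤ q := by positivity
    have hq1 : q ≤ 1 := pow_le_one₀ (by positivity) (inv_le_one_of_one_le₀ (by linarith))
    have hqe : ((K : ℝ≥0∞)⁻¹) ^ (3 * l * m) = ENNReal.ofReal q := by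
      rw [hq, ENNReal.ofReal_pow (by positivity), ENNReal.ofReal_inv_of_pos hK0,
        ENNReal.ofReal_natCast]
    rw [hqe]
    refine le_trans ?_ (ofReal_le_successProb hq0 hq1 _ _)
    have h23 : (2 / 3 : ℝ≥0∞) = ENNReal.ofReal (2 / 3) := by
      rw [ENNReal.ofReal_div_of_pos (by norm_num)]
      simp
    rw [h23]
    refine ENNReal.ofReal_le_ofReal ?_
    set v := K ^ (4 * (m + 1) * l) with hv
    -- the expected number of successes is at least `K ^ 4`
    have hqv : 8 * (K : ℝ) ≤ q * v := by
      have h1 : q * v = (K : ℝ) ^ (4 * (m + 1) * l - 3 * l * m) := by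
        rw [hq, hv, inv_pow, Nat.cast_pow, mul_comm, ← pow_sub₀ _ hK0.ne' (by nlinarith)]
      have h2 : 4 ≤ 4 * (m + 1) * l - 3 * l * m := by
        have : 4 + 3 * l * m ≤ 4 * (m + 1) * l := by nlinarith [Nat.zero_le (l * m)]
        omega
      rw [h1]
      calc 8 * (K : ℝ) = 2 ^ 3 * K := by norm_num
        _ ≤ (K : ℝ) ^ 3 * K := by gcongr
        _ = (K : ℝ) ^ 4 := by ring
        _ ≤ _ := pow_le_pow_right₀ (by linarith) h2
    have h1 : (1 - q / 2) ^ v ≤ Real.exp (-(4 * K)) := by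
      calc (1 - q / 2) ^ v ≤ Real.exp (-(q / 2)) ^ v := by
            gcongr
            · linarith
            · exact Real.one_sub_le_exp_neg _
        _ = Real.exp (v * -(q / 2)) := (Real.exp_nat_mul _ _).symm
        _ ≤ _ := Real.exp_le_exp.2 (by linarith)
    have h2 : (2 : ℝ) ^ r ≤ Real.exp K := by
      calc (2 : ℝ) ^ r ≤ 2 ^ K := pow_le_pow_right₀ (by norm_num) hr
        _ ≤ Real.exp 1 ^ K := by
          gcongr
          have := Real.add_one_le_exp 1
          linarith
        _ = Real.exp K := by rw [← Real.exp_nat_mul, mul_one]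
    have h3 : (2 : ℝ) ^ r * (1 - q / 2) ^ v ≤ 1 / 3 := by
      calc (2 : ℝ) ^ r * (1 - q / 2) ^ v ≤ Real.exp K * Real.exp (-(4 * K)) := by
            gcongr
            exact pow_nonneg (by linarith) _
        _ = (Real.exp (3 * K))⁻¹ := by
          rw [← Real.exp_add, ← Real.exp_neg]
          congr 1
          ring
        _ ≤ 1 / 3 := by
          rw [one_div]
          refine inv_anti₀ (by norm_num) ?_
          have := Real.add_one_le_exp (3 * (K : ℝ))
          linarith
    linarith

end Trials

/-! ### The algorithm for reachable kernels -/

section Reach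

variable {n m : ℕ}

/-- The registers and arrays that the body of the algorithm reads, but does not change. -/
structure Ready (σ : Store) (K : ℕ) (L : Fin m → LaminarRep (Fin n)) : Prop where
  var_zero : σ.var 0 = n
  var_two : σ.var 2 = m
  var_three : σ.var 3 = K
  var_four : σ.var 4 = Nat.log 2 K
  encodes : ∀ i : Fin m, Encodes σ i (L i)

theorem Ready.of_agree {σ σ' : Store} {K : ℕ} {L : Fin m → LaminarRep (Fin n)}
    (h : Ready σ K L) {V A : Finset ℕ} (hag : AgreeOff V A σ σ')
    (hV : 0 ∉ V ∧ 2 ∉ V ∧ 3 ∉ V ∧ 4 ∉ V) (hA : 0 ∉ A ∧ 1 ∉ A ∧ 2 ∉ A) : Ready σ' K L where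
  var_zero := (hag.1 0 hV.1).trans h.var_zero
  var_two := (hag.1 2 hV.2.1).trans h.var_two
  var_three := (hag.1 3 hV.2.2.1).trans h.var_three
  var_four := (hag.1 4 hV.2.2.2).trans h.var_four
  encodes i := (h.encodes i).of_agree hag hA

/-- Multiply variable `5` by variable `3`. -/
def multiply : Cmd :=
  .seq (.assign 6 (.num 0)) (.seq (.times 12 (.var 3) (.assign 6 (.add (.var 6) (.var 5))))
    (.assign 5 (.var 6)))

/-- Set variable `5` to `K ^ (4 * (m + 1) * log₂ K)`, the number of trials. -/
def power : Cmd :=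
  .seq (.assign 5 (.num 1)) (.times 8 (.var 4) (.times 7 (.add (.var 2) (.num 1))
    (.times 10 (.num 4) multiply)))

/-- For each laminar matroid, replace the candidate set by a guess of an exchangeable subset. -/
def guesses : Cmd := .times 7 (.var 2) guess

/-- One trial: guess a set of candidates, and add a greedy subset of it to the output. -/
def trial : Cmd := .seq initCand (.seq guesses greedy)

/-- The trials; their number is in variable `5`. -/
def trials : Cmd := .times 14 (.var 5) trial

/-- Output the ground set. -/
def outputAll : Cmd := .times 10 (.var 0) (.put 3 (.num 0) (.var 10) (.num 0) (.num 1))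

/-- The algorithm for reachable kernels: if the number of trials is at least the size of the ground
set, output the ground set; otherwise perform the trials. -/
def reach : Cmd :=
  .seq setup (.seq power (.cond (.sub (.var 0) (.var 5)) trials outputAll))

/-- The time bound for `power`. -/
def powerTime {R : Type*} [Semiring R] (D : R) : R :=
  loopTime D (loopTime D (loopTime D (loopTime D 1 + 4))) + 2

/-- The time bound for `trial`. -/
def trialTime {R : Type*} [Semiring R] (D : R) : R :=
  loopTime D 1 + loopTime D (guessTime D) + greedyTime D + 2

/-- The time bound for `reach`. -/
def reachTime {R : Type*} [Semiring R] (D : R) : R :=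
  loopTime D 4 + powerTime D + loopTime D (trialTime D) + loopTime D 1 + 9

section

variable {env : Env n}

theorem multiply_spec {σ : Store} {K D : ℕ} (h3 : σ.var 3 = K) (hD : K ≤ D) :
    Sure env multiply σ (loopTime D 1 + 4) fun σ' => σ'.var 5 = σ.var 5 * K := by
  refine (Sure.seq (T₁ := 1) (T₂ := loopTime D 1 + 2) (Q₁ := fun τ => τ.var 6 = 0)
    (Sure.assign (setVar_var_self _ _ _)) fun τ hτ hag => Sure.seq (T₁ := loopTime D 1) (T₂ := 1)
      (Sure.times (N := K) (D := D) (t := 1) (fun j τ' => τ'.var 6 = σ.var 5 * j) (by decide)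
        (fun τ' hag' => ?_) hD ?_ ?_) fun τ' hτ' _ => Sure.assign ?_).le (by omega)
  · rw [Expr.eval, hag'.1 3 (by decide), hag.1 3 (by decide), h3]
  · rw [setVar_var_of_ne (by decide), hτ, mul_zero]
  · intro j hj τ' hag' _ hI
    refine Sure.assign ?_
    rw [setVar_var_of_ne (by decide), setVar_var_self, Expr.eval, Expr.eval, Expr.eval, hI,
      hag'.1 5 (by decide), hag.1 5 (by decide), mul_add, mul_one]
  · rw [setVar_var_self, Expr.eval, hτ']

theorem power_spec {σ : Store} {K l D : ℕ} (h2 : σ.var 2 = m) (h3 : σ.var 3 = K)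
    (h4 : σ.var 4 = l) (hK : K ≤ D) (hl : l ≤ D) (hm : m + 1 ≤ D) (hD : 4 ≤ D) :
    Sure env power σ (powerTime D) fun σ' => σ'.var 5 = K ^ (4 * (m + 1) * l) := by
  refine (Sure.seq (T₁ := 1) (T₂ := loopTime D (loopTime D (loopTime D (loopTime D 1 + 4))))
    (Q₁ := fun τ => τ.var 5 = 1) (Sure.assign (setVar_var_self _ _ _)) fun τ hτ hag => ?_).le
    (by simp only [powerTime]; omega)
  refine Sure.times (N := l) (fun a τ' => τ'.var 5 = K ^ (4 * (m + 1) * a)) (by decide)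
    (fun τ' hag' => ?_) hl ?_ ?_
  · rw [Expr.eval, hag'.1 4 (by decide), hag.1 4 (by decide), h4]
  · rw [setVar_var_of_ne (by decide), hτ, mul_zero, pow_zero]
  intro a _ τ₁ hag₁ _ hI₁
  refine (Sure.times (N := m + 1) (fun b τ' => τ'.var 5 = τ₁.var 5 * K ^ (4 * b)) (by decide)
    (fun τ' hag' => ?_) hm ?_ ?_).conseq fun τ' hτ' _ => ?_
  · rw [Expr.eval, Expr.eval, Expr.eval, hag'.1 2 (by decide), hag₁.1 2 (by decide),
      hag.1 2 (by decide), h2]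
  · rw [setVar_var_of_ne (by decide), mul_zero, pow_zero, mul_one]
  · intro b _ τ₂ hag₂ _ hI₂
    refine (Sure.times (N := 4) (fun c τ' => τ'.var 5 = τ₂.var 5 * K ^ c) (by decide)
      (fun τ' hag' => ?_) hD ?_ ?_).conseq fun τ' hτ' _ => ?_
    · rw [Expr.eval]
    · rw [setVar_var_of_ne (by decide), pow_zero, mul_one]
    · intro c _ τ₃ hag₃ _ hI₃
      refine (multiply_spec (K := K) ?_ hK).conseq fun τ' hτ' _ => ?_
      · rw [hag₃.1 3 (by decide), hag₂.1 3 (by decide), hag₁.1 3 (by decide),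
          hag.1 3 (by decide), h3]
      · rw [setVar_var_of_ne (by decide), hτ', hI₃, pow_succ, mul_assoc]
    · rw [setVar_var_of_ne (by decide), hτ', hI₂, mul_assoc, ← pow_add, mul_add, mul_one]
  · rw [setVar_var_of_ne (by decide), hτ', hI₁, ← pow_add, mul_add (4 * (m + 1)), mul_one]

theorem outputAll_spec {σ : Store} {D : ℕ} (h0 : σ.var 0 = n) (hD : n ≤ D) :
    Sure env outputAll σ (loopTime D 1) fun σ' => σ'.row n 3 0 = Finset.univ := by
  refine (Sure.times (N := n) (D := D) (t := 1) (fun u τ => ∀ e : Fin n, (e : ℕ) < u →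
    τ.arr 3 0 e 0 ≠ 0) (by decide) (fun σ' hag => ?_) hD (fun e he => absurd he (by omega))
    ?_).conseq fun σ' h _ => Finset.eq_univ_of_forall fun e => mem_row.2 (h e e.2)
  · rw [Expr.eval, hag.1 0 (by decide), h0]
  · intro u hu σ' hag hu' hI
    refine Sure.put fun e he => ?_
    simp only [setVar_arr, Expr.eval, hu']
    rw [setArr_arr_self]
    split_ifs with h
    · exact one_ne_zero
    · exact hI e (by omega)

theorem guesses_sure {σ : Store} {K D : ℕ} {L : Fin m → LaminarRep (Fin n)} (h : Ready σ K L)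
    (hKn : K ≤ n) (hK : 0 < n → 0 < K) (hD : n * n + 1 ≤ D) (hm : m ≤ D) :
    Sure env guesses σ (loopTime D (guessTime D)) fun _ => True := by
  have hnD : n ≤ D := by nlinarith
  refine Sure.times (N := m) (fun _ _ => True) (by decide) (fun σ' hag => ?_) hm trivial ?_
  · rw [Expr.eval, hag.1 2 (by decide), h.var_two]
  · intro i hi σ' hag hi' _
    have h' := h.of_agree hag (by decide) (by decide)
    exact (guess_sure (h'.encodes ⟨i, hi⟩) h'.var_zero h'.var_three h'.var_four hi' hKn hK hnD
      ((L ⟨i, hi⟩).length_sets_le.trans hD)).conseq fun _ _ _ => trivial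

/-- With probability at least `K ^ (-3 * log₂ K * m)`, the remaining candidates form a set that is
exchangeable with respect to all laminar matroids and contains `x`. -/
theorem guesses_spec {σ : Store} {K D : ℕ} {L : Fin m → LaminarRep (Fin n)}
    {M : Fin m → Matroid (Fin n)} {X : Finset (Fin n)} {x : Fin n} (h : Ready σ K L)
    (hM : ∀ i, (L i).Represents (M i)) (hX : ∀ i, (M i).Indep (X : Set (Fin n))) (hx : x ∈ X)
    (hXK : X.card ≤ K) (hKn : K ≤ n) (hD : n * n + 1 ≤ D) (hm : m ≤ D) :
    Triple env guesses σ (loopTime D (guessTime D)) (fun _ => True)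
      (Set.indicator {σ' | (Cand σ x → Cand σ' x) ∧ ∀ i, ∀ y : Fin n, Cand σ' y →
        (M i).Indep ((insert y (X.erase x) : Finset (Fin n)) : Set (Fin n))} 1)
      (((K : ℝ≥0∞)⁻¹) ^ (3 * Nat.log 2 K * m)) := by
  classical
  have hnD : n ≤ D := by nlinarith
  set G : ℕ → Set Store := fun j => {σ' | (Cand σ x → Cand σ' x) ∧ ∀ i : Fin m, (i : ℕ) < j →
    ∀ y : Fin n, Cand σ' y →
      (M i).Indep ((insert y (X.erase x) : Finset (Fin n)) : Set (Fin n))} with hG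
  refine (Triple.times (N := m) (D := D) (t := guessTime D) (fun _ _ => True)
    (fun j σ' => if σ' ∈ G j then ((K : ℝ≥0∞)⁻¹) ^ (3 * Nat.log 2 K * (m - j)) else 0) (by decide)
    (fun σ' hag => ?_) hm trivial ?_).conseq ?_ ?_
  · rw [Expr.eval, hag.1 2 (by decide), h.var_two]
  · intro j hj σ' hag hj' _
    have h' := h.of_agree hag (by decide) (by decide)
    have hguess := guess_spec (env := env) (hM ⟨j, hj⟩) (hX ⟨j, hj⟩) (h'.encodes ⟨j, hj⟩)
      h'.var_zero h'.var_three h'.var_four hj' hx hXK hnD ((L ⟨j, hj⟩).length_sets_le.trans hD)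
      ((Nat.log_le_self 2 K).trans (hKn.trans hnD))
    split_ifs with hgood
    · have := hguess.convex (a := ((K : ℝ≥0∞)⁻¹) ^ (3 * Nat.log 2 K * (m - (j + 1)))) (b := 0)
        (Φ := fun σ'' => if σ''.setVar 7 (j + 1) ∈ G (j + 1) then
          ((K : ℝ≥0∞)⁻¹) ^ (3 * Nat.log 2 K * (m - (j + 1))) else 0) zero_le ?_
        (fun _ _ _ => zero_le)
      · refine this.conseq (fun σ'' hσ'' _ => ⟨trivial, le_rfl⟩) ?_
        rw [mul_zero, add_zero, ← pow_add]
        refine (congrArg _ ?_).le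
        rw [show m - j = m - (j + 1) + 1 by omega, mul_add, mul_one, add_comm]
      · rintro σ'' hσ'' - ⟨h1, h2⟩
        rw [if_pos]
        refine ⟨fun hc => h1 (hgood.1 hc), fun i hi y hy => ?_⟩
        rcases Nat.lt_succ_iff_lt_or_eq.1 hi with hi | hi
        · exact hgood.2 i hi y (hσ'' y hy)
        · obtain rfl : i = ⟨j, hj⟩ := Fin.ext hi
          exact h2 y hy
    · exact hguess.sure.triple fun σ'' _ _ => ⟨trivial, zero_le⟩
  · intro σ' _ _
    refine ⟨trivial, ?_⟩
    by_cases hσ' : σ' ∈ G m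
    · have : σ' ∈ {σ' : Store | (Cand σ x → Cand σ' x) ∧ ∀ i, ∀ y : Fin n, Cand σ' y →
          (M i).Indep ((insert y (X.erase x) : Finset (Fin n)) : Set (Fin n))} :=
        ⟨hσ'.1, fun i => hσ'.2 i i.2⟩
      rw [if_pos hσ', Set.indicator_of_mem this]
      simp
    · rw [if_neg hσ']
      exact zero_le
  · rw [if_pos]
    · simp
    · exact ⟨fun hc => hc, fun i hi => absurd hi (by omega)⟩

end

section Trials

variable {M₀ : Matroid (Fin n)} {w : Fin n → ℝ≥0} {σ : Store} {K D : ℕ}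
  {L : Fin m → LaminarRep (Fin n)}

theorem trial_triple (hE : M₀.E = Set.univ) (h : Ready σ K L) (hKn : K ≤ n)
    (hD : n * n + 1 ≤ D) {G : (Fin n → Prop) → Prop} {v : ℝ≥0∞}
    (hguess : ∀ τ : Store, Ready τ K L → (∀ e : Fin n, Cand τ e) →
      Triple (Env.ofMatroid M₀ w) guesses τ (loopTime D (guessTime D)) (fun _ => True)
        (Set.indicator {τ' | G fun e => Cand τ' e} 1) v) :
    Triple (Env.ofMatroid M₀ w) trial σ (trialTime D)
      (fun σ' => σ.row n 3 0 ⊆ σ'.row n 3 0 ∧ (σ'.row n 3 0).card ≤ (σ.row n 3 0).card + K)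
      (Set.indicator {σ' | ∃ U B, G U ∧ GreedyInv M₀ w U K B ∧ B ⊆ σ'.row n 3 0} 1) v := by
  have hnD : n ≤ D := by nlinarith
  refine (Sure.seq_triple (T₂ := loopTime D (guessTime D) + greedyTime D + 1)
    (initCand_spec h.var_zero hnD) fun σ₁ hσ₁ hag₁ => ?_).le (by simp only [trialTime]; omega)
  have h₁ := h.of_agree hag₁ (by decide) (by decide)
  refine Triple.seq (hguess σ₁ h₁ hσ₁) fun σ₂ _ hag₂ => ?_
  have h₂ := h₁.of_agree hag₂ (by decide) (by decide)
  have hrow : σ₂.row n 3 0 = σ.row n 3 0 := row_congr fun e => by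
    rw [hag₂.2 3 (by decide), hag₁.2 3 (by decide)]
  refine (greedy_spec hE h₂.var_zero h₂.var_three hnD (hKn.trans hnD)).triple ?_
  rintro σ' ⟨B, hB, hσ'⟩ -
  rw [hrow] at hσ'
  refine ⟨⟨?_, ?_⟩, indicator_one_le fun hG => ⟨_, B, hG, hB, ?_⟩⟩
  · rw [hσ']
    exact Finset.subset_union_left
  · rw [hσ']
    exact (Finset.card_union_le _ _).trans (Nat.add_le_add_left hB.card_le _)
  · rw [hσ']
    exact Finset.subset_union_right

theorem trial_sure (hE : M₀.E = Set.univ) (h : Ready σ K L) (hKn : K ≤ n)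
    (hK : 0 < n → 0 < K) (hD : n * n + 1 ≤ D) (hm : m ≤ D) :
    Sure (Env.ofMatroid M₀ w) trial σ (trialTime D)
      (fun σ' => σ.row n 3 0 ⊆ σ'.row n 3 0 ∧ (σ'.row n 3 0).card ≤ (σ.row n 3 0).card + K) :=
  (trial_triple hE h hKn hD (G := fun _ => False) (v := 0) fun _ hτ _ =>
    (guesses_sure hτ hKn hK hD hm).triple fun _ _ _ => ⟨trivial, zero_le⟩).sure

/-- A trial finds an element by which `x` can be exchanged with probability at least
`K ^ (-3 * log₂ K * m)`. -/
theorem trial_spec {M : Fin m → Matroid (Fin n)} {X : Finset (Fin n)} {x : Fin n}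
    (hE : M₀.E = Set.univ) (h : Ready σ K L) (hM : ∀ i, (L i).Represents (M i))
    (hX₀ : M₀.Indep (X : Set (Fin n))) (hX : ∀ i, (M i).Indep (X : Set (Fin n))) (hx : x ∈ X)
    (hXK : X.card ≤ K) (hKn : K ≤ n) (hD : n * n + 1 ≤ D) (hm : m ≤ D) :
    Triple (Env.ofMatroid M₀ w) trial σ (trialTime D)
      (fun σ' => σ.row n 3 0 ⊆ σ'.row n 3 0 ∧ (σ'.row n 3 0).card ≤ (σ.row n 3 0).card + K)
      (Set.indicator {σ' | ∃ y ∈ σ'.row n 3 0, w x ≤ w y ∧ y ∉ X.erase x ∧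
        M₀.Indep ((insert y (X.erase x) : Finset (Fin n)) : Set (Fin n)) ∧
        ∀ i, (M i).Indep ((insert y (X.erase x) : Finset (Fin n)) : Set (Fin n))} 1)
      (((K : ℝ≥0∞)⁻¹) ^ (3 * Nat.log 2 K * m)) := by
  refine (trial_triple hE h hKn hD (G := fun U => U x ∧ ∀ i, ∀ y : Fin n, U y →
    (M i).Indep ((insert y (X.erase x) : Finset (Fin n)) : Set (Fin n))) fun τ hτ hc =>
      (guesses_spec hτ hM hX hx hXK hKn hD hm).conseq fun σ' _ _ =>
        ⟨trivial, indicator_one_le fun hσ' => ⟨hσ'.1 (hc x), hσ'.2⟩⟩).conseq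
    fun σ' hσ' _ => ⟨hσ', indicator_one_le ?_⟩
  rintro ⟨U, B, ⟨hUx, hU⟩, hB, hsub⟩
  obtain ⟨y, hy, hwy, hyX, hind⟩ := hB.exists_replacement hE hX₀ hXK hx hUx
  exact ⟨y, hsub hy, hwy, hyX, hind, fun i => hU i y (hB.mem y hy)⟩

/-- Some number `r ≤ K` of successful trials suffices for exchanging all of `x`. The potential of
the loop is the probability that the remaining trials contain enough successes for the elements
that are not exchanged yet. -/
theorem trials_spec {v t : ℕ} {M : Fin m → Matroid (Fin n)} {x : Fin t → Fin n}
    {F : Set (Finset (Fin n))} (hE : M₀.E = Set.univ) (h : Ready σ K L)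
    (hM : ∀ i, (L i).Represents (M i)) (h5 : σ.var 5 = v) (hrow : σ.row n 3 0 = ∅)
    (hKn : K ≤ n) (hK : 0 < n → 0 < K) (hD : n * n + 1 ≤ D) (hm : m ≤ D) (hv : v ≤ D)
    (hF : F = {X : Finset (Fin n) |
      M₀.Indep (X : Set (Fin n)) ∧ ∀ i, (M i).Indep (X : Set (Fin n))})
    (hx : Function.Injective x) (hxF : Finset.univ.image x ∈ F) (ht : t ≤ K) :
    ∃ r ≤ K, Triple (Env.ofMatroid M₀ w) trials σ (loopTime D (trialTime D))
      (fun σ' => (σ'.row n 3 0).card ≤ v * K)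
      (Set.indicator {σ' | Exchanged F w x (σ'.row n 3 0) t} 1)
      (successProb (((K : ℝ≥0∞)⁻¹) ^ (3 * Nat.log 2 K * m)) r v) := by
  classical
  set q := ((K : ℝ≥0∞)⁻¹) ^ (3 * Nat.log 2 K * m) with hq
  -- the length of a longest initial segment that can be exchanged
  set J : Store → ℕ := fun σ' => Nat.findGreatest (Exchanged F w x (σ'.row n 3 0)) t with hJ
  have hJt : ∀ σ', J σ' ≤ t := fun σ' => Nat.findGreatest_le t
  have hJspec : ∀ σ', Exchanged F w x (σ'.row n 3 0) (J σ') := fun σ' =>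
    Nat.findGreatest_spec (Nat.zero_le t) Exchanged.zero
  refine ⟨t - J σ, (Nat.sub_le _ _).trans ht, ?_⟩
  refine (Triple.times (N := v) (D := D) (t := trialTime D)
    (fun r σ' => (σ'.row n 3 0).card ≤ r * K)
    (fun r σ' => successProb q (t - J σ') (v - r)) (by decide) (fun σ' hag => ?_) hv ?_
    ?_).conseq (fun σ' hσ' _ => ⟨hσ', ?_⟩) le_rfl
  · rw [Expr.eval, hag.1 5 (by decide), h5]
  · change (σ.row n 3 0).card ≤ _
    simp [hrow]
  · intro r hr σ' hag _ hI
    have hcard : ∀ σ'' : Store, (σ''.row n 3 0).card ≤ (σ'.row n 3 0).card + K →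
        (σ''.row n 3 0).card ≤ (r + 1) * K := fun σ'' h => by
      rw [add_mul, one_mul]
      exact h.trans (Nat.add_le_add_right hI K)
    have h' := h.of_agree hag (by decide) (by decide)
    have hmono : ∀ σ'' : Store, σ'.row n 3 0 ⊆ σ''.row n 3 0 → J σ' ≤ J σ'' := fun σ'' hsub =>
      Nat.le_findGreatest (hJt σ') ((hJspec σ').mono hsub)
    rcases (hJt σ').eq_or_lt with hJe | hJl
    · refine (trial_sure hE h' hKn hK hD hm).triple fun σ'' hσ'' _ => ⟨hcard σ'' hσ''.2, ?_⟩
      have h1 : J σ'' = t := le_antisymm (hJt _) (hJe ▸ hmono σ'' hσ''.1)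
      change successProb q (t - J σ') _ ≤ successProb q (t - J σ'') _
      rw [h1, hJe, Nat.sub_self, successProb, successProb]
    · have hq1 : q ≤ 1 := pow_le_one₀ zero_le
        (ENNReal.inv_le_one.2 (by exact_mod_cast (Nat.zero_lt_of_lt hJl).trans_le ht))
      obtain ⟨X, hXF, hXt, hxX, hnext⟩ := Exchanged.exists_current hx hxF hJl (hJspec σ')
      have hXF' := hXF
      rw [hF] at hXF'
      have := (trial_spec (w := w) hE h' hM hXF'.1 hXF'.2 hxX (hXt.le.trans ht) hKn hD hm).convex
        (a := successProb q (t - J σ' - 1) (v - r - 1)) (b := successProb q (t - J σ') (v - r - 1))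
        (Φ := fun σ'' => successProb q (t - J (σ''.setVar 14 (r + 1))) (v - (r + 1)))
        (successProb_antitone hq1 _ (Nat.sub_le _ _)) ?_ ?_
      · refine this.conseq (fun σ'' hσ'' _ => ⟨hcard σ'' hσ''.2, le_rfl⟩) ?_
        rw [show t - J σ' = t - J σ' - 1 + 1 by omega, show v - r = v - r - 1 + 1 by omega,
          successProb]
        rfl
      · rintro σ'' hσ'' - ⟨y, hy, hwy, hyX, hy₀, hyM⟩
        have h1 : J σ' + 1 ≤ J σ'' := Nat.le_findGreatest hJl
          (hnext _ hσ''.1 y hy hwy hyX (by rw [hF]; exact ⟨hy₀, hyM⟩))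
        change _ ≤ successProb q (t - J σ'') (v - (r + 1))
        exact successProb_antitone hq1 _ (by omega)
      · intro σ'' hσ'' _
        have h1 := hmono σ'' hσ''.1
        change _ ≤ successProb q (t - J σ'') (v - (r + 1))
        exact successProb_antitone hq1 _ (by omega)
  · rw [Nat.sub_self]
    rcases (hJt σ').eq_or_lt with hJe | hJl
    · have hmem : σ' ∈ {σ' : Store | Exchanged F w x (σ'.row n 3 0) t} := by
        have := hJspec σ'
        rwa [hJe] at this
      rw [Set.indicator_of_mem hmem, Pi.one_apply, hJe, Nat.sub_self, successProb]
    · rw [show t - J σ' = t - J σ' - 1 + 1 by omega, successProb]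
      exact zero_le

end Trials

end Reach

section Kernel

variable {n m : ℕ}

/-- The number of trials times the size of a greedy set. -/
theorem numTrials_mul_le {K m : ℕ} (hK : 0 < K) :
    K ^ (4 * (m + 1) * Nat.log 2 K) * K ≤ K ^ (5 * (m + 1) * Nat.log 2 K) := by
  rcases (Nat.one_le_iff_ne_zero.2 hK.ne').eq_or_lt with rfl | hK2
  · simp
  · have hl : 0 < Nat.log 2 K := Nat.log_pos (by norm_num) hK2
    rw [← pow_succ]
    refine Nat.pow_le_pow_right hK ?_
    nlinarith [Nat.zero_le (m * Nat.log 2 K)]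

theorem reach_triple {env : Env n} {σ : Store} {k K v D : ℕ} {L : Fin m → LaminarRep (Fin n)}
    (hK : K = min k n) (hk : 1 ≤ k) (hvK : v = K ^ (4 * (m + 1) * Nat.log 2 K))
    (h0 : σ.var 0 = n) (h1 : σ.var 1 = k) (h2 : σ.var 2 = m) (hL : ∀ i : Fin m, Encodes σ i (L i))
    (hrow : σ.row n 3 0 = ∅) (hnD : n ≤ D) (hm : m + 1 ≤ D) (hD : 4 ≤ D)
    {G : Set (Finset (Fin n))} (hG : Finset.univ ∈ G) {u : ℝ≥0∞} (hu : u ≤ 1)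
    (htrials : ∀ τ : Store, Ready τ K L → τ.var 5 = v → v < n → τ.row n 3 0 = ∅ →
      Triple env trials τ (loopTime D (trialTime D)) (fun τ' => (τ'.row n 3 0).card ≤ v * K)
        (Set.indicator {τ' | τ'.row n 3 0 ∈ G} 1) u) :
    Triple env reach σ (reachTime D)
      (fun σ' => (σ'.row n 3 0).card ≤ K ^ (5 * (m + 1) * Nat.log 2 K))
      (Set.indicator {σ' | σ'.row n 3 0 ∈ G} 1) u := by
  have hKn : K ≤ n := hK ▸ min_le_right _ _
  have hK0 : 0 < n → 0 < K := fun hn => hK ▸ lt_min hk hn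
  have hKD := hKn.trans hnD
  have hlD := (Nat.log_le_self 2 K).trans hKD
  refine (Sure.seq_triple (setup_spec h0 h1 hnD)
    (T₂ := powerTime D + (loopTime D (trialTime D) + loopTime D 1 + 1) + 1)
    fun σ₁ hσ₁ hag₁ => ?_).le (by simp only [reachTime]; omega)
  rw [← hK] at hσ₁
  have h2₁ := (hag₁.1 2 (by decide)).trans h2
  refine Sure.seq_triple (power_spec h2₁ hσ₁.1 hσ₁.2 hKD hlD hm hD) fun σ₂ hσ₂ hag₂ => ?_
  have hready : Ready σ₂ K L := by
    refine ⟨?_, ?_, ?_, ?_, fun i => ((hL i).of_agree hag₁ (by decide)).of_agree hag₂ (by decide)⟩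
    · rw [hag₂.1 0 (by decide), hag₁.1 0 (by decide), h0]
    · rw [hag₂.1 2 (by decide), h2₁]
    · rw [hag₂.1 3 (by decide), hσ₁.1]
    · rw [hag₂.1 4 (by decide), hσ₁.2]
  rw [← hvK] at hσ₂
  have hrow₂ : σ₂.row n 3 0 = ∅ := by
    rw [← hrow]
    exact row_congr fun e => by rw [hag₂.2 3 (by decide), hag₁.2 3 (by decide)]
  refine Triple.cond (fun hc => ?_) fun hc => ?_
  · simp only [Expr.eval, hready.var_zero, hσ₂] at hc
    have hvn : v < n := by omega
    refine (htrials σ₂ hready hσ₂ hvn hrow₂).conseq (fun σ' hσ' _ => ⟨hσ'.trans ?_, le_rfl⟩) le_rfl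
      (by omega)
    rw [hvK]
    exact numTrials_mul_le (hK0 (by omega))
  · simp only [Expr.eval, hready.var_zero, hσ₂] at hc
    refine Triple.le (Sure.triple (outputAll_spec hready.var_zero hnD) fun σ' hσ' _ => ⟨?_, ?_⟩)
      (by omega)
    · rw [hσ', Finset.card_univ, Fintype.card_fin]
      rcases Nat.eq_zero_or_pos n with hn | hn
      · omega
      · refine le_trans (by omega) ((Nat.le_mul_of_pos_right v (hK0 hn)).trans ?_)
        rw [hvK]
        exact numTrials_mul_le (hK0 hn)
    · rw [Set.indicator_of_mem (by change _ ∈ G; rw [hσ']; exact hG)]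
      exact hu

theorem row_initialStore {k : ℕ} (L : Fin m → LaminarRep (Fin n)) :
    (initialStore k L).row n 3 0 = ∅ := by
  refine Finset.eq_empty_of_forall_notMem fun e he => mem_row.1 he ?_
  simp [initialStore]

/-- The program `reach` is a polynomial-time algorithm for reachable kernels. -/
theorem reachable_kernel_correct : ∃ (C : ℝ) (P : Cmd) (p : Polynomial ℕ),
    ∀ (d n k : ℕ), 1 ≤ d → 1 ≤ k →
      ∀ (M₀ : Matroid (Fin n)) (M : Fin (d - 1) → Matroid (Fin n))
        (L : Fin (d - 1) → LaminarRep (Fin n)) (w : Fin n → ℝ≥0),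
        M₀.E = Set.univ → (∀ i, (L i).Represents (M i)) →
        HaltsWithin ⟨fun S => M₀.Indep (S : Set (Fin n)), w⟩ P (initialStore k L)
          (p.eval (n + d)) ∧
        (∀ s ∈ (run ⟨fun S => M₀.Indep (S : Set (Fin n)), w⟩ (p.eval (n + d))
            ([P], initialStore k L)).support,
          ((outputSet n s).card : ℝ) ≤ (k : ℝ) ^ (C * d * Real.log k)) ∧
        IsReachableKernel
          {X | M₀.Indep (X : Set (Fin n)) ∧ ∀ i, (M i).Indep (X : Set (Fin n))} w k
          ((run ⟨fun S => M₀.Indep (S : Set (Fin n)), w⟩ (p.eval (n + d))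
            ([P], initialStore k L)).map (outputSet n)) := by
  refine ⟨(5 : ℕ) / Real.log 2, reach,
    reachTime (Polynomial.X * Polynomial.X + 4 : Polynomial ℕ), ?_⟩
  intro d n k hd hk M₀ M L w hE hM
  obtain ⟨m, rfl⟩ : ∃ m, d = m + 1 := ⟨d - 1, by omega⟩
  change Fin m → Matroid (Fin n) at M
  change Fin m → LaminarRep (Fin n) at L
  set D := (n + (m + 1)) * (n + (m + 1)) + 4 with hDdef
  have htime : (reachTime (Polynomial.X * Polynomial.X + 4 : Polynomial ℕ)).eval (n + (m + 1)) =
      reachTime D := by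
    simp [reachTime, powerTime, trialTime, guessTime, greedyTime, coinTime, loopTime, hDdef]
  rw [htime]
  have hnD : n ≤ D := by nlinarith
  have hmD : m + 1 ≤ D := by nlinarith
  have hD4 : 4 ≤ D := by omega
  have hnnD : n * n + 1 ≤ D := by nlinarith
  set K := min k n with hK
  set v := K ^ (4 * (m + 1) * Nat.log 2 K) with hv
  have hKn : K ≤ n := min_le_right _ _
  have hK0 : 0 < n → 0 < K := fun hn => lt_min hk hn
  set F : Set (Finset (Fin n)) :=
    {X : Finset (Fin n) | M₀.Indep (X : Set (Fin n)) ∧ ∀ i, (M i).Indep (X : Set (Fin n))} with hF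
  have hmain : ∀ (t : ℕ) (x : Fin t → Fin n), t ≤ k → Function.Injective x →
      Finset.univ.image x ∈ F → Halts (Env.ofMatroid M₀ w) ([reach], initialStore k L)
        (reachTime D) (fun σ' => (σ'.row n 3 0).card ≤ K ^ (5 * (m + 1) * Nat.log 2 K))
        (Set.indicator {σ' | Exchanged F w x (σ'.row n 3 0) t} 1) (2 / 3) := by
    intro t x htk hx hxF
    have htK : t ≤ K := le_min htk (by simpa using Fintype.card_le_of_injective x hx)
    have hself : ∀ i, exchanged x x i = Finset.univ.image x := fun i => by simp [exchanged]
    refine (reach_triple (G := {R | Exchanged F w x R t}) hK hk hv rfl rfl rfl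
      (encodes_initialStore L) (row_initialStore L) hnD hmD hD4 ?_ ?_
      fun τ hτ h5 hvn hrow => ?_).halts
    · refine ⟨x, fun i _ => ⟨Finset.mem_univ _, le_rfl, ?_, ?_⟩⟩
      · rw [hself, Finset.card_image_of_injective _ hx, Finset.card_univ, Fintype.card_fin]
      · rwa [hself]
    · rw [ENNReal.div_le_iff (by norm_num) (by norm_num)]
      norm_num
    · obtain ⟨r, hr, htrials⟩ := trials_spec (w := w) hE hτ hM h5 hrow hKn hK0 hnnD (by omega)
        (hvn.le.trans hnD) hF hx hxF htK
      exact htrials.conseq (fun _ h _ => ⟨h, le_rfl⟩)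
        (two_thirds_le_successProb (hK0 (by omega)) hr)
  -- the bounds on time and size do not depend on the sequence
  have hsure := hmain 0 Fin.elim0 (Nat.zero_le k) (fun i => i.elim0) (by simp [hF])
  refine ⟨fun s hs => (hsure.1 s hs).1, fun s hs => ?_, ?_⟩
  · calc ((outputSet n s).card : ℝ) ≤ ((K ^ (5 * (m + 1) * Nat.log 2 K) : ℕ) : ℝ) := by
          exact_mod_cast (hsure.1 s hs).2
      _ ≤ ((k ^ (5 * (m + 1) * Nat.log 2 k) : ℕ) : ℝ) := by
          refine Nat.cast_le.2 ?_
          rcases Nat.eq_zero_or_pos n with hn | hn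
          · rw [show K = 0 by omega, Nat.log_zero_right, mul_zero, pow_zero]
            exact Nat.one_le_pow _ _ hk
          · exact (Nat.pow_le_pow_right (hK0 hn) (Nat.mul_le_mul_left _
              (Nat.log_mono_right (min_le_left k n)))).trans
                (Nat.pow_le_pow_left (min_le_left k n) _)
      _ ≤ _ := by
          refine pow_le_rpow_of_le hk ((natCast_log_mul_le (5 * (m + 1)) k).trans (le_of_eq ?_))
          push_cast
          ring
  · intro t x htk hx hxF
    rw [PMF.toOuterMeasure_map_apply, ← expect_indicator]
    refine (hmain t x htk hx hxF).2.trans (expect_mono fun s _ => indicator_one_le ?_)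
    rintro ⟨y, hy⟩
    exact ⟨y, fun i => hy i i.2⟩

end Kernel

/-! ### Candidate sets and reachable kernels -/

theorem theorem5 :
    -- the procedure `FindCandidate`
    ((∀ (E : Type) [DecidableEq E] (𝓛 : Finset (Finset E)) (c : Finset E → ℕ) (k : ℕ)
        (Z : Finset (Finset E)) (i : ℕ),
        2 ≤ height c Z → (height c Z + 1) / 2 ≤ i → i < height c Z →
        ∀ Z' ∈ (doubleSample 𝓛 c k Z i).support, 2 * height c Z' ≤ height c Z) ∧
      ∃ C : ℝ, ∀ (E : Type) [Fintype E] [DecidableEq E] (k : ℕ), 1 ≤ k →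
        ∀ (M : Matroid E) (L : LaminarRep E), L.Represents M → (∀ e, M.Indep {e}) →
          (∀ 𝒴 ∈ (findCandidate (L.normSets k) (L.normCap k) k {Finset.univ}).support,
            (𝒴.card : ℝ) ≤ (k : ℝ) ^ (C * Real.log k)) ∧
          ∀ X : Finset E, M.Indep (X : Set E) → X.card ≤ k → ∀ x ∈ X,
            ENNReal.ofReal (1 / (k : ℝ) ^ (C * Real.log k)) ≤
              (findCandidate (L.normSets k) (L.normCap k) k {Finset.univ}).toOuterMeasure
                {𝒴 | ∃ Y ∈ 𝒴, IsExchangeable M X x Y}) ∧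
    -- a polynomial-time algorithm for candidate sets
    (∃ (C : ℝ) (P : Cmd) (p : Polynomial ℕ), ∀ (n k : ℕ), 1 ≤ k →
      ∀ (M : Matroid (Fin n)) (L : LaminarRep (Fin n)), L.Represents M →
        HaltsWithin (Env.trivial n) P (initialStore k fun _ : Fin 1 => L) (p.eval n) ∧
        (∀ s ∈ (run (Env.trivial n) (p.eval n)
            ([P], initialStore k fun _ : Fin 1 => L)).support,
          ((outputFamily n s).card : ℝ) ≤ (k : ℝ) ^ (C * Real.log k)) ∧
        ∀ X : Finset (Fin n), M.Indep (X : Set (Fin n)) → X.card ≤ k → ∀ x ∈ X,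
          ENNReal.ofReal (1 / (k : ℝ) ^ (C * Real.log k)) ≤
            (run (Env.trivial n) (p.eval n)
              ([P], initialStore k fun _ : Fin 1 => L)).toOuterMeasure
                {s | ∃ Y ∈ outputFamily n s, IsExchangeable M X x Y}) ∧
    -- a polynomial-time algorithm for reachable kernels
    (∃ (C : ℝ) (P : Cmd) (p : Polynomial ℕ), ∀ (d n k : ℕ), 1 ≤ d → 1 ≤ k →
      ∀ (M₀ : Matroid (Fin n)) (M : Fin (d - 1) → Matroid (Fin n))
        (L : Fin (d - 1) → LaminarRep (Fin n)) (w : Fin n → ℝ≥0),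
        M₀.E = Set.univ → (∀ i, (L i).Represents (M i)) →
        HaltsWithin ⟨fun S => M₀.Indep (S : Set (Fin n)), w⟩ P (initialStore k L)
          (p.eval (n + d)) ∧
        (∀ s ∈ (run ⟨fun S => M₀.Indep (S : Set (Fin n)), w⟩ (p.eval (n + d))
            ([P], initialStore k L)).support,
          ((outputSet n s).card : ℝ) ≤ (k : ℝ) ^ (C * d * Real.log k)) ∧
        IsReachableKernel
          {X | M₀.Indep (X : Set (Fin n)) ∧ ∀ i, (M i).Indep (X : Set (Fin n))} w k
          ((run ⟨fun S => M₀.Indep (S : Set (Fin n)), w⟩ (p.eval (n + d))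
            ([P], initialStore k L)).map (outputSet n))) := by
  refine ⟨⟨fun E _ 𝓛 c k Z i _ hi _ Z' hZ' => two_mul_height_le hi hZ',
    (4 : ℕ) / Real.log 2, fun E _ _ k hk M L hL hloop => ⟨fun 𝒴 h𝒴 => ?_,
      fun X hX hXk x hx => ?_⟩⟩, candidates_correct, reachable_kernel_correct⟩
  · have hh := L.height_univ_le hk
    have hcard := card_le_of_mem_support_findCandidateAux hh h𝒴
    calc (𝒴.card : ℝ) ≤ ((k ^ (4 * Nat.log 2 k) : ℕ) : ℝ) := by
          refine Nat.cast_le.2 (hcard.trans (Nat.pow_le_pow_right hk ?_))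
          have := Nat.log_mono_right (b := 2) hh
          omega
      _ ≤ _ := pow_le_rpow_of_le hk (natCast_log_mul_le 4 k)
  · exact (ofReal_inv_rpow_le hk (natCast_log_mul_le 4 k)).trans
      (L.le_toOuterMeasure_findCandidate hL hloop hX hXk hx)
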